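/- Let $N\ge 1$ be an integer, $s\in(0,1)$, $\mathbb R^{N+1}_+=\{(t,x): t>0,\ x\in\mathbb R^N\}$ and $B^{N+1}_+(0,R)=\{(t,x)\in\mathbb R^{N+1}_+: t^2+|x|^2<R^2\}$. Let $\mathcal L^1_s$ be the space of measurable $u:\mathbb R^N\to\mathbb R$ with $\int_{\mathbb R^N}\frac{|u|}{1+|x|^{N+2s}}\,dx<\infty$. For $\varphi\in C_c^\infty(\mathbb R^N)$, $(-\Delta)^s\varphi$ is the function with Fourier transform $|\zeta|^{2s}\widehat\varphi(\zeta)$ (where $\widehat\varphi(\zeta)=(2\pi)^{-N/2}\int e^{-i\zeta\cdot x}\varphi(x)\,dx$); for $u\in\mathcal L^1_s$ and an open set $G$, $(-\Delta)^su\in\mathcal D'(G)$ is given by $\langle(-\Delta)^su,\varphi\rangle=\int_{\mathbb R^N}u\,(-\Delta)^s\varphi\,dx$, $\varphi\in C_c^\infty(G)$. Put $$\gamma_\alpha=2^{2s}\,\frac{\Gamma\left(\frac{N+2s+2\alpha}{4}\right)}{\Gamma\left(\frac{N-2s-2\alpha}{4}\right)}\,\frac{\Gamma\left(\frac{N+2s-2\alpha}{4}\right)}{\Gamma\left(\frac{N-2s+2\alpha}{4}\right)}\quad\left(\tfrac1{\Gamma(0)}:=0\right),\qquad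 \kappa_s=\frac{\Gamma(1-s)}{2^{2s-1}\Gamma(s)},$$ $$P(t,x)=\frac{p_{N,s}\,t^{2s}}{(|x|^2+t^2)^{(N+2s)/2}},\qquad p_{N,s}=\left(\int_{\mathbb R^N}\frac{dx}{(|x|^2+1)^{(N+2s)/2}}\right)^{-1}.$$ On $[0,\frac N2-s)$ (which may be empty) the function $\alpha\mapsto\gamma_\alpha$ is continuous and strictly decreasing. Moreover, for every $\alpha\in(-\frac N2-s,\frac N2-s)$ the function $\vartheta_\alpha(x)=|x|^{\frac{2s-N}{2}+\alpha}$ belongs to $\mathcal L^1_s$ and satisfies $$(-\Delta)^s\vartheta_\alpha=\gamma_\alpha|x|^{-2s}\vartheta_\alpha\quad\text{in }\mathcal D'(\mathbb R^N\setminus\{0\}),$$ and its Poisson extension $\Upsilon_\alpha$, defined by $\Upsilon_\alpha(t,x)=\int_{\mathbb R^N}P(t,x-y)\vartheta_\alpha(y)\,dy$ for $t>0$ and $\Upsilon_\alpha(0,x)=\vartheta_\alpha(x)$ for $x\ne0$, has the following properties. 1. $\Upsilon_\alpha$ is positive on $\overline{\mathbb R^{N+1}_+}\setminus\{0\}$,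 and there is $\beta\in(0,1)$ with $\Upsilon_\alpha\in C^\beta(\overline{\mathbb R^{N+1}_+}\setminus\{0\})$, that is, $\Upsilon_\alpha$ is $\beta$-Hölder continuous on every compact subset of $\overline{\mathbb R^{N+1}_+}\setminus\{0\}$. 2. $\Upsilon_\alpha$ is smooth in $\mathbb R^{N+1}_+$ and $$\begin{cases}\operatorname{div}(t^{1-2s}\nabla\Upsilon_\alpha)=0&\text{in }\mathbb R^{N+1}_+,\\ \Upsilon_\alpha=\vartheta_\alpha&\text{on }\partial\mathbb R^{N+1}_+\setminus\{0\},\\ -\lim_{t\to0^+}t^{1-2s}\dfrac{\partial\Upsilon_\alpha}{\partial t}(t,x)=\kappa_s\gamma_\alpha|x|^{-2s}\vartheta_\alpha(x)=\kappa_s(-\Delta)^s\vartheta_\alpha&\text{on }\mathbb R^N\setminus\{0\},\end{cases}$$ where the limit is locally uniform in $x\in\mathbb R^N\setminus\{0\}$. 3. If $\alpha>0$, then $\int_{B^{N+1}_+(0,R)}t^{1-2s}|\nabla\Upsilon_\alpha|^2\,dt\,dx<\infty$ for every $R>0$. -/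

import Mathlib

open MeasureTheory Set Filter Topology
open scoped ContDiff FourierTransform

noncomputable section

/-- The space `𝓛¹_s` of measurable `u : ℝᴺ → ℝ` with `∫ |u| / (1 + |x|^(N+2s)) dx < ∞`. -/
def MemL1s {N : ℕ} (s : ℝ) (u : EuclideanSpace ℝ (Fin N) → ℝ) : Prop :=
  AEStronglyMeasurable u ∧ Integrable (fun x => |u x| / (1 + ‖x‖ ^ ((N : ℝ) + 2 * s)))

/-- The fractional Laplacian of a test function, i.e. the Fourier multiplier operator with
symbol `|ζ|^(2s)` (for the kernel `exp(-i ζ·x)`). Mathlib's Fourier transform has the kernel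
`exp(-2πi ξ·x)`, so that `ζ = 2π ξ`. -/
def fracLaplacian {N : ℕ} (s : ℝ) (φ : EuclideanSpace ℝ (Fin N) → ℂ) :
    EuclideanSpace ℝ (Fin N) → ℂ :=
  𝓕⁻ (fun ξ : EuclideanSpace ℝ (Fin N) => (((2 * Real.pi * ‖ξ‖) ^ (2 * s) : ℝ) : ℂ) * 𝓕 φ ξ)

/-- `(-Δ)^s u = f` in the sense of distributions on the open set `G`, for `u ∈ 𝓛¹_s` and
`f` locally integrable on `G`:
`∫ u (-Δ)^s φ dx = ∫ f φ dx` for all `φ ∈ C_c^∞(G)`, where the left integral converges. -/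
def FracLaplacianEqOn {N : ℕ} (s : ℝ) (G : Set (EuclideanSpace ℝ (Fin N)))
    (u f : EuclideanSpace ℝ (Fin N) → ℝ) : Prop :=
  MemL1s s u ∧ LocallyIntegrableOn f G ∧
    ∀ φ : EuclideanSpace ℝ (Fin N) → ℂ, ContDiff ℝ ∞ φ → HasCompactSupport φ → tsupport φ ⊆ G →
      Integrable (fun x => (u x : ℂ) * fracLaplacian s φ x) ∧
        ∫ x, (u x : ℂ) * fracLaplacian s φ x = ∫ x, (f x : ℂ) * φ x

/-- `ϑ_α(x) = |x|^((2s-N)/2 + α)`. -/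
def powerFun (N : ℕ) (s α : ℝ) (x : EuclideanSpace ℝ (Fin N)) : ℝ :=
  ‖x‖ ^ ((2 * s - N) / 2 + α)

/-- The constant `γ_α`. For `-N/2 - s < α < N/2 - s` the only Gamma factor that can meet a pole is
the last one, at `N - 2s + 2α = 0`; there `1/Γ(0)` is `0` as usual (and so it is in Lean). -/
def hardyGamma (N : ℕ) (s α : ℝ) : ℝ :=
  2 ^ (2 * s) *
    (Real.Gamma ((N + 2 * s + 2 * α) / 4) / Real.Gamma ((N - 2 * s - 2 * α) / 4)) *
    (Real.Gamma ((N + 2 * s - 2 * α) / 4) / Real.Gamma ((N - 2 * s + 2 * α) / 4))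

/-- The constant `κ_s = Γ(1-s) / (2^(2s-1) Γ(s))`. -/
def kappa (s : ℝ) : ℝ :=
  Real.Gamma (1 - s) / (2 ^ (2 * s - 1) * Real.Gamma s)

/-- The normalization constant `p_{N,s}` of the Poisson kernel, for which `∫ P(t, x) dx = 1`. -/
def poissonConst (N : ℕ) (s : ℝ) : ℝ :=
  (∫ x : EuclideanSpace ℝ (Fin N), 1 / (‖x‖ ^ 2 + 1) ^ (((N : ℝ) + 2 * s) / 2))⁻¹

/-- The Poisson kernel `P(t, x) = p_{N,s} t^(2s) / (|x|² + t²)^((N+2s)/2)` of the half-space. -/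
def halfSpacePoissonKernel {N : ℕ} (s t : ℝ) (x : EuclideanSpace ℝ (Fin N)) : ℝ :=
  poissonConst N s * t ^ (2 * s) / (‖x‖ ^ 2 + t ^ 2) ^ (((N : ℝ) + 2 * s) / 2)

/-- The Poisson extension of `u` to the closed half-space `{(t, x) : t ≥ 0}`: the convolution
`P(t, ·) * u` for `t > 0` and `u` itself on the boundary. (Values at `t < 0` play no role.) -/
def poissonExtension {N : ℕ} (s : ℝ) (u : EuclideanSpace ℝ (Fin N) → ℝ)
    (z : ℝ × EuclideanSpace ℝ (Fin N)) : ℝ :=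
  if 0 < z.1 then ∫ y, halfSpacePoissonKernel s z.1 (z.2 - y) * u y else u z.2

/-- `∂U/∂t (t, x)`. -/
def partialT {N : ℕ} (U : ℝ × EuclideanSpace ℝ (Fin N) → ℝ)
    (t : ℝ) (x : EuclideanSpace ℝ (Fin N)) : ℝ :=
  deriv (fun τ => U (τ, x)) t

/-- `∂U/∂x_i (t, x)`. -/
def partialX {N : ℕ} (i : Fin N) (U : ℝ × EuclideanSpace ℝ (Fin N) → ℝ)
    (t : ℝ) (x : EuclideanSpace ℝ (Fin N)) : ℝ :=
  fderiv ℝ (fun y => U (t, y)) x (EuclideanSpace.single i 1)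

/-- `div(t^(1-2s) ∇U) (t, x)`, divergence and gradient being taken in all the variables `(t, x)`. -/
def weightedDiv {N : ℕ} (s : ℝ) (U : ℝ × EuclideanSpace ℝ (Fin N) → ℝ)
    (t : ℝ) (x : EuclideanSpace ℝ (Fin N)) : ℝ :=
  partialT (fun z => z.1 ^ (1 - 2 * s) * partialT U z.1 z.2) t x +
    ∑ i, partialX i (fun z => z.1 ^ (1 - 2 * s) * partialX i U z.1 z.2) t x

/-- `|∇U|² (t, x)`, the gradient being taken in all the variables `(t, x)`. -/
def gradSq {N : ℕ} (U : ℝ × EuclideanSpace ℝ (Fin N) → ℝ)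
    (t : ℝ) (x : EuclideanSpace ℝ (Fin N)) : ℝ :=
  partialT U t x ^ 2 + ∑ i, partialX i U t x ^ 2

/-- The open half-space `ℝ^(N+1)_+ = {(t, x) : t > 0}`. -/
def upperHalf (N : ℕ) : Set (ℝ × EuclideanSpace ℝ (Fin N)) := {z | 0 < z.1}

/-- The closed half-space without the origin. -/
def closedUpperHalfPunctured (N : ℕ) : Set (ℝ × EuclideanSpace ℝ (Fin N)) :=
  {z | 0 ≤ z.1 ∧ z ≠ 0}

/-- The Euclidean half-ball `B^(N+1)_+(0, R)`. -/
def upperHalfBall (N : ℕ) (R : ℝ) : Set (ℝ × EuclideanSpace ℝ (Fin N)) :=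
  {z | 0 < z.1 ∧ z.1 ^ 2 + ‖z.2‖ ^ 2 < R ^ 2}

/-- `U ∈ C^β(S)`: `U` is `β`-Hölder continuous on every compact subset of `S`. (The product metric
of `ℝ × ℝᴺ` is equivalent to the Euclidean one, so only the constants depend on this choice.) -/
def LocallyHolderOn {N : ℕ} (β : NNReal) (U : ℝ × EuclideanSpace ℝ (Fin N) → ℝ)
    (S : Set (ℝ × EuclideanSpace ℝ (Fin N))) : Prop :=
  ∀ K : Set (ℝ × EuclideanSpace ℝ (Fin N)), IsCompact K → K ⊆ S →
    ∃ C : NNReal, HolderOnWith C β U K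

end

/-! Put `a = N/2 - s - α`, so that `ϑ_α = |x|^(-a)` with `0 < a < N`. Everything rests on an
explicit formula for the extension. Writing both `(|x-y|² + T)^(-(N/2+s))` and `|y|^(-a)` as Gamma
integrals of Gaussians and integrating out `y` and one parameter gives, with `T = t²`, `X = |x|²`,
`b = (N-a)/2`, `Υ = c ∫₀^∞ v^(b-1) (v+T)^(-(b-s)) (v+T+X)^(-(a/2+s)) dv`
(`lintegral_rpow_mul_norm_rpow`, `integrable_poisson_power`).

Positivity is then visible. Differentiating in `T` or `X` only shifts the exponents, which gives
smoothness, and one integration by parts in `v` gives the extension equation in the form `T g_TT +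
(1-s) g_T + X g_XX + (N/2) g_X = 0` (`eulerIntegral_equation`). At `T = 0` the integral is a Beta
integral equal to the boundary value. The bounds `|g_T| ≤ K (T+X)^(-(a/2+s)) T^(s-1)` and `|g_X| ≤ K
(T+X)^(-(a/2+1))` yield Hölder continuity of order `s` and, when `2a + 2s < N`, that is `α > 0`, the
weighted square integrability of the gradient. The scaling `v = Tw` gives the limit of `T^(1-s)
g_T`, hence the conormal derivative and the constant `γ_α`.

For the distributional equation the Poisson semigroup is tested directly. The Fourier transform of
the kernel is `1 - T^s m_T(ξ)` with `m_T` bounded by, and tending to, a multiple of `|ξ|^(2s)`; so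
`(φ - P_t * φ) / t^(2s)` tends to a multiple of `(-Δ)^s φ`, dominated by `C / (1 + |x|^(N+2s))`
(`exists_norm_sub_poissonConv_le`). By symmetry of the kernel, pairing this quotient with `ϑ` equals
pairing `(ϑ - Υ(t,·)) / t^(2s)` with `φ`, whose limit is read off from `g_T` by l'Hôpital. Equating
the two limits gives the equation with the same `γ_α`.

Monotonicity of `γ_α` comes from Euler's product for Gamma: each factor of the resulting product
decreases in `α`. -/

/-! ### Gamma and Beta integrals. -/

lemma lintegral_rpow_mul_exp_neg {c A : ℝ} (hc : 0 < c) (hA : 0 < A) :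
    ∫⁻ x in Ioi (0 : ℝ), ENNReal.ofReal (x ^ (c - 1) * Real.exp (-(A * x))) =
      ENNReal.ofReal (Real.Gamma c * A ^ (-c)) := by
  have h := Real.integral_rpow_mul_exp_neg_mul_Ioi hc hA
  have hpos : 0 < (1 / A) ^ c * Real.Gamma c :=
    mul_pos (Real.rpow_pos_of_pos (by positivity) _) (Real.Gamma_pos_of_pos hc)
  have hint : IntegrableOn (fun x : ℝ => x ^ (c - 1) * Real.exp (-(A * x))) (Ioi 0) :=
    Integrable.of_integral_ne_zero (by rw [h]; exact hpos.ne')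
  rw [← ofReal_integral_eq_lintegral_ofReal hint, h, one_div, Real.inv_rpow hA.le,
    Real.rpow_neg hA.le, mul_comm]
  filter_upwards [ae_restrict_mem measurableSet_Ioi] with x hx
  have hx : 0 < x := hx
  positivity

/-- Turns a negative power into a superposition of exponentials. It is stated in `ENNReal` so that
Tonelli can exchange integrals before any integrability is known. -/
lemma ofReal_rpow_neg_eq_lintegral {c A : ℝ} (hc : 0 < c) (hA : 0 < A) :
    ENNReal.ofReal (A ^ (-c)) = ENNReal.ofReal (Real.Gamma c)⁻¹ *
      ∫⁻ x in Ioi (0 : ℝ), ENNReal.ofReal (x ^ (c - 1) * Real.exp (-(A * x))) := by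
  have h := Real.Gamma_pos_of_pos hc
  rw [lintegral_rpow_mul_exp_neg hc hA, ← ENNReal.ofReal_mul (by positivity)]
  congr 1
  field_simp

/-- The Beta integral: expand `(v+E)^(-r)` as a Gamma integral, integrate in `v` first, then in the
parameter. -/
lemma lintegral_rpow_mul_add_rpow {b r E : ℝ} (hb : 0 < b) (hr : b < r) (hE : 0 < E) :
    ∫⁻ v in Ioi (0 : ℝ), ENNReal.ofReal (v ^ (b - 1) * (v + E) ^ (-r)) =
      ENNReal.ofReal (E ^ (b - r) * (Real.Gamma b * Real.Gamma (r - b) / Real.Gamma r)) := by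
  have hr0 : 0 < r := hb.trans hr
  have hΓ := Real.Gamma_pos_of_pos hr0
  have hΓb := Real.Gamma_pos_of_pos hb
  calc ∫⁻ v in Ioi (0 : ℝ), ENNReal.ofReal (v ^ (b - 1) * (v + E) ^ (-r))
      = ∫⁻ v in Ioi (0 : ℝ), ∫⁻ x in Ioi (0 : ℝ), ENNReal.ofReal (Real.Gamma r)⁻¹ *
          (ENNReal.ofReal (x ^ (r - 1) * Real.exp (-(E * x))) *
            ENNReal.ofReal (v ^ (b - 1) * Real.exp (-(x * v)))) := by
        refine setLIntegral_congr_fun measurableSet_Ioi fun v (hv : 0 < v) => ?_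
        rw [ENNReal.ofReal_mul (by positivity),
          ofReal_rpow_neg_eq_lintegral hr0 (by positivity : 0 < v + E), mul_left_comm,
          lintegral_const_mul _ (by fun_prop), ← lintegral_const_mul _ (by fun_prop)]
        congr 1
        refine setLIntegral_congr_fun measurableSet_Ioi fun x (hx : 0 < x) => ?_
        rw [← ENNReal.ofReal_mul (by positivity), ← ENNReal.ofReal_mul (by positivity),
          show -((v + E) * x) = -(E * x) + -(x * v) by ring, Real.exp_add]
        congr 1
        ring
    _ = ∫⁻ x in Ioi (0 : ℝ), ENNReal.ofReal (Real.Gamma r)⁻¹ *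
          (ENNReal.ofReal (x ^ (r - 1) * Real.exp (-(E * x))) *
            ENNReal.ofReal (Real.Gamma b * x ^ (-b))) := by
        rw [lintegral_lintegral_swap (by fun_prop)]
        refine setLIntegral_congr_fun measurableSet_Ioi fun x (hx : 0 < x) => ?_
        rw [lintegral_const_mul _ (by fun_prop), lintegral_const_mul _ (by fun_prop),
          lintegral_rpow_mul_exp_neg hb hx]
    _ = ENNReal.ofReal ((Real.Gamma r)⁻¹ * Real.Gamma b) *
          ∫⁻ x in Ioi (0 : ℝ), ENNReal.ofReal (x ^ (r - b - 1) * Real.exp (-(E * x))) := by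
        rw [← lintegral_const_mul _ (by fun_prop)]
        refine setLIntegral_congr_fun measurableSet_Ioi fun x (hx : 0 < x) => ?_
        rw [← ENNReal.ofReal_mul (by positivity), ← ENNReal.ofReal_mul (by positivity),
          ← ENNReal.ofReal_mul (by positivity),
          show r - b - 1 = (r - 1) + (-b) by ring, Real.rpow_add hx]
        congr 1
        ring
    _ = _ := by
        rw [lintegral_rpow_mul_exp_neg (by linarith) hE, ← ENNReal.ofReal_mul (by positivity),
          neg_sub]
        congr 1
        ring

lemma integrableOn_and_integral_of_lintegral {f : ℝ → ℝ} {C : ℝ} (hf : Measurable f)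
    (hf0 : ∀ v, 0 < v → 0 ≤ f v) (hC : 0 ≤ C)
    (h : ∫⁻ v in Ioi (0 : ℝ), ENNReal.ofReal (f v) = ENNReal.ofReal C) :
    IntegrableOn f (Ioi 0) ∧ ∫ v in Ioi (0 : ℝ), f v = C := by
  have h0 : 0 ≤ᵐ[volume.restrict (Ioi (0 : ℝ))] f := by
    filter_upwards [ae_restrict_mem measurableSet_Ioi] with v hv using hf0 v hv
  refine ⟨⟨hf.aestronglyMeasurable, ?_⟩, ?_⟩
  · rw [hasFiniteIntegral_iff_ofReal h0, h]
    exact ENNReal.ofReal_lt_top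
  · rw [integral_eq_lintegral_of_nonneg_ae h0 hf.aestronglyMeasurable, h,
      ENNReal.toReal_ofReal hC]

lemma rpow_mul_add_rpow_integral {b r E : ℝ} (hb : 0 < b) (hr : b < r) (hE : 0 < E) :
    IntegrableOn (fun v : ℝ => v ^ (b - 1) * (v + E) ^ (-r)) (Ioi 0) ∧
    ∫ v in Ioi (0 : ℝ), v ^ (b - 1) * (v + E) ^ (-r) =
      E ^ (b - r) * (Real.Gamma b * Real.Gamma (r - b) / Real.Gamma r) := by
  have h1 := Real.Gamma_pos_of_pos hb
  have h2 := Real.Gamma_pos_of_pos (sub_pos.2 hr)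
  have h3 := Real.Gamma_pos_of_pos (hb.trans hr)
  refine integrableOn_and_integral_of_lintegral (by fun_prop) (fun v hv => by positivity)
    (by positivity) (lintegral_rpow_mul_add_rpow hb hr hE)

lemma lintegral_Ioi_comp_const_div {c : ℝ} (hc : 0 < c) (f : ℝ → ENNReal) :
    ∫⁻ x in Ioi (0 : ℝ), f x = ∫⁻ v in Ioi (0 : ℝ), ENNReal.ofReal (c / v ^ 2) * f (c / v) := by
  have himg : (fun v : ℝ => c / v) '' Ioi 0 = Ioi 0 := by
    ext x
    constructor
    · rintro ⟨v, hv, rfl⟩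
      exact div_pos hc hv
    · intro hx
      have hx : 0 < x := hx
      exact ⟨c / x, div_pos hc hx, by field_simp⟩
  have h := lintegral_image_eq_lintegral_abs_deriv_mul (s := Ioi (0 : ℝ)) (f := fun v => c / v)
    (f' := fun v => -(c / v ^ 2)) measurableSet_Ioi (fun v (hv : 0 < v) => ?_) ?_ f
  · rw [himg] at h
    rw [h]
    refine setLIntegral_congr_fun measurableSet_Ioi fun v (hv : 0 < v) => ?_
    rw [abs_neg, abs_of_pos (by positivity)]
  · have := ((hasDerivAt_inv hv.ne').const_mul c).hasDerivWithinAt (s := Ioi 0)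
    convert! this using 1
    ring
  · intro v hv w hw hvw
    have hv : 0 < v := hv
    have hw : 0 < w := hw
    simp only at hvw
    field_simp at hvw
    exact hvw.symm

/-! ### Gaussian superposition and the Poisson integral of a power. -/

section Gaussian
variable {N : ℕ}

lemma lintegral_gaussian {σ : ℝ} (hσ : 0 < σ) :
    ∫⁻ y : EuclideanSpace ℝ (Fin N), ENNReal.ofReal (Real.exp (-(σ * ‖y‖ ^ 2))) =
      ENNReal.ofReal ((Real.pi / σ) ^ ((N : ℝ) / 2)) := by
  have h := GaussianFourier.integral_rexp_neg_mul_sq_norm (V := EuclideanSpace ℝ (Fin N)) hσ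
  simp only [finrank_euclideanSpace, Fintype.card_fin, neg_mul] at h
  have hpos : 0 < (Real.pi / σ) ^ ((N : ℝ) / 2) :=
    Real.rpow_pos_of_pos (div_pos Real.pi_pos hσ) _
  have hint : Integrable (fun y : EuclideanSpace ℝ (Fin N) => Real.exp (-(σ * ‖y‖ ^ 2))) :=
    Integrable.of_integral_ne_zero (by rw [h]; exact hpos.ne')
  rw [← ofReal_integral_eq_lintegral_ofReal hint (ae_of_all _ fun y => (Real.exp_pos _).le), h]

lemma mul_norm_sub_sq_add_mul_norm_sq {σ τ : ℝ} (hσ : 0 < σ) (hτ : 0 < τ)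
    (x y : EuclideanSpace ℝ (Fin N)) :
    σ * ‖x - y‖ ^ 2 + τ * ‖y‖ ^ 2 =
      (σ + τ) * ‖y - (σ / (σ + τ)) • x‖ ^ 2 + σ * τ / (σ + τ) * ‖x‖ ^ 2 := by
  have : σ + τ ≠ 0 := by positivity
  rw [norm_sub_sq_real, norm_sub_sq_real, inner_smul_right, norm_smul, mul_pow, Real.norm_eq_abs,
    sq_abs, real_inner_comm]
  field_simp
  ring

lemma lintegral_gaussian_conv {σ τ : ℝ} (hσ : 0 < σ) (hτ : 0 < τ)
    (x : EuclideanSpace ℝ (Fin N)) :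
    ∫⁻ y, ENNReal.ofReal (Real.exp (-(σ * ‖x - y‖ ^ 2)) * Real.exp (-(τ * ‖y‖ ^ 2))) =
      ENNReal.ofReal ((Real.pi / (σ + τ)) ^ ((N : ℝ) / 2) *
        Real.exp (-(σ * τ / (σ + τ) * ‖x‖ ^ 2))) := by
  have hst : 0 < σ + τ := by positivity
  have h : ∀ y : EuclideanSpace ℝ (Fin N),
      ENNReal.ofReal (Real.exp (-(σ * ‖x - y‖ ^ 2)) * Real.exp (-(τ * ‖y‖ ^ 2))) =
      ENNReal.ofReal (Real.exp (-((σ + τ) * ‖y - (σ / (σ + τ)) • x‖ ^ 2))) *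
        ENNReal.ofReal (Real.exp (-(σ * τ / (σ + τ) * ‖x‖ ^ 2))) := by
    intro y
    rw [← ENNReal.ofReal_mul (Real.exp_pos _).le, ← Real.exp_add, ← Real.exp_add, ← neg_add,
      ← neg_add, mul_norm_sub_sq_add_mul_norm_sq hσ hτ]
  simp_rw [h]
  rw [lintegral_mul_const _ (by fun_prop),
    lintegral_sub_right_eq_self (μ := volume)
      (fun y : EuclideanSpace ℝ (Fin N) => ENNReal.ofReal (Real.exp (-((σ + τ) * ‖y‖ ^ 2)))),
    lintegral_gaussian hst, ENNReal.ofReal_mul (by positivity)]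

/-- Mixing Gaussians over their width reduces the integral to a one-dimensional Gamma integral; at
`T = 1` this evaluates `p_{N,s}`. -/
lemma lintegral_norm_sq_add_rpow {s T : ℝ} (hs : 0 < s) (hT : 0 < T) :
    ∫⁻ y : EuclideanSpace ℝ (Fin N), ENNReal.ofReal ((‖y‖ ^ 2 + T) ^ (-((N : ℝ) / 2 + s))) =
      ENNReal.ofReal (Real.pi ^ ((N : ℝ) / 2) * Real.Gamma s / Real.Gamma ((N : ℝ) / 2 + s) *
        T ^ (-s)) := by
  have hM : 0 < (N : ℝ) / 2 + s := by positivity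
  have hΓ := Real.Gamma_pos_of_pos hM
  have hΓs := Real.Gamma_pos_of_pos hs
  have hπ := Real.pi_pos
  calc ∫⁻ y : EuclideanSpace ℝ (Fin N), ENNReal.ofReal ((‖y‖ ^ 2 + T) ^ (-((N : ℝ) / 2 + s)))
      = ∫⁻ y : EuclideanSpace ℝ (Fin N), ∫⁻ σ in Ioi (0 : ℝ),
          ENNReal.ofReal (Real.Gamma ((N : ℝ) / 2 + s))⁻¹ *
          (ENNReal.ofReal (σ ^ ((N : ℝ) / 2 + s - 1) * Real.exp (-(T * σ))) *
            ENNReal.ofReal (Real.exp (-(σ * ‖y‖ ^ 2)))) := by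
        refine lintegral_congr fun y => ?_
        rw [ofReal_rpow_neg_eq_lintegral hM (by positivity), ← lintegral_const_mul _ (by fun_prop)]
        refine setLIntegral_congr_fun measurableSet_Ioi fun σ (hσ : 0 < σ) => ?_
        rw [← ENNReal.ofReal_mul (p := σ ^ _ * _) (by positivity), mul_assoc, ← Real.exp_add]
        ring_nf
    _ = ∫⁻ σ in Ioi (0 : ℝ), ENNReal.ofReal (Real.pi ^ ((N : ℝ) / 2) *
          (Real.Gamma ((N : ℝ) / 2 + s))⁻¹) *
          ENNReal.ofReal (σ ^ (s - 1) * Real.exp (-(T * σ))) := by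
        rw [lintegral_lintegral_swap (by fun_prop)]
        refine setLIntegral_congr_fun measurableSet_Ioi fun σ (hσ : 0 < σ) => ?_
        rw [lintegral_const_mul _ (by fun_prop), lintegral_const_mul _ (by fun_prop),
          lintegral_gaussian hσ, ← ENNReal.ofReal_mul (by positivity),
          ← ENNReal.ofReal_mul (by positivity), ← ENNReal.ofReal_mul (by positivity),
          Real.div_rpow hπ.le hσ.le,
          show (N : ℝ) / 2 + s - 1 = (s - 1) + N / 2 by ring, Real.rpow_add hσ]
        congr 1
        field_simp
    _ = _ := by
        rw [lintegral_const_mul _ (by fun_prop), lintegral_rpow_mul_exp_neg hs hT,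
          ← ENNReal.ofReal_mul (by positivity)]
        congr 1
        ring

lemma poissonConst_eq {s : ℝ} (hs : 0 < s) :
    poissonConst N s =
      Real.Gamma ((N : ℝ) / 2 + s) / (Real.pi ^ ((N : ℝ) / 2) * Real.Gamma s) := by
  have hΓ := Real.Gamma_pos_of_pos (show 0 < (N : ℝ) / 2 + s by positivity)
  have hΓs := Real.Gamma_pos_of_pos hs
  have hπ := Real.pi_pos
  have h : ∀ x : EuclideanSpace ℝ (Fin N), 1 / (‖x‖ ^ 2 + 1) ^ (((N : ℝ) + 2 * s) / 2) =
      (‖x‖ ^ 2 + 1) ^ (-((N : ℝ) / 2 + s)) := by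
    intro x
    rw [Real.rpow_neg (by positivity), one_div]
    ring_nf
  simp only [poissonConst, h]
  rw [integral_eq_lintegral_of_nonneg_ae (ae_of_all _ fun x => by positivity)
    (by fun_prop : Measurable _).aestronglyMeasurable, lintegral_norm_sq_add_rpow hs one_pos,
    ENNReal.toReal_ofReal (by positivity), Real.one_rpow, mul_one, inv_div]

/-- Both powers become Gamma integrals in `σ` and `τ`, and the `y`-integral becomes a convolution of
two Gaussians. After a change of the variable `τ`, the `σ`-integral is again a Gamma integral,
leaving a single integral in `v`. -/
lemma lintegral_rpow_mul_norm_rpow {s a T : ℝ} (hN : 0 < N) (hs : 0 < s) (ha : 0 < a)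
    (hT : 0 < T) (x : EuclideanSpace ℝ (Fin N)) :
    ∫⁻ y, ENNReal.ofReal ((‖x - y‖ ^ 2 + T) ^ (-((N : ℝ) / 2 + s)) * ‖y‖ ^ (-a)) =
      ENNReal.ofReal (Real.pi ^ ((N : ℝ) / 2) * Real.Gamma (a / 2 + s) * T ^ (-s) /
        (Real.Gamma ((N : ℝ) / 2 + s) * Real.Gamma (a / 2))) *
      ∫⁻ v in Ioi (0 : ℝ), ENNReal.ofReal (v ^ (((N : ℝ) - a) / 2 - 1) *
        (v + T) ^ (-(((N : ℝ) - a) / 2 - s)) * (v + T + ‖x‖ ^ 2) ^ (-(a / 2 + s))) := by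
  have hM : 0 < (N : ℝ) / 2 + s := by positivity
  have ha2 : 0 < a / 2 := by positivity
  have hm : 0 < a / 2 + s := by positivity
  have hΓ := Real.Gamma_pos_of_pos hM
  have hΓa := Real.Gamma_pos_of_pos ha2
  have hΓm := Real.Gamma_pos_of_pos hm
  have hπ := Real.pi_pos
  have : Nontrivial (EuclideanSpace ℝ (Fin N)) := by
    have : Nonempty (Fin N) := ⟨⟨0, hN⟩⟩
    infer_instance
  obtain ⟨C, hC⟩ : ∃ C : ENNReal, C = ENNReal.ofReal
      ((Real.Gamma ((N : ℝ) / 2 + s))⁻¹ * (Real.Gamma (a / 2))⁻¹) := ⟨_, rfl⟩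
  calc ∫⁻ y, ENNReal.ofReal ((‖x - y‖ ^ 2 + T) ^ (-((N : ℝ) / 2 + s)) * ‖y‖ ^ (-a))
      = ∫⁻ y, ∫⁻ σ in Ioi (0 : ℝ), ∫⁻ τ in Ioi (0 : ℝ), C *
          (ENNReal.ofReal (σ ^ ((N : ℝ) / 2 + s - 1) * Real.exp (-(T * σ)) * τ ^ (a / 2 - 1)) *
            ENNReal.ofReal (Real.exp (-(σ * ‖x - y‖ ^ 2)) * Real.exp (-(τ * ‖y‖ ^ 2)))) := by
        refine lintegral_congr_ae ?_
        filter_upwards [Measure.ae_ne volume (0 : EuclideanSpace ℝ (Fin N))] with y hy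
        have hy : 0 < ‖y‖ := norm_pos_iff.2 hy
        have h2 : ‖y‖ ^ (-a) = (‖y‖ ^ 2) ^ (-(a / 2)) := by
          rw [← Real.rpow_natCast, ← Real.rpow_mul hy.le]
          congr 1
          push_cast
          ring
        rw [ENNReal.ofReal_mul (by positivity), h2,
          ofReal_rpow_neg_eq_lintegral hM (by positivity),
          ofReal_rpow_neg_eq_lintegral ha2 (by positivity), mul_mul_mul_comm,
          ← ENNReal.ofReal_mul (by positivity), ← hC, ← lintegral_mul_const _ (by fun_prop),
          ← lintegral_const_mul _ (by fun_prop)]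
        refine setLIntegral_congr_fun measurableSet_Ioi fun σ (hσ : 0 < σ) => ?_
        beta_reduce
        rw [← lintegral_const_mul _ (by fun_prop), ← lintegral_const_mul _ (by fun_prop)]
        refine setLIntegral_congr_fun measurableSet_Ioi fun τ (hτ : 0 < τ) => ?_
        rw [← ENNReal.ofReal_mul (by positivity), ← ENNReal.ofReal_mul (by positivity)]
        congr 2
        rw [show -((‖x - y‖ ^ 2 + T) * σ) = -(T * σ) + -(σ * ‖x - y‖ ^ 2) by ring, Real.exp_add,
          mul_comm (‖y‖ ^ 2) τ]
        ring
    _ = ∫⁻ σ in Ioi (0 : ℝ), ∫⁻ τ in Ioi (0 : ℝ), C *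
          (ENNReal.ofReal (σ ^ ((N : ℝ) / 2 + s - 1) * Real.exp (-(T * σ)) * τ ^ (a / 2 - 1)) *
            ENNReal.ofReal ((Real.pi / (σ + τ)) ^ ((N : ℝ) / 2) *
              Real.exp (-(σ * τ / (σ + τ) * ‖x‖ ^ 2)))) := by
        rw [lintegral_lintegral_swap (by fun_prop)]
        refine setLIntegral_congr_fun measurableSet_Ioi fun σ (hσ : 0 < σ) => ?_
        beta_reduce
        rw [lintegral_lintegral_swap (by fun_prop)]
        refine setLIntegral_congr_fun measurableSet_Ioi fun τ (hτ : 0 < τ) => ?_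
        rw [lintegral_const_mul _ (by fun_prop), lintegral_const_mul _ (by fun_prop),
          lintegral_gaussian_conv hσ hτ]
    _ = ∫⁻ σ in Ioi (0 : ℝ), ∫⁻ v in Ioi (0 : ℝ), C *
          (ENNReal.ofReal (Real.pi ^ ((N : ℝ) / 2) * T ^ (a / 2) *
              v ^ (((N : ℝ) - a) / 2 - 1) * (v + T) ^ (-((N : ℝ) / 2))) *
            ENNReal.ofReal (σ ^ (a / 2 + s - 1) *
              Real.exp (-(T * (v + T + ‖x‖ ^ 2) / (v + T) * σ)))) := by
        refine setLIntegral_congr_fun measurableSet_Ioi fun σ (hσ : 0 < σ) => ?_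
        -- The substitution `τ = σT/v` makes `στ/(σ+τ) = σT/(v+T)`, so the exponent is linear in `σ`
        -- for fixed `v`.
        rw [lintegral_Ioi_comp_const_div (c := σ * T) (by positivity)]
        refine setLIntegral_congr_fun measurableSet_Ioi fun v (hv : 0 < v) => ?_
        rw [mul_left_comm, ← ENNReal.ofReal_mul (by positivity),
          ← ENNReal.ofReal_mul (by positivity), ← ENNReal.ofReal_mul (by positivity)]
        congr 2
        have e1 : Real.exp (-(T * σ)) *
            Real.exp (-(σ * (σ * T / v) / (σ + σ * T / v) * ‖x‖ ^ 2)) =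
            Real.exp (-(T * (v + T + ‖x‖ ^ 2) / (v + T) * σ)) := by
          rw [← Real.exp_add]
          congr 1
          field_simp
          ring
        have e2 : Real.pi / (σ + σ * T / v) = Real.pi * v * (v + T)⁻¹ * σ⁻¹ := by
          field_simp
        rw [← e1, e2, Real.mul_rpow (by positivity) (by positivity),
          Real.mul_rpow (by positivity) (by positivity), Real.mul_rpow (by positivity) hv.le,
          Real.inv_rpow (by positivity), Real.inv_rpow hσ.le, ← Real.rpow_neg (by positivity),
          ← Real.rpow_neg hσ.le, Real.div_rpow (by positivity) hv.le, Real.mul_rpow hσ.le hT.le]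
        have e3 : σ ^ (a / 2 + s - 1) = σ ^ ((N : ℝ) / 2 + s - 1) * σ ^ (a / 2 - 1) *
            σ ^ (-((N : ℝ) / 2)) * σ := by
          conv_rhs => rw [← Real.rpow_add hσ, ← Real.rpow_add hσ, ← Real.rpow_add_one hσ.ne']
          congr 1; ring
        have e4 : v ^ (((N : ℝ) - a) / 2 - 1) * v ^ (a / 2 - 1) * v ^ 2 = v ^ ((N : ℝ) / 2) := by
          rw [← Real.rpow_natCast v 2, ← Real.rpow_add hv, ← Real.rpow_add hv]
          congr 1; push_cast; ring
        have e5 : T ^ (a / 2) = T ^ (a / 2 - 1) * T := by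
          rw [← Real.rpow_add_one hT.ne']
          congr 1; ring
        rw [e3, ← e4, e5]
        have hv2 : v ^ (a / 2 - 1) ≠ 0 := by positivity
        field_simp
    _ = ∫⁻ v in Ioi (0 : ℝ), ENNReal.ofReal (Real.pi ^ ((N : ℝ) / 2) *
          Real.Gamma (a / 2 + s) * T ^ (-s) /
            (Real.Gamma ((N : ℝ) / 2 + s) * Real.Gamma (a / 2))) *
          ENNReal.ofReal (v ^ (((N : ℝ) - a) / 2 - 1) *
        (v + T) ^ (-(((N : ℝ) - a) / 2 - s)) * (v + T + ‖x‖ ^ 2) ^ (-(a / 2 + s))) := by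
        rw [lintegral_lintegral_swap (by fun_prop)]
        refine setLIntegral_congr_fun measurableSet_Ioi fun v (hv : 0 < v) => ?_
        rw [lintegral_const_mul _ (by fun_prop), lintegral_const_mul _ (by fun_prop),
          lintegral_rpow_mul_exp_neg hm (by positivity), hC, ← ENNReal.ofReal_mul (by positivity),
          ← ENNReal.ofReal_mul (by positivity), ← ENNReal.ofReal_mul (by positivity)]
        congr 1
        have e6 : T ^ (-s) = T ^ (a / 2) * T ^ (-(a / 2 + s)) := by
          rw [← Real.rpow_add hT]
          congr 1; ring
        have e7 : (v + T) ^ (-(((N : ℝ) - a) / 2 - s)) =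
            (v + T) ^ (-((N : ℝ) / 2)) * ((v + T) ^ (-(a / 2 + s)))⁻¹ := by
          rw [← Real.rpow_neg (by positivity), ← Real.rpow_add (by positivity)]
          congr 1; ring
        rw [Real.div_rpow (by positivity) (by positivity),
          Real.mul_rpow hT.le (by positivity), e6, e7]
        field_simp
    _ = _ := lintegral_const_mul _ (by fun_prop)

end Gaussian

/-! ### Smoothness of the Euler integral. -/

/-- The two-parameter Euler integral `∫₀^∞ v^(b-1) (v+T)^(-p) (v+T+X)^(-q) dv`. -/
noncomputable def eulerIntegral (b p q T X : ℝ) : ℝ :=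
  ∫ v in Ioi (0 : ℝ), v ^ (b - 1) * (v + T) ^ (-p) * (v + T + X) ^ (-q)

/-- A power is monotone or antitone, so its value in between is at most one of the end values. This
avoids splitting on the sign of `b - s`, which is not determined. -/
lemma rpow_le_rpow_add_rpow {x y z : ℝ} (r : ℝ) (hx : 0 < x) (hxy : x ≤ y) (hyz : y ≤ z) :
    y ^ r ≤ x ^ r + z ^ r := by
  have hz : 0 < z := by linarith
  rcases le_total 0 r with hr | hr
  · have := Real.rpow_le_rpow (hx.le.trans hxy) hyz hr
    have : 0 ≤ x ^ r := by positivity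
    linarith
  · have := Real.rpow_le_rpow_of_nonpos hx hxy hr
    have : 0 ≤ z ^ r := by positivity
    linarith

lemma rpow_le_of_comparable {c x y : ℝ} (r : ℝ) (hc : 0 < c) (hy : 0 < y) (h1 : c * y ≤ x)
    (h2 : x ≤ c⁻¹ * y) : x ^ r ≤ c ^ (-|r|) * y ^ r := by
  have hx : 0 < x := lt_of_lt_of_le (by positivity) h1
  rcases le_total 0 r with hr | hr
  · rw [abs_of_nonneg hr, Real.rpow_neg hc.le, ← Real.inv_rpow hc.le,
      ← Real.mul_rpow (by positivity) hy.le]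
    exact Real.rpow_le_rpow hx.le h2 hr
  · rw [abs_of_nonpos hr, neg_neg, ← Real.mul_rpow hc.le hy.le]
    exact Real.rpow_le_rpow_of_nonpos (by positivity) h1 hr

/-- When `T` and `T + X` stay in `[c, c⁻¹]`, both factors are comparable to powers of `v + 1`, so
one integrable Beta integrand dominates locally uniformly in `(T, X)`. Integrability therefore needs
only `0 < b < p + q`, whatever the signs of `p` and `q`. -/
lemma eulerIntegrand_le {b p q c T X v : ℝ} (hc : 0 < c) (hv : 0 < v) (hc1 : c ≤ 1)
    (h1 : c ≤ T) (h2 : T ≤ c⁻¹) (h3 : c ≤ T + X) (h4 : T + X ≤ c⁻¹) :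
    v ^ (b - 1) * (v + T) ^ (-p) * (v + T + X) ^ (-q) ≤
      c ^ (-|p|) * c ^ (-|q|) * (v ^ (b - 1) * (v + 1) ^ (-(p + q))) := by
  have hc2 : 1 ≤ c⁻¹ := (one_le_inv₀ hc).2 hc1
  have e1 : (v + T) ^ (-p) ≤ c ^ (-|-p|) * (v + 1) ^ (-p) :=
    rpow_le_of_comparable _ hc (by positivity) (by nlinarith) (by nlinarith)
  have e2 : (v + T + X) ^ (-q) ≤ c ^ (-|-q|) * (v + 1) ^ (-q) :=
    rpow_le_of_comparable _ hc (by positivity) (by nlinarith) (by nlinarith)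
  rw [abs_neg] at e1 e2
  have hT : 0 < T := hc.trans_le h1
  have hTX : 0 < v + T + X := by linarith
  calc v ^ (b - 1) * (v + T) ^ (-p) * (v + T + X) ^ (-q)
      ≤ v ^ (b - 1) * (c ^ (-|p|) * (v + 1) ^ (-p)) * (c ^ (-|q|) * (v + 1) ^ (-q)) := by
        gcongr
    _ = _ := by
        rw [neg_add, Real.rpow_add (by positivity)]
        ring

lemma eulerIntegrand_nonneg {b p q T X v : ℝ} (hv : 0 < v) (hT : 0 ≤ T) (hTX : 0 ≤ T + X) :
    0 ≤ v ^ (b - 1) * (v + T) ^ (-p) * (v + T + X) ^ (-q) := by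
  have h : 0 < v + T + X := by linarith
  positivity

lemma exists_comparison {T X : ℝ} (hT : 0 < T) (hTX : 0 < T + X) :
    ∃ c, 0 < c ∧ c ≤ 1 ∧ c < T ∧ T < c⁻¹ ∧ c < T + X ∧ T + X < c⁻¹ := by
  have h1 : ∀ᶠ c in 𝓝[>] (0 : ℝ), c < min 1 (min T (T + X)) :=
    nhdsWithin_le_nhds (eventually_lt_nhds (by positivity))
  have h2 : ∀ᶠ c in 𝓝[>] (0 : ℝ), max T (T + X) < c⁻¹ :=
    tendsto_inv_nhdsGT_zero.eventually_gt_atTop _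
  obtain ⟨c, h1, h2, h3⟩ := (h1.and (h2.and self_mem_nhdsWithin)).exists
  simp only [lt_min_iff, max_lt_iff] at h1 h2
  exact ⟨c, h3, h1.1.le, h1.2.1, h2.1, h1.2.2, h2.2⟩

lemma eulerIntegrand_integrable {b p q T X : ℝ} (hb : 0 < b) (hpq : b < p + q) (hT : 0 < T)
    (hTX : 0 < T + X) :
    IntegrableOn (fun v : ℝ => v ^ (b - 1) * (v + T) ^ (-p) * (v + T + X) ^ (-q)) (Ioi 0) := by
  obtain ⟨c, hc, hc1, h1, h2, h3, h4⟩ := exists_comparison hT hTX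
  refine Integrable.mono' ((rpow_mul_add_rpow_integral hb hpq one_pos).1.const_mul
    (c ^ (-|p|) * c ^ (-|q|))) (by fun_prop : Measurable _).aestronglyMeasurable ?_
  filter_upwards [ae_restrict_mem measurableSet_Ioi] with v hv
  rw [Real.norm_eq_abs, abs_of_nonneg (eulerIntegrand_nonneg hv hT.le hTX.le)]
  exact eulerIntegrand_le hc hv hc1 h1.le h2.le h3.le h4.le

lemma eulerIntegral_pos {b p q T X : ℝ} (hb : 0 < b) (hpq : b < p + q) (hT : 0 < T)
    (hTX : 0 < T + X) : 0 < eulerIntegral b p q T X := by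
  refine (setIntegral_pos_iff_support_of_nonneg_ae ?_
    (eulerIntegrand_integrable hb hpq hT hTX)).2 ?_
  · filter_upwards [ae_restrict_mem measurableSet_Ioi] with v hv
    exact eulerIntegrand_nonneg hv hT.le hTX.le
  · rw [inter_eq_right.2]
    · simp
    · intro v (hv : 0 < v)
      have h : 0 < v + T + X := by linarith
      exact (show 0 < v ^ (b - 1) * (v + T) ^ (-p) * (v + T + X) ^ (-q) by positivity).ne'

/-- The domain `{T > 0, T + X > 0}` of smoothness of `eulerIntegral`. -/
def eulerDomain : Set (ℝ × ℝ) := {z | 0 < z.1 ∧ 0 < z.1 + z.2}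

lemma isOpen_eulerDomain : IsOpen eulerDomain :=
  (isOpen_lt continuous_const continuous_fst).inter
    (isOpen_lt continuous_const (continuous_fst.add continuous_snd))

lemma hasFDerivAt_eulerIntegrand {b p q v : ℝ} (hv : 0 < v) {z : ℝ × ℝ} (hz : z ∈ eulerDomain) :
    HasFDerivAt (fun z : ℝ × ℝ => v ^ (b - 1) * (v + z.1) ^ (-p) * (v + z.1 + z.2) ^ (-q))
      ((-p * (v ^ (b - 1) * (v + z.1) ^ (-(p + 1)) * (v + z.1 + z.2) ^ (-q))) •
          ContinuousLinearMap.fst ℝ ℝ ℝ +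
        (-q * (v ^ (b - 1) * (v + z.1) ^ (-p) * (v + z.1 + z.2) ^ (-(q + 1)))) •
          (ContinuousLinearMap.fst ℝ ℝ ℝ + ContinuousLinearMap.snd ℝ ℝ ℝ)) z := by
  have h1 : 0 < v + z.1 := add_pos hv hz.1
  have h2 : 0 < v + z.1 + z.2 := by linarith [hz.2]
  have d1 : HasFDerivAt (fun z : ℝ × ℝ => v + z.1) (ContinuousLinearMap.fst ℝ ℝ ℝ) z :=
    hasFDerivAt_fst.const_add v
  have d2 : HasFDerivAt (fun z : ℝ × ℝ => v + z.1 + z.2)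
      (ContinuousLinearMap.fst ℝ ℝ ℝ + ContinuousLinearMap.snd ℝ ℝ ℝ) z :=
    d1.add hasFDerivAt_snd
  have h := ((d1.rpow_const (p := -p) (Or.inl h1.ne')).const_mul (v ^ (b - 1))).mul
    (d2.rpow_const (p := -q) (Or.inl h2.ne'))
  refine h.congr_fderiv ?_
  rw [show -(p + 1) = -p - 1 by ring, show -(q + 1) = -q - 1 by ring]
  ext <;> simp <;> ring

/-- Differentiation under the integral sign. The partial derivatives are again Euler integrals with
`p` or `q` raised by one, a change that preserves `b < p + q`. -/
lemma hasFDerivAt_eulerIntegral {b p q : ℝ} (hb : 0 < b) (hpq : b < p + q) {z : ℝ × ℝ}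
    (hz : z ∈ eulerDomain) :
    HasFDerivAt (fun z : ℝ × ℝ => eulerIntegral b p q z.1 z.2)
      ((-p * eulerIntegral b (p + 1) q z.1 z.2) • ContinuousLinearMap.fst ℝ ℝ ℝ +
        (-q * eulerIntegral b p (q + 1) z.1 z.2) •
          (ContinuousLinearMap.fst ℝ ℝ ℝ + ContinuousLinearMap.snd ℝ ℝ ℝ)) z := by
  obtain ⟨c, hc, hc1, h1, h2, h3, h4⟩ := exists_comparison hz.1 hz.2
  -- A neighbourhood of `z` on which the comparison constant `c` is uniform, so that a single
  -- majorant serves for the derivative.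
  set V : Set (ℝ × ℝ) := {w | (c < w.1 ∧ w.1 < c⁻¹) ∧ c < w.1 + w.2 ∧ w.1 + w.2 < c⁻¹}
  have hVo : IsOpen V :=
    ((isOpen_lt continuous_const continuous_fst).inter
      (isOpen_lt continuous_fst continuous_const)).inter
    ((isOpen_lt continuous_const (continuous_fst.add continuous_snd)).inter
      (isOpen_lt (continuous_fst.add continuous_snd) continuous_const))
  have hV : V ∈ 𝓝 z := hVo.mem_nhds ⟨⟨h1, h2⟩, h3, h4⟩
  have hVD : ∀ w ∈ V, w ∈ eulerDomain := fun w hw => ⟨hc.trans hw.1.1, hc.trans hw.2.1⟩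
  have i1 := eulerIntegrand_integrable (p := p + 1) hb (by linarith) hz.1 hz.2 (q := q)
  have i2 := eulerIntegrand_integrable (p := p) hb (by linarith) hz.1 hz.2 (q := q + 1)
  have key := hasFDerivAt_integral_of_dominated_of_fderiv_le (𝕜 := ℝ)
    (μ := volume.restrict (Ioi (0 : ℝ))) (s := V) (x₀ := z)
    (F := fun z v => v ^ (b - 1) * (v + z.1) ^ (-p) * (v + z.1 + z.2) ^ (-q))
    (F' := fun z v => (-p * (v ^ (b - 1) * (v + z.1) ^ (-(p + 1)) * (v + z.1 + z.2) ^ (-q))) •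
          ContinuousLinearMap.fst ℝ ℝ ℝ +
        (-q * (v ^ (b - 1) * (v + z.1) ^ (-p) * (v + z.1 + z.2) ^ (-(q + 1)))) •
          (ContinuousLinearMap.fst ℝ ℝ ℝ + ContinuousLinearMap.snd ℝ ℝ ℝ))
    (bound := fun v => |p| * (c ^ (-|p + 1|) * c ^ (-|q|) *
        (v ^ (b - 1) * (v + 1) ^ (-(p + 1 + q)))) + |q| * (c ^ (-|p|) * c ^ (-|q + 1|) *
        (v ^ (b - 1) * (v + 1) ^ (-(p + (q + 1))))) * 2) hV
    (Eventually.of_forall fun w => (by fun_prop : Measurable _).aestronglyMeasurable)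
    (eulerIntegrand_integrable hb hpq hz.1 hz.2)
    ?_ ?_ ?_ ?_
  · refine key.congr_fderiv ?_
    rw [integral_add ((i1.const_mul (-p)).smul_const _) ((i2.const_mul (-q)).smul_const _),
      integral_smul_const, integral_smul_const, integral_const_mul, integral_const_mul]
    rfl
  · exact ((i1.const_mul (-p)).smul_const _).1.add ((i2.const_mul (-q)).smul_const _).1
  · filter_upwards [ae_restrict_mem measurableSet_Ioi] with v (hv : 0 < v) w hw
    have hw' := hVD w hw
    refine (norm_add_le _ _).trans (add_le_add ?_ ?_)
    · rw [norm_smul, norm_mul, norm_neg, Real.norm_eq_abs, Real.norm_eq_abs,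
        abs_of_nonneg (eulerIntegrand_nonneg hv hw'.1.le hw'.2.le)]
      refine (mul_le_of_le_one_right (mul_nonneg (abs_nonneg _)
        (eulerIntegrand_nonneg hv hw'.1.le hw'.2.le))
        (ContinuousLinearMap.norm_fst_le ℝ ℝ ℝ)).trans ?_
      exact mul_le_mul_of_nonneg_left (eulerIntegrand_le hc hv hc1
        hw.1.1.le hw.1.2.le hw.2.1.le hw.2.2.le)
        (abs_nonneg _)
    · rw [norm_smul, norm_mul, norm_neg, Real.norm_eq_abs, Real.norm_eq_abs,
        abs_of_nonneg (eulerIntegrand_nonneg hv hw'.1.le hw'.2.le)]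
      refine mul_le_mul ?_ ?_ (norm_nonneg _) (by positivity)
      · exact mul_le_mul_of_nonneg_left (eulerIntegrand_le hc hv hc1
          hw.1.1.le hw.1.2.le hw.2.1.le hw.2.2.le)
          (abs_nonneg _)
      · refine (norm_add_le _ _).trans ?_
        linarith [ContinuousLinearMap.norm_fst_le ℝ ℝ ℝ, ContinuousLinearMap.norm_snd_le ℝ ℝ ℝ]
  · exact (((rpow_mul_add_rpow_integral hb (by linarith) one_pos).1.const_mul _).const_mul _).add
      ((((rpow_mul_add_rpow_integral hb (by linarith) one_pos).1.const_mul _).const_mul _).mul_const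
        _)
  · filter_upwards [ae_restrict_mem measurableSet_Ioi] with v hv w hw
    exact hasFDerivAt_eulerIntegrand hv (hVD w hw)

/-- The family of Euler integrals is closed under differentiation, so induction on the order works
provided that `p` and `q` remain universally quantified. -/
lemma contDiffOn_eulerIntegral_nat {b : ℝ} (hb : 0 < b) (n : ℕ) :
    ∀ p q : ℝ, b < p + q →
      ContDiffOn ℝ n (fun z : ℝ × ℝ => eulerIntegral b p q z.1 z.2) eulerDomain := by
  induction n with
  | zero =>
    intro p q hpq
    exact contDiffOn_zero.2 fun z hz =>
      (hasFDerivAt_eulerIntegral hb hpq hz).continuousAt.continuousWithinAt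
  | succ n ih =>
    intro p q hpq
    rw [Nat.cast_succ, contDiffOn_succ_iff_fderiv_of_isOpen isOpen_eulerDomain]
    refine ⟨fun z hz => (hasFDerivAt_eulerIntegral hb hpq hz).differentiableAt.differentiableWithinAt,
      fun h => absurd h (by simp), ?_⟩
    refine ContDiffOn.congr ?_ fun z hz => (hasFDerivAt_eulerIntegral hb hpq hz).fderiv
    exact ((contDiffOn_const.mul (ih (p + 1) q (by linarith))).smul contDiffOn_const).add
      ((contDiffOn_const.mul (ih p (q + 1) (by linarith))).smul contDiffOn_const)

lemma contDiffOn_eulerIntegral {b p q : ℝ} (hb : 0 < b) (hpq : b < p + q) :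
    ContDiffOn ℝ ∞ (fun z : ℝ × ℝ => eulerIntegral b p q z.1 z.2) eulerDomain :=
  contDiffOn_infty.2 fun n => contDiffOn_eulerIntegral_nat hb n p q hpq

lemma hasDerivAt_eulerIntegral_fst {b p q T X : ℝ} (hb : 0 < b) (hpq : b < p + q) (hT : 0 < T)
    (hTX : 0 < T + X) :
    HasDerivAt (fun T => eulerIntegral b p q T X)
      (-p * eulerIntegral b (p + 1) q T X - q * eulerIntegral b p (q + 1) T X) T := by
  have h := (hasFDerivAt_eulerIntegral hb hpq (z := (T, X)) ⟨hT, hTX⟩).comp_hasDerivAt T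
    ((hasDerivAt_id T).prodMk (hasDerivAt_const T X))
  refine h.congr_deriv ?_
  simp
  ring

lemma hasDerivAt_eulerIntegral_snd {b p q T X : ℝ} (hb : 0 < b) (hpq : b < p + q) (hT : 0 < T)
    (hTX : 0 < T + X) :
    HasDerivAt (fun X => eulerIntegral b p q T X) (-q * eulerIntegral b p (q + 1) T X) X := by
  have h := (hasFDerivAt_eulerIntegral hb hpq (z := (T, X)) ⟨hT, hTX⟩).comp_hasDerivAt X
    ((hasDerivAt_const X T).prodMk (hasDerivAt_id X))
  refine h.congr_deriv ?_
  simp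

/-! ### Contiguity relations, bounds and boundary behaviour of the Euler integral. -/

section EulerIntegral
variable {b p q s T X : ℝ}

/-- The integral of the derivative of `v^b (v+T)^(-p) (v+T+X)^(-q)` vanishes: `b > 0` kills the
boundary term at `0`, and `b < p + q` the one at infinity. -/
lemma eulerIntegral_ibp (hb : 0 < b) (hpq : b < p + q) (hT : 0 < T) (hTX : 0 < T + X) :
    b * eulerIntegral b p q T X =
      p * eulerIntegral (b + 1) (p + 1) q T X + q * eulerIntegral (b + 1) p (q + 1) T X := by
  have i0 := eulerIntegrand_integrable hb hpq hT hTX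
  have i1 := eulerIntegrand_integrable (b := b + 1) (p := p + 1) (q := q) (by linarith)
    (by linarith) hT hTX
  have i2 := eulerIntegrand_integrable (b := b + 1) (p := p) (q := q + 1) (by linarith)
    (by linarith) hT hTX
  have i01 : IntegrableOn (fun v : ℝ => b * (v ^ (b - 1) * (v + T) ^ (-p) * (v + T + X) ^ (-q)) -
      p * (v ^ (b + 1 - 1) * (v + T) ^ (-(p + 1)) * (v + T + X) ^ (-q))) (Ioi 0) :=
    (i0.const_mul b).sub (i1.const_mul p)
  have hi := i01.sub (i2.const_mul q)
  have h := integral_Ioi_of_hasDerivAt_of_tendsto (a := 0) (m := 0)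
    (f := fun v : ℝ => v ^ b * (v + T) ^ (-p) * (v + T + X) ^ (-q)) ?_ ?_ hi ?_
  · rw [Real.zero_rpow hb.ne', zero_mul, zero_mul, sub_zero] at h
    simp only [Pi.sub_apply] at h
    rw [integral_sub i01 (i2.const_mul q), integral_sub (i0.const_mul b) (i1.const_mul p), integral_const_mul, integral_const_mul,
      integral_const_mul] at h
    simp only [eulerIntegral]
    linarith
  · refine ContinuousAt.continuousWithinAt ?_
    refine ((Real.continuousAt_rpow_const _ _ (Or.inr hb.le)).mul ?_).mul ?_
    · exact (continuousAt_id.add continuousAt_const).rpow_const (Or.inl (by simpa using hT.ne'))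
    · exact ((continuousAt_id.add continuousAt_const).add continuousAt_const).rpow_const
        (Or.inl (by simpa using hTX.ne'))
  · intro v (hv : 0 < v)
    have h1 : v + T ≠ 0 := by positivity
    have h2 : v + T + X ≠ 0 := by linarith
    have d := (((Real.hasDerivAt_rpow_const (p := b) (Or.inl hv.ne')).mul
      (((hasDerivAt_id v).add_const T).rpow_const (p := -p) (Or.inl h1))).mul
      ((((hasDerivAt_id v).add_const T).add_const X).rpow_const (p := -q) (Or.inl h2)))
    refine d.congr_deriv ?_
    simp only [Pi.sub_apply, Pi.mul_apply, id_eq]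
    rw [show -(p + 1) = -p - 1 by ring, show -(q + 1) = -q - 1 by ring,
      show b + 1 - 1 = b by ring]
    ring
  · obtain ⟨c, hc, hc1, h1, h2, h3, h4⟩ := exists_comparison hT hTX
    have ht : Tendsto (fun v : ℝ => c ^ (-|p|) * c ^ (-|q|) * (v + 1) ^ (-(p + q - b)))
        atTop (𝓝 0) := by
      simpa using ((tendsto_rpow_neg_atTop (show 0 < p + q - b by linarith)).comp
        (tendsto_atTop_add_const_right atTop 1 tendsto_id)).const_mul (c ^ (-|p|) * c ^ (-|q|))
    refine squeeze_zero' ?_ ?_ ht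
    · filter_upwards [eventually_gt_atTop 0] with v hv
      simpa using eulerIntegrand_nonneg (b := b + 1) (p := p) (q := q) hv hT.le hTX.le
    · filter_upwards [eventually_gt_atTop 0] with v hv
      have := eulerIntegrand_le (b := b + 1) (p := p) (q := q) hc hv hc1 h1.le h2.le h3.le h4.le
      rw [add_sub_cancel_right] at this
      refine this.trans (mul_le_mul_of_nonneg_left ?_ (by positivity))
      calc v ^ b * (v + 1) ^ (-(p + q)) ≤ (v + 1) ^ b * (v + 1) ^ (-(p + q)) := by
            gcongr; linarith
        _ = _ := by
            rw [← Real.rpow_add (by positivity)]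
            congr 1; ring

/-- Write the extra factor `v` as `(v + T) - T`. -/
lemma eulerIntegral_add_one_fst (hb : 0 < b) (hpq : b < p + q) (hT : 0 < T) (hTX : 0 < T + X) :
    eulerIntegral (b + 1) (p + 1) q T X =
      eulerIntegral b p q T X - T * eulerIntegral b (p + 1) q T X := by
  have i0 := eulerIntegrand_integrable hb hpq hT hTX
  have i1 := eulerIntegrand_integrable (p := p + 1) (q := q) hb (by linarith) hT hTX
  simp only [eulerIntegral]
  rw [← integral_const_mul, ← integral_sub i0 (i1.const_mul T)]
  refine setIntegral_congr_fun measurableSet_Ioi fun v (hv : 0 < v) => ?_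
  have e1 : (v + T) ^ (-p) = (v + T) ^ (-(p + 1)) * (v + T) := by
    rw [← Real.rpow_add_one (by positivity)]
    congr 1; ring
  have e2 : v ^ (b + 1 - 1) = v ^ (b - 1) * v := by
    rw [← Real.rpow_add_one hv.ne']
    congr 1; ring
  rw [e1, e2]
  ring

/-- Split one factor `v + T + X` as `(v + T) + X`. -/
lemma eulerIntegral_eq_add (hb : 0 < b) (hpq : b < p + q) (hT : 0 < T) (hTX : 0 < T + X) :
    eulerIntegral b p q T X =
      eulerIntegral b (p - 1) (q + 1) T X + X * eulerIntegral b p (q + 1) T X := by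
  have i0 := eulerIntegrand_integrable (p := p - 1) (q := q + 1) hb (by linarith) hT hTX
  have i1 := eulerIntegrand_integrable (p := p) (q := q + 1) hb (by linarith) hT hTX
  simp only [eulerIntegral]
  rw [← integral_const_mul, ← integral_add i0 (i1.const_mul X)]
  refine setIntegral_congr_fun measurableSet_Ioi fun v (hv : 0 < v) => ?_
  have h2 : v + T + X ≠ 0 := by linarith
  have e1 : (v + T) ^ (-(p - 1)) = (v + T) ^ (-p) * (v + T) := by
    rw [← Real.rpow_add_one (by positivity)]
    congr 1; ring
  have e2 : (v + T + X) ^ (-q) = (v + T + X) ^ (-(q + 1)) * (v + T + X) := by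
    rw [← Real.rpow_add_one h2]
    congr 1; ring
  rw [e1, e2]
  ring

/-- In terms of `f = eulerIntegral b p q` this reads `T f_TT + (1-b+p) f_T + X f_XX + (p+q) f_X =
0`. It is a combination of integration by parts for the parameters `(p+1, q)` and `(p, q+1)`, after
the contiguity relations have brought all terms back to the exponent `b`. For the Poisson profile,
`b - p = s` and `p + q = N/2`. -/
lemma eulerIntegral_equation (hb : 0 < b) (hpq : b < p + q) (hT : 0 < T) (hTX : 0 < T + X) :
    T * (p * (p + 1) * eulerIntegral b (p + 2) q T X +
        2 * p * q * eulerIntegral b (p + 1) (q + 1) T X +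
        q * (q + 1) * eulerIntegral b p (q + 2) T X) -
      (1 - b + p) * (p * eulerIntegral b (p + 1) q T X + q * eulerIntegral b p (q + 1) T X) +
      X * (q * (q + 1)) * eulerIntegral b p (q + 2) T X -
      (p + q) * q * eulerIntegral b p (q + 1) T X = 0 := by
  have h1 := eulerIntegral_ibp (p := p + 1) (q := q) hb (by linarith) hT hTX
  have h2 := eulerIntegral_ibp (p := p) (q := q + 1) hb (by linarith) hT hTX
  have h3 := eulerIntegral_eq_add (p := p) (q := q + 1) hb (by linarith) hT hTX
  have h4 := eulerIntegral_add_one_fst (p := p + 1) (q := q) hb (by linarith) hT hTX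
  have h5 := eulerIntegral_add_one_fst (p := p) (q := q + 1) hb (by linarith) hT hTX
  have h6 := eulerIntegral_add_one_fst (p := p - 1) (q := q + 2) hb (by linarith) hT hTX
  rw [sub_add_cancel] at h6
  rw [show q + 1 + 1 = q + 2 by ring] at *
  rw [show p + 1 + 1 = p + 2 by ring] at *
  rw [h4, h5] at h1
  rw [h5, h6] at h2
  linear_combination p * h1 + q * h2 - q * (q + 1) * h3

/-- Since `v + T` lies between `v` and `v + T + X`, its power is at most the sum of theirs, and each
summand gives a Beta integral with shift `T + X`. The bound does not degenerate as `T → 0` with `X`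
fixed. -/
lemma eulerIntegral_sub_le (hb : 0 < b) (hs : 0 < s) (hq : s < q) (hT : 0 < T) (hX : 0 ≤ X) :
    eulerIntegral b (b - s) q T X ≤ (T + X) ^ (s - q) *
      (Real.Gamma s * Real.Gamma (q - s) / Real.Gamma q +
        Real.Gamma b * Real.Gamma (q - s) / Real.Gamma (b + q - s)) := by
  have hE : 0 < T + X := by linarith
  obtain ⟨i1, e1⟩ := rpow_mul_add_rpow_integral hs hq hE
  obtain ⟨i2, e2⟩ := rpow_mul_add_rpow_integral hb (show b < b + q - s by linarith) hE
  have i0 := eulerIntegrand_integrable (p := b - s) (q := q) hb (by linarith) hT hE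
  rw [show b - (b + q - s) = s - q by ring, show b + q - s - b = q - s by ring] at e2
  rw [mul_add, ← e1, ← e2, ← integral_add i1 i2]
  refine setIntegral_mono_on i0 (i1.add i2) measurableSet_Ioi fun v (hv : 0 < v) => ?_
  have h := rpow_le_rpow_add_rpow (-(b - s)) hv (show v ≤ v + T by linarith)
    (show v + T ≤ v + (T + X) by linarith)
  have e3 : v ^ (s - 1) = v ^ (b - 1) * v ^ (-(b - s)) := by
    rw [← Real.rpow_add hv]; congr 1; ring
  have e4 : (v + (T + X)) ^ (-(b + q - s)) =
      (v + (T + X)) ^ (-(b - s)) * (v + (T + X)) ^ (-q) := by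
    rw [← Real.rpow_add (by positivity)]; congr 1; ring
  rw [e3, e4, add_assoc]
  calc v ^ (b - 1) * (v + T) ^ (-(b - s)) * (v + (T + X)) ^ (-q)
      ≤ v ^ (b - 1) * (v ^ (-(b - s)) + (v + (T + X)) ^ (-(b - s))) * (v + (T + X)) ^ (-q) := by
        gcongr
    _ = _ := by ring

/-- For `p > b` the mass concentrates at `v` of order `T`. Freezing the last factor at `v = 0`
leaves a Beta integral, which carries the singular power `T^(b-p)`. -/
lemma eulerIntegral_le_of_lt (hb : 0 < b) (hp : b < p) (hq : 0 ≤ q) (hT : 0 < T) (hX : 0 ≤ X) :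
    eulerIntegral b p q T X ≤ (T + X) ^ (-q) * T ^ (b - p) *
      (Real.Gamma b * Real.Gamma (p - b) / Real.Gamma p) := by
  have hE : 0 < T + X := by linarith
  obtain ⟨i1, e1⟩ := rpow_mul_add_rpow_integral hb hp hT
  have i0 := eulerIntegrand_integrable (p := p) (q := q) hb (by linarith) hT hE
  rw [mul_assoc, ← e1, ← integral_const_mul]
  refine setIntegral_mono_on i0 (i1.const_mul _) measurableSet_Ioi fun v (hv : 0 < v) => ?_
  have h : (v + T + X) ^ (-q) ≤ (T + X) ^ (-q) :=
    Real.rpow_le_rpow_of_nonpos hE (by linarith) (by linarith)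
  rw [mul_comm ((T + X) ^ (-q))]
  gcongr

lemma eulerIntegral_shift_le (hb : 0 < b) (hpq : b < p + q + 1) (hT : 0 < T) (hX : 0 ≤ X) :
    eulerIntegral b p (q + 1) T X ≤ eulerIntegral b (p + 1) q T X := by
  have hE : 0 < T + X := by linarith
  refine setIntegral_mono_on (eulerIntegrand_integrable hb (by linarith) hT hE)
    (eulerIntegrand_integrable hb (by linarith) hT hE) measurableSet_Ioi fun v (hv : 0 < v) => ?_
  have h : (v + T + X)⁻¹ ≤ (v + T)⁻¹ :=
    inv_anti₀ (by positivity) (by linarith)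
  have e1 : (v + T + X) ^ (-(q + 1)) = (v + T + X) ^ (-q) * (v + T + X)⁻¹ := by
    rw [← Real.rpow_neg_one, ← Real.rpow_add (by positivity)]; congr 1; ring
  have e2 : (v + T) ^ (-(p + 1)) = (v + T) ^ (-p) * (v + T)⁻¹ := by
    rw [← Real.rpow_neg_one (v + T), ← Real.rpow_add (by positivity)]; congr 1; ring
  rw [e1, e2]
  calc v ^ (b - 1) * (v + T) ^ (-p) * ((v + T + X) ^ (-q) * (v + T + X)⁻¹)
      ≤ v ^ (b - 1) * (v + T) ^ (-p) * ((v + T + X) ^ (-q) * (v + T)⁻¹) := by gcongr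
    _ = _ := by ring

lemma eulerIntegral_zero (hs : 0 < s) (hq : s < q) (hX : 0 < X) :
    eulerIntegral b (b - s) q 0 X =
      X ^ (s - q) * (Real.Gamma s * Real.Gamma (q - s) / Real.Gamma q) := by
  rw [← (rpow_mul_add_rpow_integral hs hq hX).2]
  refine setIntegral_congr_fun measurableSet_Ioi fun v (hv : 0 < v) => ?_
  rw [add_zero, ← Real.rpow_add hv, show b - 1 + -(b - s) = s - 1 by ring]

/-- Dominated convergence up to the boundary `T = 0`, where the smoothness argument stops: near `v =
0` the majorant must absorb `v^(b-1) v^(-(b-s)) = v^(s-1)`, which is integrable because `s > 0`. -/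
lemma continuousWithinAt_eulerIntegral_zero (hb : 0 < b) (hs : 0 < s) (hq : s < q) (hX : 0 < X) :
    ContinuousWithinAt (fun z : ℝ × ℝ => eulerIntegral b (b - s) q z.1 z.2)
      {z | 0 ≤ z.1} (0, X) := by
  have hc : 0 < X / 2 := by linarith
  have n1 : ∀ᶠ z : ℝ × ℝ in 𝓝[{z | 0 ≤ z.1}] (0, X), 0 ≤ z.1 ∧ z.1 < 1 ∧ X / 2 < z.2 := by
    refine Filter.Eventually.and self_mem_nhdsWithin (nhdsWithin_le_nhds ?_)
    have h1 : ∀ᶠ z : ℝ × ℝ in 𝓝 (0, X), z.1 < 1 :=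
      continuousAt_fst.eventually_lt continuousAt_const (by simp)
    have h2 : ∀ᶠ z : ℝ × ℝ in 𝓝 (0, X), X / 2 < z.2 :=
      continuousAt_const.eventually_lt continuousAt_snd (by simpa using hX)
    exact h1.and h2
  have i1 := (rpow_mul_add_rpow_integral hs hq hc).1
  -- The value `X/2 - 1` is chosen so that `T = 1` gives `T + X = X/2`, matching the lower bound
  -- imposed on the second variable.
  have i2 := eulerIntegrand_integrable (b := b) (p := b - s) (q := q) (T := 1) (X := X / 2 - 1) hb
    (by linarith) one_pos (by linarith)
  refine continuousWithinAt_of_dominated (bound := fun v => v ^ (s - 1) * (v + X / 2) ^ (-q) +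
    v ^ (b - 1) * (v + 1) ^ (-(b - s)) * (v + 1 + (X / 2 - 1)) ^ (-q))
    (Eventually.of_forall fun z => (by fun_prop : Measurable _).aestronglyMeasurable) ?_
    (i1.add i2) ?_
  · filter_upwards [n1] with z hz
    filter_upwards [ae_restrict_mem measurableSet_Ioi] with v (hv : 0 < v)
    rw [Real.norm_eq_abs, abs_of_nonneg (eulerIntegrand_nonneg hv hz.1 (by linarith))]
    have h := rpow_le_rpow_add_rpow (-(b - s)) hv (show v ≤ v + z.1 by linarith)
      (show v + z.1 ≤ v + 1 by linarith)
    have h' : (v + z.1 + z.2) ^ (-q) ≤ (v + X / 2) ^ (-q) :=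
      Real.rpow_le_rpow_of_nonpos (by positivity) (by linarith) (by linarith)
    have e3 : v ^ (s - 1) = v ^ (b - 1) * v ^ (-(b - s)) := by
      rw [← Real.rpow_add hv]; congr 1; ring
    have h0 : 0 ≤ (v + z.1 + z.2) ^ (-q) := Real.rpow_nonneg (by linarith) _
    rw [e3, show v + 1 + (X / 2 - 1) = v + X / 2 by ring]
    calc v ^ (b - 1) * (v + z.1) ^ (-(b - s)) * (v + z.1 + z.2) ^ (-q)
        ≤ v ^ (b - 1) * (v ^ (-(b - s)) + (v + 1) ^ (-(b - s))) * (v + X / 2) ^ (-q) := by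
          gcongr
      _ = _ := by ring
  · filter_upwards [ae_restrict_mem measurableSet_Ioi] with v (hv : 0 < v)
    refine ContinuousAt.continuousWithinAt ?_
    refine (continuousAt_const.mul ?_).mul ?_
    · exact (continuousAt_const.add continuousAt_fst).rpow_const (Or.inl (by simpa using hv.ne'))
    · refine ((continuousAt_const.add continuousAt_fst).add continuousAt_snd).rpow_const (Or.inl ?_)
      simpa using (add_pos hv hX).ne'

/-- The rescaling `v = Tw` extracts the singular power `T^(b-p)` and leaves an integrand that is
regular at `T = 0`. -/
lemma rpow_mul_eulerIntegral (hT : 0 < T) :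
    T ^ (p - b) * eulerIntegral b p q T X =
      ∫ w in Ioi (0 : ℝ), w ^ (b - 1) * (w + 1) ^ (-p) * (T * (w + 1) + X) ^ (-q) := by
  have h := integral_comp_mul_left_Ioi
    (fun v => v ^ (b - 1) * (v + T) ^ (-p) * (v + T + X) ^ (-q)) 0 hT
  rw [mul_zero] at h
  have h' : eulerIntegral b p q T X = T * ∫ w in Ioi (0 : ℝ),
      (T * w) ^ (b - 1) * (T * w + T) ^ (-p) * (T * w + T + X) ^ (-q) := by
    rw [h, smul_eq_mul, mul_inv_cancel_left₀ hT.ne']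
    rfl
  rw [h', ← mul_assoc, ← integral_const_mul]
  refine setIntegral_congr_fun measurableSet_Ioi fun w (hw : 0 < w) => ?_
  rw [Real.mul_rpow hT.le hw.le, show T * w + T = T * (w + 1) by ring,
    Real.mul_rpow hT.le (by positivity)]
  have e : T ^ (p - b) * T * T ^ (b - 1) * T ^ (-p) = 1 := by
    rw [← Real.rpow_add_one hT.ne', ← Real.rpow_add hT, ← Real.rpow_add hT,
      show p - b + 1 + (b - 1) + -p = 0 by ring, Real.rpow_zero]
  linear_combination (w ^ (b - 1) * (w + 1) ^ (-p) * (T * (w + 1) + X) ^ (-q)) * e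

/-- Dominated convergence after the rescaling. The limit is taken jointly in `T` and `X` because
locally uniform convergence in `x` will be needed for the conormal derivative. -/
lemma tendsto_rpow_mul_eulerIntegral (hb : 0 < b) (hp : b < p) (hq : 0 ≤ q) (hX : 0 < X) :
    Tendsto (fun z : ℝ × ℝ => z.1 ^ (p - b) * eulerIntegral b p q z.1 z.2) (𝓝[>] 0 ×ˢ 𝓝 X)
      (𝓝 (X ^ (-q) * (Real.Gamma b * Real.Gamma (p - b) / Real.Gamma p))) := by
  have hc : 0 < X / 2 := by linarith
  obtain ⟨i1, e1⟩ := rpow_mul_add_rpow_integral hb hp one_pos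
  rw [Real.one_rpow, one_mul] at e1
  have hn : ∀ᶠ z : ℝ × ℝ in 𝓝[>] 0 ×ˢ 𝓝 X, 0 < z.1 ∧ X / 2 < z.2 :=
    (eventually_mem_nhdsWithin (a := (0 : ℝ)) (s := Ioi 0)).prod_mk
      (eventually_gt_nhds (show X / 2 < X by linarith))
  have hle : (𝓝[>] (0 : ℝ) ×ˢ 𝓝 X) ≤ 𝓝 ((0 : ℝ), X) := by
    rw [nhds_prod_eq]
    exact Filter.prod_mono nhdsWithin_le_nhds le_rfl
  refine Tendsto.congr' (f₁ := fun z : ℝ × ℝ =>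
    ∫ w in Ioi (0 : ℝ), w ^ (b - 1) * (w + 1) ^ (-p) * (z.1 * (w + 1) + z.2) ^ (-q)) ?_ ?_
  · filter_upwards [hn] with z hz
    rw [rpow_mul_eulerIntegral hz.1]
  · rw [← e1, mul_comm, ← integral_mul_const]
    refine tendsto_integral_filter_of_dominated_convergence
      (fun w => w ^ (b - 1) * (w + 1) ^ (-p) * (X / 2) ^ (-q))
      (Eventually.of_forall fun z => (by fun_prop : Measurable _).aestronglyMeasurable) ?_
      (i1.mul_const _) ?_
    · filter_upwards [hn] with z ⟨hz1, hz2⟩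
      filter_upwards [ae_restrict_mem measurableSet_Ioi] with w (hw : 0 < w)
      have h1 : 0 < z.1 * (w + 1) := by positivity
      have h2 : 0 < z.1 * (w + 1) + z.2 := by linarith
      rw [Real.norm_eq_abs, abs_of_nonneg (by positivity)]
      have h : (z.1 * (w + 1) + z.2) ^ (-q) ≤ (X / 2) ^ (-q) :=
        Real.rpow_le_rpow_of_nonpos hc (by linarith) (by linarith)
      gcongr
    · refine ae_of_all _ fun w => Tendsto.const_mul _ ?_
      have hcont : ContinuousAt (fun z : ℝ × ℝ => (z.1 * (w + 1) + z.2) ^ (-q)) ((0 : ℝ), X) := by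
        refine ContinuousAt.rpow_const (by fun_prop) (Or.inl ?_)
        simpa using hX.ne'
      have := hcont.tendsto.mono_left hle
      simpa using this

end EulerIntegral

/-- The profile of the Poisson extension of `|x|^(-a)`, as a function of `T = t²`, `X = |x|²`. -/
noncomputable def powerProfile (N : ℕ) (s a T X : ℝ) : ℝ :=
  Real.Gamma (a / 2 + s) / (Real.Gamma s * Real.Gamma (a / 2)) *
    eulerIntegral (((N : ℝ) - a) / 2) (((N : ℝ) - a) / 2 - s) (a / 2 + s) T X

/-! ### The Poisson extension of a power in closed form. -/

section PoissonFormula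
variable {N : ℕ} {s a : ℝ}

lemma halfSpacePoissonKernel_eq {t : ℝ} (ht : 0 < t) (z : EuclideanSpace ℝ (Fin N)) :
    halfSpacePoissonKernel s t z =
      poissonConst N s * (t ^ 2) ^ s * (‖z‖ ^ 2 + t ^ 2) ^ (-((N : ℝ) / 2 + s)) := by
  rw [halfSpacePoissonKernel, Real.rpow_neg (by positivity), ← Real.rpow_natCast t 2,
    ← Real.rpow_mul ht.le, div_eq_mul_inv]
  push_cast
  rw [show ((N : ℝ) + 2 * s) / 2 = (N : ℝ) / 2 + s by ring]

lemma poissonConst_pos (hs : 0 < s) : 0 < poissonConst N s := by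
  have h1 := Real.Gamma_pos_of_pos (show 0 < (N : ℝ) / 2 + s by positivity)
  have h2 := Real.Gamma_pos_of_pos hs
  have h3 := Real.pi_pos
  rw [poissonConst_eq hs]
  positivity

lemma halfSpacePoissonKernel_pos (hs : 0 < s) {t : ℝ} (ht : 0 < t)
    (z : EuclideanSpace ℝ (Fin N)) : 0 < halfSpacePoissonKernel s t z := by
  have := poissonConst_pos (N := N) hs
  rw [halfSpacePoissonKernel_eq ht]
  positivity

lemma measurable_halfSpacePoissonKernel {t : ℝ} :
    Measurable (halfSpacePoissonKernel (N := N) s t) := by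
  unfold halfSpacePoissonKernel
  fun_prop

/-- The factors `T^s` and `T^(-s)` cancel, and so do the powers of `π` and `Γ(N/2+s)` against
`p_{N,s}`, leaving exactly the constant of `powerProfile`. -/
lemma lintegral_poisson_power (hs : 0 < s) (ha : 0 < a) (haN : a < N) {t : ℝ} (ht : 0 < t)
    (x : EuclideanSpace ℝ (Fin N)) :
    ∫⁻ y, ENNReal.ofReal (halfSpacePoissonKernel s t (x - y) * ‖y‖ ^ (-a)) =
      ENNReal.ofReal (powerProfile N s a (t ^ 2) (‖x‖ ^ 2)) := by
  have hN : 0 < N := by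
    have : (0 : ℝ) < N := ha.trans haN
    exact_mod_cast this
  have hT : 0 < t ^ 2 := by positivity
  have hTX : 0 < t ^ 2 + ‖x‖ ^ 2 := by positivity
  have hb : 0 < ((N : ℝ) - a) / 2 := by linarith
  have hint := eulerIntegrand_integrable (p := ((N : ℝ) - a) / 2 - s) (q := a / 2 + s) hb
    (by linarith) hT hTX
  have h1 := Real.Gamma_pos_of_pos (show 0 < (N : ℝ) / 2 + s by positivity)
  have h2 := Real.Gamma_pos_of_pos hs
  have h3 := Real.Gamma_pos_of_pos (show 0 < a / 2 + s by positivity)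
  have h4 := Real.Gamma_pos_of_pos (show 0 < a / 2 by positivity)
  have hπ := Real.pi_pos
  have hp := poissonConst_pos (N := N) hs
  have e : ∀ y : EuclideanSpace ℝ (Fin N),
      ENNReal.ofReal (halfSpacePoissonKernel s t (x - y) * ‖y‖ ^ (-a)) =
      ENNReal.ofReal (poissonConst N s * (t ^ 2) ^ s) *
        ENNReal.ofReal ((‖x - y‖ ^ 2 + t ^ 2) ^ (-((N : ℝ) / 2 + s)) * ‖y‖ ^ (-a)) := by
    intro y
    rw [halfSpacePoissonKernel_eq ht, ← ENNReal.ofReal_mul (by positivity), mul_assoc]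
  simp_rw [e]
  rw [lintegral_const_mul _ (by fun_prop), lintegral_rpow_mul_norm_rpow hN hs ha hT,
    ← ofReal_integral_eq_lintegral_ofReal hint, ← ENNReal.ofReal_mul (by positivity),
    ← ENNReal.ofReal_mul (by positivity), powerProfile, poissonConst_eq hs, eulerIntegral]
  · congr 1
    rw [Real.rpow_neg hT.le]
    field_simp
  · filter_upwards [ae_restrict_mem measurableSet_Ioi] with v hv
    exact eulerIntegrand_nonneg hv hT.le hTX.le

lemma powerProfile_pos (hs : 0 < s) (ha : 0 < a) (haN : a < N) {T X : ℝ} (hT : 0 < T)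
    (hTX : 0 < T + X) : 0 < powerProfile N s a T X := by
  have h2 := Real.Gamma_pos_of_pos hs
  have h3 := Real.Gamma_pos_of_pos (show 0 < a / 2 + s by positivity)
  have h4 := Real.Gamma_pos_of_pos (show 0 < a / 2 by positivity)
  exact mul_pos (by positivity) (eulerIntegral_pos (by linarith) (by linarith) hT hTX)

lemma integrable_poisson_power (hs : 0 < s) (ha : 0 < a) (haN : a < N) {t : ℝ} (ht : 0 < t)
    (x : EuclideanSpace ℝ (Fin N)) :
    Integrable (fun y => halfSpacePoissonKernel s t (x - y) * ‖y‖ ^ (-a)) ∧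
      ∫ y, halfSpacePoissonKernel s t (x - y) * ‖y‖ ^ (-a) =
        powerProfile N s a (t ^ 2) (‖x‖ ^ 2) := by
  have hmeas : Measurable
      (fun y : EuclideanSpace ℝ (Fin N) => halfSpacePoissonKernel s t (x - y) * ‖y‖ ^ (-a)) :=
    (measurable_halfSpacePoissonKernel.comp (measurable_const.sub measurable_id)).mul
      (by fun_prop)
  have h0 : ∀ y : EuclideanSpace ℝ (Fin N),
      0 ≤ halfSpacePoissonKernel s t (x - y) * ‖y‖ ^ (-a) := fun y =>
    mul_nonneg (halfSpacePoissonKernel_pos hs ht _).le (by positivity)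
  have h := lintegral_poisson_power hs ha haN ht x
  refine ⟨⟨hmeas.aestronglyMeasurable, ?_⟩, ?_⟩
  · rw [hasFiniteIntegral_iff_ofReal (ae_of_all _ h0), h]
    exact ENNReal.ofReal_lt_top
  · rw [integral_eq_lintegral_of_nonneg_ae (ae_of_all _ h0) hmeas.aestronglyMeasurable, h,
      ENNReal.toReal_ofReal (powerProfile_pos hs ha haN (by positivity) (by positivity)).le]

/-- The Beta value at `T = 0` is the reciprocal of the normalising constant, so one formula covers
both the interior and the boundary. -/
lemma powerProfile_zero (hs : 0 < s) (ha : 0 < a) {X : ℝ} (hX : 0 < X) :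
    powerProfile N s a 0 X = X ^ (-(a / 2)) := by
  have h2 := Real.Gamma_pos_of_pos hs
  have h3 := Real.Gamma_pos_of_pos (show 0 < a / 2 + s by positivity)
  have h4 := Real.Gamma_pos_of_pos (show 0 < a / 2 by positivity)
  rw [powerProfile, eulerIntegral_zero hs (by linarith) hX, add_sub_cancel_right,
    show s - (a / 2 + s) = -(a / 2) by ring]
  field_simp

lemma powerFun_eq (N : ℕ) (s α : ℝ) :
    powerFun N s α = fun x => ‖x‖ ^ (-((N : ℝ) / 2 - s - α)) := by
  funext x
  rw [powerFun]
  congr 1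
  ring

lemma poissonExtension_power (hs : 0 < s) (ha : 0 < a) (haN : a < N)
    {z : ℝ × EuclideanSpace ℝ (Fin N)} (hz : 0 < z.1) :
    poissonExtension s (fun x => ‖x‖ ^ (-a)) z = powerProfile N s a (z.1 ^ 2) (‖z.2‖ ^ 2) := by
  rw [poissonExtension, if_pos hz, (integrable_poisson_power hs ha haN hz z.2).2]

lemma poissonExtension_power_of_closed (hs : 0 < s) (ha : 0 < a) (haN : a < N)
    {z : ℝ × EuclideanSpace ℝ (Fin N)} (hz : z ∈ closedUpperHalfPunctured N) :
    poissonExtension s (fun x => ‖x‖ ^ (-a)) z = powerProfile N s a (z.1 ^ 2) (‖z.2‖ ^ 2) := by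
  obtain ⟨t, x⟩ := z
  rcases hz.1.lt_or_eq with h | h
  · exact poissonExtension_power hs ha haN h
  · obtain rfl : 0 = t := h
    have hx : x ≠ 0 := by
      rintro rfl
      exact hz.2 rfl
    have hx : 0 < ‖x‖ := norm_pos_iff.2 hx
    simp only [poissonExtension, lt_irrefl, if_false]
    rw [zero_pow two_ne_zero, powerProfile_zero hs ha (by positivity), ← Real.rpow_natCast,
      ← Real.rpow_mul hx.le]
    congr 1
    push_cast
    ring

lemma poissonExtension_power_pos (hs : 0 < s) (ha : 0 < a) (haN : a < N)
    {z : ℝ × EuclideanSpace ℝ (Fin N)} (hz : z ∈ closedUpperHalfPunctured N) :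
    0 < poissonExtension s (fun x => ‖x‖ ^ (-a)) z := by
  obtain ⟨t, x⟩ := z
  rcases hz.1.lt_or_eq with h | h
  · have h : 0 < t := h
    rw [poissonExtension_power hs ha haN h]
    exact powerProfile_pos hs ha haN (by positivity) (by positivity)
  · obtain rfl : 0 = t := h
    have hx : x ≠ 0 := by
      rintro rfl
      exact hz.2 rfl
    simp only [poissonExtension, lt_irrefl, if_false]
    exact Real.rpow_pos_of_pos (norm_pos_iff.2 hx) _

end PoissonFormula

/-! ### Smoothness and the extension equation. -/

section Derivatives
variable {N : ℕ} {s a : ℝ}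

/-- `∂_T` of `powerProfile`. -/
noncomputable def powerProfileT (N : ℕ) (s a T X : ℝ) : ℝ :=
  Real.Gamma (a / 2 + s) / (Real.Gamma s * Real.Gamma (a / 2)) *
    (-(((N : ℝ) - a) / 2 - s) *
        eulerIntegral (((N : ℝ) - a) / 2) (((N : ℝ) - a) / 2 - s + 1) (a / 2 + s) T X -
      (a / 2 + s) *
        eulerIntegral (((N : ℝ) - a) / 2) (((N : ℝ) - a) / 2 - s) (a / 2 + s + 1) T X)

/-- `∂_X` of `powerProfile`. -/
noncomputable def powerProfileX (N : ℕ) (s a T X : ℝ) : ℝ :=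
  Real.Gamma (a / 2 + s) / (Real.Gamma s * Real.Gamma (a / 2)) *
    (-(a / 2 + s) *
        eulerIntegral (((N : ℝ) - a) / 2) (((N : ℝ) - a) / 2 - s) (a / 2 + s + 1) T X)

lemma contDiffOn_powerProfile (ha : 0 < a) (haN : a < N) :
    ContDiffOn ℝ ∞ (fun z : ℝ × ℝ => powerProfile N s a z.1 z.2) eulerDomain :=
  contDiffOn_const.mul (contDiffOn_eulerIntegral (by linarith) (by linarith))

lemma hasDerivAt_powerProfile_fst (ha : 0 < a) (haN : a < N) {T X : ℝ} (hT : 0 < T)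
    (hTX : 0 < T + X) :
    HasDerivAt (fun T => powerProfile N s a T X) (powerProfileT N s a T X) T :=
  (hasDerivAt_eulerIntegral_fst (by linarith) (by linarith) hT hTX).const_mul _

lemma hasDerivAt_powerProfile_snd (ha : 0 < a) (haN : a < N) {T X : ℝ} (hT : 0 < T)
    (hTX : 0 < T + X) :
    HasDerivAt (fun X => powerProfile N s a T X) (powerProfileX N s a T X) X :=
  (hasDerivAt_eulerIntegral_snd (by linarith) (by linarith) hT hTX).const_mul _

lemma continuousOn_powerProfileT (ha : 0 < a) (haN : a < N) :
    ContinuousOn (fun z : ℝ × ℝ => powerProfileT N s a z.1 z.2) eulerDomain :=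
  continuousOn_const.mul
    ((continuousOn_const.mul (contDiffOn_eulerIntegral (by linarith) (by linarith)).continuousOn).sub
      (continuousOn_const.mul (contDiffOn_eulerIntegral (by linarith) (by linarith)).continuousOn))

lemma continuousOn_powerProfileX (ha : 0 < a) (haN : a < N) :
    ContinuousOn (fun z : ℝ × ℝ => powerProfileX N s a z.1 z.2) eulerDomain :=
  continuousOn_const.mul
    (continuousOn_const.mul (contDiffOn_eulerIntegral (by linarith) (by linarith)).continuousOn)

/-- The extension equation in the variables `T = t²`, `X = |x|²`. -/
lemma powerProfile_equation (ha : 0 < a) (haN : a < N) {T X : ℝ} (hT : 0 < T) (hTX : 0 < T + X) :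
    ∃ gTT gXX : ℝ, HasDerivAt (fun T => powerProfileT N s a T X) gTT T ∧
      HasDerivAt (fun X => powerProfileX N s a T X) gXX X ∧
      T * gTT + (1 - s) * powerProfileT N s a T X + X * gXX +
        N / 2 * powerProfileX N s a T X = 0 := by
  have hb : 0 < ((N : ℝ) - a) / 2 := by linarith
  refine ⟨_, _, (((hasDerivAt_eulerIntegral_fst hb (by linarith) hT hTX).const_mul _).sub
    ((hasDerivAt_eulerIntegral_fst hb (by linarith) hT hTX).const_mul _)).const_mul _,
    ((hasDerivAt_eulerIntegral_snd hb (by linarith) hT hTX).const_mul _).const_mul _, ?_⟩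
  have h := eulerIntegral_equation (p := ((N : ℝ) - a) / 2 - s) (q := a / 2 + s) hb (by linarith)
    hT hTX
  rw [powerProfileT, powerProfileX]
  simp only [show ∀ r : ℝ, r + 1 + 1 = r + 2 by intro r; ring]
  linear_combination (Real.Gamma (a / 2 + s) / (Real.Gamma s * Real.Gamma (a / 2))) * h

/-- In `t²` and `|x|²` the extension is a smooth function composed with polynomials; the axis `x =
0` needs no separate treatment, because `eulerDomain` contains the points `(T, 0)` with `T > 0`. -/
lemma contDiffOn_poissonExtension_power (hs : 0 < s) (ha : 0 < a) (haN : a < N) :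
    ContDiffOn ℝ ∞ (poissonExtension s (fun x : EuclideanSpace ℝ (Fin N) => ‖x‖ ^ (-a)))
      (upperHalf N) := by
  have h : ContDiff ℝ ∞ (fun z : ℝ × EuclideanSpace ℝ (Fin N) => (z.1 ^ 2, ‖z.2‖ ^ 2)) :=
    (contDiff_fst.pow 2).prodMk (contDiff_snd.norm_sq ℝ)
  refine ((contDiffOn_powerProfile (s := s) ha haN).comp h.contDiffOn ?_).congr
    fun z hz => poissonExtension_power hs ha haN hz
  intro z (hz : 0 < z.1)
  exact ⟨by positivity, by positivity⟩

lemma partialT_poissonExtension_power (hs : 0 < s) (ha : 0 < a) (haN : a < N) {t : ℝ} (ht : 0 < t)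
    (x : EuclideanSpace ℝ (Fin N)) :
    partialT (poissonExtension s (fun x => ‖x‖ ^ (-a))) t x =
      2 * t * powerProfileT N s a (t ^ 2) (‖x‖ ^ 2) := by
  have h := (hasDerivAt_powerProfile_fst (s := s) ha haN (T := t ^ 2) (X := ‖x‖ ^ 2)
    (by positivity) (by positivity)).comp t (hasDerivAt_pow 2 t)
  have h' : HasDerivAt (fun τ => poissonExtension s (fun x => ‖x‖ ^ (-a)) (τ, x))
      (powerProfileT N s a (t ^ 2) (‖x‖ ^ 2) * ((2 : ℕ) * t ^ (2 - 1))) t := by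
    refine h.congr_of_eventuallyEq ?_
    filter_upwards [eventually_gt_nhds ht] with τ hτ
    exact poissonExtension_power hs ha haN hτ
  rw [partialT, h'.deriv]
  push_cast
  ring

lemma partialX_poissonExtension_power (hs : 0 < s) (ha : 0 < a) (haN : a < N) {t : ℝ} (ht : 0 < t)
    (i : Fin N) (x : EuclideanSpace ℝ (Fin N)) :
    partialX i (poissonExtension s (fun x => ‖x‖ ^ (-a))) t x =
      2 * x i * powerProfileX N s a (t ^ 2) (‖x‖ ^ 2) := by
  have h := (hasDerivAt_powerProfile_snd (s := s) ha haN (T := t ^ 2) (X := ‖x‖ ^ 2)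
    (by positivity) (by positivity)).comp_hasFDerivAt x
      (hasStrictFDerivAt_norm_sq x).hasFDerivAt
  have h' : (fun y => poissonExtension s (fun x => ‖x‖ ^ (-a)) (t, y)) =
      (fun X => powerProfile N s a (t ^ 2) X) ∘ fun y : EuclideanSpace ℝ (Fin N) => ‖y‖ ^ 2 := by
    funext y
    exact poissonExtension_power hs ha haN ht
  rw [partialX, h', h.fderiv]
  simp [EuclideanSpace.inner_single_right]
  ring

lemma weightedDiv_poissonExtension_power (hs : 0 < s) (ha : 0 < a) (haN : a < N)
    {t : ℝ} (ht : 0 < t) (x : EuclideanSpace ℝ (Fin N)) :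
    weightedDiv s (poissonExtension s (fun x => ‖x‖ ^ (-a))) t x = 0 := by
  obtain ⟨gTT, gXX, h1, h2, h3⟩ := powerProfile_equation (s := s) ha haN (T := t ^ 2)
    (X := ‖x‖ ^ 2) (by positivity) (by positivity)
  have d1 : partialT (fun z => z.1 ^ (1 - 2 * s) *
      partialT (poissonExtension s (fun x => ‖x‖ ^ (-a))) z.1 z.2) t x =
      t ^ (1 - 2 * s) * ((4 - 4 * s) * powerProfileT N s a (t ^ 2) (‖x‖ ^ 2) +
        4 * t ^ 2 * gTT) := by
    have h := (Real.hasDerivAt_rpow_const (p := 1 - 2 * s) (Or.inl ht.ne')).mul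
      (((hasDerivAt_id t).const_mul 2).mul (HasDerivAt.comp
        (h₂ := fun T => powerProfileT N s a T (‖x‖ ^ 2)) (h := fun t : ℝ => t ^ 2) t h1
        (hasDerivAt_pow 2 t)))
    have h' := h.congr_of_eventuallyEq (f₁ := fun τ => τ ^ (1 - 2 * s) *
        partialT (poissonExtension s (fun x => ‖x‖ ^ (-a))) τ x) (by
      filter_upwards [eventually_gt_nhds ht] with τ hτ
      rw [partialT_poissonExtension_power hs ha haN hτ]
      rfl)
    rw [partialT, h'.deriv]
    have e : t ^ (1 - 2 * s) = t ^ (1 - 2 * s - 1) * t := by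
      rw [← Real.rpow_add_one ht.ne']
      congr 1; ring
    simp only [Pi.mul_apply, Function.comp_apply, id_eq]
    rw [e]
    push_cast
    ring
  have d2 : ∀ i, partialX i (fun z => z.1 ^ (1 - 2 * s) *
      partialX i (poissonExtension s (fun x => ‖x‖ ^ (-a))) z.1 z.2) t x =
      t ^ (1 - 2 * s) * (2 * powerProfileX N s a (t ^ 2) (‖x‖ ^ 2) + 4 * x i ^ 2 * gXX) := by
    intro i
    have h := ((((EuclideanSpace.proj i : EuclideanSpace ℝ (Fin N) →L[ℝ] ℝ).hasFDerivAt
      (x := x)).const_mul 2).mul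
      (h2.comp_hasFDerivAt x (hasStrictFDerivAt_norm_sq x).hasFDerivAt)).const_mul
        (t ^ (1 - 2 * s))
    have h' : (fun y => t ^ (1 - 2 * s) *
        partialX i (poissonExtension s (fun x => ‖x‖ ^ (-a))) t y) = fun y =>
        t ^ (1 - 2 * s) * (2 * (EuclideanSpace.proj i : EuclideanSpace ℝ (Fin N) →L[ℝ] ℝ) y *
          ((fun X => powerProfileX N s a (t ^ 2) X) ∘
            fun y : EuclideanSpace ℝ (Fin N) => ‖y‖ ^ 2) y) := by
      funext y
      rw [partialX_poissonExtension_power hs ha haN ht]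
      rfl
    have h'' := h.fderiv
    rw [partialX]
    refine (congrArg (fun f => fderiv ℝ f x (EuclideanSpace.single i 1)) h').trans ?_
    refine (congrArg (fun L => L (EuclideanSpace.single i 1)) h'').trans ?_
    simp [EuclideanSpace.inner_single_right]
    ring
  have hsum : ∑ i, x i ^ 2 = ‖x‖ ^ 2 := by
    rw [EuclideanSpace.real_norm_sq_eq]
  rw [weightedDiv, d1, Finset.sum_congr rfl fun i _ => d2 i, ← Finset.mul_sum,
    Finset.sum_add_distrib, Finset.sum_const, ← Finset.sum_mul, ← Finset.mul_sum, hsum,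
    Finset.card_univ, Fintype.card_fin, nsmul_eq_mul]
  -- The chain rule for `T = t²`, `X = |x|²` turns the weighted divergence into `4 t^(1-2s)` times
  -- the profile equation.
  linear_combination 4 * t ^ (1 - 2 * s) * h3

end Derivatives

/-! ### Derivative bounds and Hölder continuity up to the boundary. -/

section Bounds
variable {N : ℕ} {s a : ℝ}

/-- Both terms of `g_T` are controlled by the one with `p = b - s + 1`. Since `s < 1` this exceeds
`b`, which is the singular regime and produces `T^(s-1)`. -/
lemma exists_abs_powerProfileT_le (N : ℕ) (hs : 0 < s) (hs1 : s < 1) (ha : 0 < a) (haN : a < N) :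
    ∃ K, 0 ≤ K ∧ ∀ T X, 0 < T → 0 ≤ X →
      |powerProfileT N s a T X| ≤ K * (T + X) ^ (-(a / 2 + s)) * T ^ (s - 1) := by
  have hb : 0 < ((N : ℝ) - a) / 2 := by linarith
  have h1 := Real.Gamma_pos_of_pos (show 0 < a / 2 + s by positivity)
  have h2 := Real.Gamma_pos_of_pos hs
  have h3 := Real.Gamma_pos_of_pos (show 0 < a / 2 by positivity)
  have h4 := Real.Gamma_pos_of_pos hb
  have h5 := Real.Gamma_pos_of_pos (show 0 < ((N : ℝ) - a) / 2 - s + 1 by linarith)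
  have h6 := Real.Gamma_pos_of_pos
    (show 0 < ((N : ℝ) - a) / 2 - s + 1 - ((N : ℝ) - a) / 2 by linarith)
  refine ⟨Real.Gamma (a / 2 + s) / (Real.Gamma s * Real.Gamma (a / 2)) *
    ((|((N : ℝ) - a) / 2 - s| + (a / 2 + s)) * (Real.Gamma (((N : ℝ) - a) / 2) *
      Real.Gamma (((N : ℝ) - a) / 2 - s + 1 - ((N : ℝ) - a) / 2) /
      Real.Gamma (((N : ℝ) - a) / 2 - s + 1))), by positivity, fun T X hT hX => ?_⟩
  have hE : 0 < T + X := by linarith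
  set E1 := eulerIntegral (((N : ℝ) - a) / 2) (((N : ℝ) - a) / 2 - s + 1) (a / 2 + s) T X with hE1
  set E2 := eulerIntegral (((N : ℝ) - a) / 2) (((N : ℝ) - a) / 2 - s) (a / 2 + s + 1) T X with hE2
  have p1 : 0 < E1 := eulerIntegral_pos hb (by linarith) hT hE
  have p2 : 0 < E2 := eulerIntegral_pos hb (by linarith) hT hE
  have le1 : E2 ≤ E1 := eulerIntegral_shift_le hb (by linarith) hT hX
  have le2 := eulerIntegral_le_of_lt hb (show ((N : ℝ) - a) / 2 < ((N : ℝ) - a) / 2 - s + 1 by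
    linarith) (show 0 ≤ a / 2 + s by positivity) hT hX
  rw [← hE1, show ((N : ℝ) - a) / 2 - (((N : ℝ) - a) / 2 - s + 1) = s - 1 by ring] at le2
  rw [powerProfileT, ← hE1, ← hE2, abs_mul, abs_of_nonneg (by positivity :
    0 ≤ Real.Gamma (a / 2 + s) / (Real.Gamma s * Real.Gamma (a / 2))), mul_assoc, mul_assoc]
  refine mul_le_mul_of_nonneg_left ?_ (by positivity)
  calc |-(((N : ℝ) - a) / 2 - s) * E1 - (a / 2 + s) * E2|
      ≤ |-(((N : ℝ) - a) / 2 - s) * E1| + |(a / 2 + s) * E2| := abs_sub _ _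
    _ = |((N : ℝ) - a) / 2 - s| * E1 + (a / 2 + s) * E2 := by
        rw [abs_mul, abs_neg, abs_of_pos p1,
          abs_of_pos (show 0 < (a / 2 + s) * E2 by positivity)]
    _ ≤ |((N : ℝ) - a) / 2 - s| * E1 + (a / 2 + s) * E1 := by gcongr
    _ = (|((N : ℝ) - a) / 2 - s| + (a / 2 + s)) * E1 := by ring
    _ ≤ (|((N : ℝ) - a) / 2 - s| + (a / 2 + s)) * _ :=
        mul_le_mul_of_nonneg_left le2 (by positivity)
    _ = _ := by ring

/-- Here the first exponent remains `b - s`, so the estimate that is nonsingular in `T` applies. -/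
lemma exists_abs_powerProfileX_le (N : ℕ) (hs : 0 < s) (ha : 0 < a) (haN : a < N) :
    ∃ K, 0 ≤ K ∧ ∀ T X, 0 < T → 0 ≤ X →
      |powerProfileX N s a T X| ≤ K * (T + X) ^ (-(a / 2 + 1)) := by
  have hb : 0 < ((N : ℝ) - a) / 2 := by linarith
  have h1 := Real.Gamma_pos_of_pos (show 0 < a / 2 + s by positivity)
  have h2 := Real.Gamma_pos_of_pos hs
  have h3 := Real.Gamma_pos_of_pos (show 0 < a / 2 by positivity)
  have h4 := Real.Gamma_pos_of_pos hb
  have h5 := Real.Gamma_pos_of_pos (show 0 < a / 2 + s + 1 by linarith)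
  have h6 := Real.Gamma_pos_of_pos (show 0 < a / 2 + s + 1 - s by linarith)
  have h7 := Real.Gamma_pos_of_pos
    (show 0 < ((N : ℝ) - a) / 2 + (a / 2 + s + 1) - s by linarith)
  refine ⟨Real.Gamma (a / 2 + s) / (Real.Gamma s * Real.Gamma (a / 2)) * ((a / 2 + s) *
    (Real.Gamma s * Real.Gamma (a / 2 + s + 1 - s) / Real.Gamma (a / 2 + s + 1) +
      Real.Gamma (((N : ℝ) - a) / 2) * Real.Gamma (a / 2 + s + 1 - s) /
        Real.Gamma (((N : ℝ) - a) / 2 + (a / 2 + s + 1) - s))), by positivity,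
    fun T X hT hX => ?_⟩
  have hE : 0 < T + X := by linarith
  have p2 : 0 < eulerIntegral (((N : ℝ) - a) / 2) (((N : ℝ) - a) / 2 - s) (a / 2 + s + 1) T X :=
    eulerIntegral_pos hb (by linarith) hT hE
  have le := eulerIntegral_sub_le hb hs (show s < a / 2 + s + 1 by linarith) hT hX
  rw [show s - (a / 2 + s + 1) = -(a / 2 + 1) by ring] at le
  rw [powerProfileX, abs_mul, abs_of_nonneg (by positivity :
    0 ≤ Real.Gamma (a / 2 + s) / (Real.Gamma s * Real.Gamma (a / 2))), abs_mul, abs_neg,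
    abs_of_pos p2, abs_of_pos (by positivity : 0 < a / 2 + s), mul_assoc, mul_assoc]
  refine mul_le_mul_of_nonneg_left (mul_le_mul_of_nonneg_left (le.trans_eq ?_) (by positivity))
    (by positivity)
  ring

lemma continuousWithinAt_powerProfile (hs : 0 < s) (ha : 0 < a) (haN : a < N) {T X : ℝ}
    (hT : 0 ≤ T) (hTX : 0 < T + X) :
    ContinuousWithinAt (fun z : ℝ × ℝ => powerProfile N s a z.1 z.2) {z | 0 ≤ z.1} (T, X) := by
  rcases hT.lt_or_eq with h | rfl
  · exact ((contDiffOn_powerProfile (s := s) ha haN).continuousOn.continuousAt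
      (isOpen_eulerDomain.mem_nhds ⟨h, hTX⟩)).continuousWithinAt
  · exact continuousWithinAt_const.mul (continuousWithinAt_eulerIntegral_zero (by linarith) hs
      (by linarith) (by linarith))

/-- The bound on `g_T` is the derivative of a multiple of `T^s`. Adding `g` to that multiple, or
subtracting it, gives monotone functions; comparison of the end values includes `T = 0`, where only
continuity of `g` is available. -/
lemma exists_powerProfile_sub_le_fst (N : ℕ) (hs : 0 < s) (hs1 : s < 1) (ha : 0 < a)
    (haN : a < N) : ∃ K, 0 ≤ K ∧ ∀ ε T T' X, 0 < ε → 0 ≤ T → T ≤ T' → 0 ≤ X → ε ≤ T + X →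
      |powerProfile N s a T X - powerProfile N s a T' X| ≤
        K * ε ^ (-(a / 2 + s)) * (T' ^ s - T ^ s) := by
  obtain ⟨K, hK, hle⟩ := exists_abs_powerProfileT_le N hs hs1 ha haN
  refine ⟨K / s, by positivity, fun ε T T' X hε hT hTT hX hεTX => ?_⟩
  have hcont : ContinuousOn (fun T => powerProfile N s a T X) (Icc T T') := fun τ hτ =>
    (continuousWithinAt_powerProfile hs ha haN (hT.trans hτ.1)
      (by linarith [hτ.1])).comp (f := fun τ : ℝ => (τ, X))
      (by fun_prop) fun σ hσ => hT.trans hσ.1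
  have hcont' : ContinuousOn (fun τ : ℝ => K / s * ε ^ (-(a / 2 + s)) * τ ^ s) (Icc T T') :=
    (continuous_const.mul (Real.continuous_rpow_const hs.le)).continuousOn
  have hder : ∀ τ ∈ interior (Icc T T'), 0 < τ ∧ HasDerivAt (fun T => powerProfile N s a T X)
      (powerProfileT N s a τ X) τ ∧ HasDerivAt
      (fun τ : ℝ => K / s * ε ^ (-(a / 2 + s)) * τ ^ s)
      (K * ε ^ (-(a / 2 + s)) * τ ^ (s - 1)) τ ∧
      |powerProfileT N s a τ X| ≤ K * ε ^ (-(a / 2 + s)) * τ ^ (s - 1) := by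
    intro τ hτ
    rw [interior_Icc] at hτ
    have hτ0 : 0 < τ := hT.trans_lt hτ.1
    refine ⟨hτ0, hasDerivAt_powerProfile_fst ha haN hτ0 (by linarith), ?_,
      (hle τ X hτ0 hX).trans ?_⟩
    · refine ((Real.hasDerivAt_rpow_const (p := s) (Or.inl hτ0.ne')).const_mul _).congr_deriv ?_
      field_simp
    · have : (τ + X) ^ (-(a / 2 + s)) ≤ ε ^ (-(a / 2 + s)) :=
        Real.rpow_le_rpow_of_nonpos hε (by linarith [hτ.1]) (by linarith)
      gcongr
  have m1 := monotoneOn_of_deriv_nonneg (convex_Icc T T') (hcont'.sub hcont)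
    (fun τ hτ => ((hder τ hτ).2.2.1.sub (hder τ hτ).2.1).differentiableAt.differentiableWithinAt)
    (fun τ hτ => by
      rw [((hder τ hτ).2.2.1.sub (hder τ hτ).2.1).deriv]
      linarith [(abs_le.1 (hder τ hτ).2.2.2).2])
  have m2 := monotoneOn_of_deriv_nonneg (convex_Icc T T') (hcont'.add hcont)
    (fun τ hτ => ((hder τ hτ).2.2.1.add (hder τ hτ).2.1).differentiableAt.differentiableWithinAt)
    (fun τ hτ => by
      rw [((hder τ hτ).2.2.1.add (hder τ hτ).2.1).deriv]
      linarith [(abs_le.1 (hder τ hτ).2.2.2).1])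
  have l1 := m1 (left_mem_Icc.2 hTT) (right_mem_Icc.2 hTT) hTT
  have l2 := m2 (left_mem_Icc.2 hTT) (right_mem_Icc.2 hTT) hTT
  simp only [Pi.sub_apply, Pi.add_apply] at l1 l2
  rw [mul_sub]
  exact abs_le.2 ⟨by linarith, by linarith⟩

/-- The mean value inequality in `X` for `T > 0`, on a half-line where `T + X ≥ ε`; the case `T = 0`
follows by letting `T → 0`. -/
lemma exists_powerProfile_sub_le_snd (N : ℕ) (hs : 0 < s) (ha : 0 < a)
    (haN : a < N) : ∃ K, 0 ≤ K ∧ ∀ ε T X X', 0 < ε → 0 ≤ T → 0 ≤ X → 0 ≤ X' → ε ≤ T + X →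
      ε ≤ T + X' → |powerProfile N s a T X - powerProfile N s a T X'| ≤
        K * ε ^ (-(a / 2 + 1)) * |X - X'| := by
  obtain ⟨K, hK, hle⟩ := exists_abs_powerProfileX_le N hs ha haN
  have main : ∀ ε T X X', 0 < ε → 0 < T → 0 ≤ X → 0 ≤ X' → ε ≤ T + X → ε ≤ T + X' →
      |powerProfile N s a T X - powerProfile N s a T X'| ≤
        K * ε ^ (-(a / 2 + 1)) * |X - X'| := by
    intro ε T X X' hε hT hX hX' hεX hεX'
    refine Convex.norm_image_sub_le_of_norm_hasDerivWithin_le (s := Ici (max 0 (ε - T)))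
      (f := fun X => powerProfile N s a T X) (f' := fun X => powerProfileX N s a T X)
      (fun Y hY => ?_) (fun Y hY => ?_) (convex_Ici _)
      (mem_Ici.2 (max_le hX' (by linarith))) (mem_Ici.2 (max_le hX (by linarith)))
    · obtain ⟨h1, h2⟩ := max_le_iff.1 (mem_Ici.1 hY)
      exact (hasDerivAt_powerProfile_snd ha haN hT (by linarith)).hasDerivWithinAt
    · obtain ⟨h1, h2⟩ := max_le_iff.1 (mem_Ici.1 hY)
      refine (hle T Y hT h1).trans (mul_le_mul_of_nonneg_left ?_ hK)
      exact Real.rpow_le_rpow_of_nonpos hε (by linarith) (by linarith)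
  refine ⟨K, hK, fun ε T X X' hε hT hX hX' hεX hεX' => ?_⟩
  rcases hT.lt_or_eq with h | rfl
  · exact main ε T X X' hε h hX hX' hεX hεX'
  · have ht : ∀ X, ε ≤ 0 + X → Tendsto (fun T => powerProfile N s a T X) (𝓝[>] 0)
        (𝓝 (powerProfile N s a 0 X)) := fun X hX =>
      ((continuousWithinAt_powerProfile hs ha haN le_rfl (by linarith)).comp
        (f := fun τ : ℝ => (τ, X)) (s := Ioi 0) (by fun_prop) fun τ (hτ : 0 < τ) => show 0 ≤ τ from hτ.le)
    refine le_of_tendsto ((ht X hεX).sub (ht X' hεX')).abs ?_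
    filter_upwards [self_mem_nhdsWithin] with T (hT : 0 < T)
    exact main ε T X X' hε hT hX hX' (by linarith) (by linarith)

lemma exists_powerProfile_sub_le (hs : 0 < s) (hs1 : s < 1) (ha : 0 < a)
    (haN : a < N) {ε : ℝ} (hε : 0 < ε) :
    ∃ A B, 0 ≤ A ∧ 0 ≤ B ∧ ∀ T T' X X', 0 ≤ T → 0 ≤ T' → 0 ≤ X → 0 ≤ X' → ε ≤ T + X →
      ε ≤ T' + X' → |powerProfile N s a T X - powerProfile N s a T' X'| ≤
        A * |T ^ s - T' ^ s| + B * |X - X'| := by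
  obtain ⟨K, hK, h1⟩ := exists_powerProfile_sub_le_fst N hs hs1 ha haN
  obtain ⟨L, hL, h2⟩ := exists_powerProfile_sub_le_snd N hs ha haN
  refine ⟨K * ε ^ (-(a / 2 + s)), L * ε ^ (-(a / 2 + 1)), by positivity, by positivity, ?_⟩
  have main : ∀ T T' X X', T ≤ T' → 0 ≤ T → 0 ≤ T' → 0 ≤ X → 0 ≤ X' → ε ≤ T + X →
      ε ≤ T' + X' → |powerProfile N s a T X - powerProfile N s a T' X'| ≤
        K * ε ^ (-(a / 2 + s)) * |T ^ s - T' ^ s| + L * ε ^ (-(a / 2 + 1)) * |X - X'| := by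
    intro T T' X X' hTT hT hT' hX hX' hεX hεX'
    refine (abs_sub_le _ (powerProfile N s a T' X) _).trans (add_le_add ?_ ?_)
    · refine (h1 ε T T' X hε hT hTT hX hεX).trans (mul_le_mul_of_nonneg_left ?_ (by positivity))
      rw [abs_sub_comm]
      exact le_abs_self _
    · exact h2 ε T' X X' hε hT' hX hX' (by linarith) hεX'
  intro T T' X X' hT hT' hX hX' hεX hεX'
  rcases le_total T T' with h | h
  · exact main T T' X X' h hT hT' hX hX' hεX hεX'
  · rw [abs_sub_comm, abs_sub_comm (T ^ s), abs_sub_comm X]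
    exact main T' T X' X h hT' hT hX' hX hεX' hεX

lemma abs_rpow_sub_rpow_le {x y r : ℝ} (hx : 0 ≤ x) (hy : 0 ≤ y) (hr : 0 ≤ r) (hr1 : r ≤ 1) :
    |x ^ r - y ^ r| ≤ |x - y| ^ r := by
  have main : ∀ x y : ℝ, 0 ≤ y → y ≤ x → |x ^ r - y ^ r| ≤ |x - y| ^ r := by
    intro x y hy hxy
    have h := NNReal.rpow_add_le_add_rpow ⟨x - y, sub_nonneg.2 hxy⟩ ⟨y, hy⟩ hr hr1
    have h' : (x - y + y) ^ r ≤ (x - y) ^ r + y ^ r := by exact_mod_cast h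
    rw [sub_add_cancel] at h'
    rw [abs_of_nonneg (sub_nonneg.2 (Real.rpow_le_rpow hy hxy hr)),
      abs_of_nonneg (sub_nonneg.2 hxy)]
    linarith
  rcases le_total x y with h | h
  · rw [abs_sub_comm, abs_sub_comm x]
    exact main y x hx h
  · exact main x y hy h

/-- On a compact set avoiding the origin, `T + X` is bounded below. The profile is Lipschitz in `T^s
= (t^s)²` and in `X`, and `t^s` is Hölder of order `s` in `t`. -/
lemma locallyHolderOn_poissonExtension_power (hs : 0 < s) (hs1 : s < 1) (ha : 0 < a)
    (haN : a < N) :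
    LocallyHolderOn s.toNNReal (poissonExtension s fun x : EuclideanSpace ℝ (Fin N) => ‖x‖ ^ (-a))
      (closedUpperHalfPunctured N) := by
  intro K hK hKS
  obtain ⟨ε, hε, hεK⟩ := hK.exists_forall_le' (a := 0)
    (f := fun z : ℝ × EuclideanSpace ℝ (Fin N) => z.1 ^ 2 + ‖z.2‖ ^ 2) (by fun_prop) (by
      intro z hz
      have h := (hKS hz).2
      by_contra! hle
      have h1 : z.1 = 0 := by nlinarith [sq_nonneg z.1, sq_nonneg ‖z.2‖]
      have h2 : ‖z.2‖ = 0 := by nlinarith [sq_nonneg z.1, sq_nonneg ‖z.2‖]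
      exact h (Prod.ext h1 (norm_eq_zero.1 h2)))
  obtain ⟨R, hR, hRK⟩ := hK.isBounded.exists_pos_norm_le
  obtain ⟨A, B, hA, hB, hAB⟩ := exists_powerProfile_sub_le (N := N) hs hs1 ha haN hε
  set C : ℝ := A * (2 * R ^ s) + B * (2 * R * (2 * R) ^ (1 - s)) with hC
  have hC0 : 0 ≤ C := by positivity
  refine ⟨C.toNNReal, fun z hz w hw => ?_⟩
  have key : dist (poissonExtension s (fun x : EuclideanSpace ℝ (Fin N) => ‖x‖ ^ (-a)) z)
      (poissonExtension s (fun x : EuclideanSpace ℝ (Fin N) => ‖x‖ ^ (-a)) w) ≤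
      C * dist z w ^ s := by
    rw [poissonExtension_power_of_closed hs ha haN (hKS hz),
      poissonExtension_power_of_closed hs ha haN (hKS hw), Real.dist_eq]
    have hz0 : 0 ≤ z.1 := (hKS hz).1
    have hw0 : 0 ≤ w.1 := (hKS hw).1
    have hz1 : z.1 ≤ R := (le_abs_self _).trans ((norm_fst_le z).trans (hRK z hz))
    have hw1 : w.1 ≤ R := (le_abs_self _).trans ((norm_fst_le w).trans (hRK w hw))
    have hz2 : ‖z.2‖ ≤ R := (norm_snd_le z).trans (hRK z hz)
    have hw2 : ‖w.2‖ ≤ R := (norm_snd_le w).trans (hRK w hw)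
    have hd1 : |z.1 - w.1| ≤ dist z w := by
      rw [← Real.dist_eq]
      exact le_max_left _ _
    have hd2 : |‖z.2‖ - ‖w.2‖| ≤ dist z w := by
      refine (abs_norm_sub_norm_le _ _).trans ?_
      rw [← dist_eq_norm]
      exact le_max_right _ _
    have hd3 : dist z w ≤ 2 * R := by
      rw [dist_eq_norm]
      refine (norm_sub_le _ _).trans ?_
      linarith [hRK z hz, hRK w hw]
    have hsq : ∀ x : ℝ, 0 ≤ x → (x ^ 2) ^ s = (x ^ s) ^ 2 := by
      intro x hx
      rw [← Real.rpow_natCast, ← Real.rpow_natCast, ← Real.rpow_mul hx, ← Real.rpow_mul hx,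
        mul_comm]
    have e1 : |(z.1 ^ 2) ^ s - (w.1 ^ 2) ^ s| ≤ 2 * R ^ s * dist z w ^ s := by
      rw [hsq _ hz0, hsq _ hw0, sq_sub_sq, abs_mul]
      refine mul_le_mul ?_ ?_ (abs_nonneg _) (by positivity)
      · rw [abs_of_nonneg (by positivity)]
        have := Real.rpow_le_rpow hz0 hz1 hs.le
        have := Real.rpow_le_rpow hw0 hw1 hs.le
        linarith
      · exact (abs_rpow_sub_rpow_le hz0 hw0 hs.le hs1.le).trans
          (Real.rpow_le_rpow (abs_nonneg _) hd1 hs.le)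
    have e2 : |‖z.2‖ ^ 2 - ‖w.2‖ ^ 2| ≤ 2 * R * (2 * R) ^ (1 - s) * dist z w ^ s := by
      rw [sq_sub_sq, abs_mul, mul_assoc]
      refine mul_le_mul ?_ (hd2.trans ?_) (abs_nonneg _) (by positivity)
      · rw [abs_of_nonneg (by positivity)]
        linarith
      · rcases (dist_nonneg (x := z) (y := w)).eq_or_lt with h | h
        · rw [← h]
          positivity
        · calc dist z w = dist z w ^ (1 - s) * dist z w ^ s := by
                rw [← Real.rpow_add h, sub_add_cancel, Real.rpow_one]
            _ ≤ (2 * R) ^ (1 - s) * dist z w ^ s := by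
                have := Real.rpow_le_rpow h.le hd3 (by linarith : 0 ≤ 1 - s)
                gcongr
    calc _ ≤ A * |(z.1 ^ 2) ^ s - (w.1 ^ 2) ^ s| + B * |‖z.2‖ ^ 2 - ‖w.2‖ ^ 2| :=
          hAB _ _ _ _ (by positivity) (by positivity) (by positivity) (by positivity)
            (hεK z hz) (hεK w hw)
      _ ≤ A * (2 * R ^ s * dist z w ^ s) +
          B * (2 * R * (2 * R) ^ (1 - s) * dist z w ^ s) := by gcongr
      _ = _ := by rw [hC]; ring
  rw [edist_dist, edist_dist, Real.coe_toNNReal s hs.le,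
    ENNReal.ofReal_rpow_of_nonneg dist_nonneg hs.le]
  refine (ENNReal.ofReal_le_ofReal key).trans_eq ?_
  rw [ENNReal.ofReal_mul hC0]
  rfl

end Bounds

/-! ### The conormal derivative and the constant `γ`. -/

section NormalDerivative
variable {N : ℕ} {s a : ℝ}

lemma hardyGamma_eq (N : ℕ) (s α : ℝ) :
    hardyGamma N s α = 2 ^ (2 * s) *
      (Real.Gamma (((N : ℝ) - (N / 2 - s - α)) / 2) / Real.Gamma ((N / 2 - s - α) / 2)) *
      (Real.Gamma ((N / 2 - s - α) / 2 + s) /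
        Real.Gamma (((N : ℝ) - (N / 2 - s - α)) / 2 - s)) := by
  rw [hardyGamma]
  congr 3
  all_goals congr 1
  all_goals ring

/-- The constant `γ` in terms of the exponent `a` of `|x|^(-a)`. -/
noncomputable def powerGamma (N : ℕ) (s a : ℝ) : ℝ :=
  2 ^ (2 * s) * (Real.Gamma (((N : ℝ) - a) / 2) / Real.Gamma (a / 2)) *
    (Real.Gamma (a / 2 + s) / Real.Gamma (((N : ℝ) - a) / 2 - s))

/-- The limit of `T^(1-s) ∂_T` of the profile, at `X = 1`. -/
noncomputable def profileSlope (N : ℕ) (s a : ℝ) : ℝ :=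
  Real.Gamma (a / 2 + s) / (Real.Gamma s * Real.Gamma (a / 2)) *
    (-(((N : ℝ) - a) / 2 - s) * (Real.Gamma (((N : ℝ) - a) / 2) * Real.Gamma (1 - s) /
      Real.Gamma (((N : ℝ) - a) / 2 - s + 1)))

lemma kappa_mul_powerGamma (hs : 0 < s) (hs1 : s < 1) (ha : 0 < a) (haN : a < N) :
    kappa s * powerGamma N s a = -2 * profileSlope N s a := by
  have h2 := Real.Gamma_pos_of_pos hs
  have h3 := Real.Gamma_pos_of_pos (show 0 < a / 2 by positivity)
  have h5 := Real.Gamma_pos_of_pos (show 0 < ((N : ℝ) - a) / 2 - s + 1 by linarith)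
  rw [kappa, powerGamma, profileSlope]
  have e : (2 : ℝ) ^ (2 * s) = 2 ^ (2 * s - 1) * 2 := by
    rw [← Real.rpow_add_one two_ne_zero]
    congr 1; ring
  -- When `b = s` the left side contains `1/Γ(0)`, which is `0`, and the right side the factor `b -
  -- s = 0`. Otherwise `Γ(p+1) = pΓ(p)` with `p = b - s`.
  rcases eq_or_ne (((N : ℝ) - a) / 2 - s) 0 with h | h
  · rw [h, Real.Gamma_zero]
    simp
  · have h6 := Real.Gamma_add_one h
    rw [h6] at h5 ⊢
    have h7 : Real.Gamma (((N : ℝ) - a) / 2 - s) ≠ 0 := fun h0 => by simp [h0] at h5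
    rw [e]
    generalize ((N : ℝ) - a) / 2 - s = p at *
    field_simp

/-- Only the term with `p = b - s + 1` is of order `T^(s-1)`. The other stays bounded near `T = 0`,
so the factor `T^(1-s)` removes it. -/
lemma tendsto_rpow_mul_powerProfileT (hs : 0 < s) (hs1 : s < 1) (ha : 0 < a) (haN : a < N) {X : ℝ}
    (hX : 0 < X) :
    Tendsto (fun z : ℝ × ℝ => z.1 ^ (1 - s) * powerProfileT N s a z.1 z.2) (𝓝[>] 0 ×ˢ 𝓝 X)
      (𝓝 (profileSlope N s a * X ^ (-(a / 2 + s)))) := by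
  have hb : 0 < ((N : ℝ) - a) / 2 := by linarith
  have hle : (𝓝[>] (0 : ℝ) ×ˢ 𝓝 X) ≤ 𝓝 ((0 : ℝ), X) := by
    rw [nhds_prod_eq]
    exact Filter.prod_mono nhdsWithin_le_nhds le_rfl
  have hn : ∀ᶠ z : ℝ × ℝ in 𝓝[>] 0 ×ˢ 𝓝 X, 0 < z.1 ∧ 0 < z.2 :=
    (eventually_mem_nhdsWithin (a := (0 : ℝ)) (s := Ioi 0)).prod_mk (eventually_gt_nhds hX)
  have t1 := tendsto_rpow_mul_eulerIntegral hb
    (show ((N : ℝ) - a) / 2 < ((N : ℝ) - a) / 2 - s + 1 by linarith)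
    (show 0 ≤ a / 2 + s by positivity) hX
  rw [show ((N : ℝ) - a) / 2 - s + 1 - ((N : ℝ) - a) / 2 = 1 - s by ring] at t1
  set L := Real.Gamma s * Real.Gamma (a / 2 + s + 1 - s) / Real.Gamma (a / 2 + s + 1) +
      Real.Gamma (((N : ℝ) - a) / 2) * Real.Gamma (a / 2 + s + 1 - s) /
        Real.Gamma (((N : ℝ) - a) / 2 + (a / 2 + s + 1) - s) with hL
  have t2 : Tendsto (fun z : ℝ × ℝ => z.1 ^ (1 - s) *
      eulerIntegral (((N : ℝ) - a) / 2) (((N : ℝ) - a) / 2 - s) (a / 2 + s + 1) z.1 z.2)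
      (𝓝[>] 0 ×ˢ 𝓝 X) (𝓝 0) := by
    have hc : ContinuousAt
        (fun z : ℝ × ℝ => z.1 ^ (1 - s) * ((z.1 + z.2) ^ (s - (a / 2 + s + 1)) * L)) ((0 : ℝ), X) := by
      refine (continuousAt_fst.rpow_const (Or.inr (by linarith))).mul
        (((continuousAt_fst.add continuousAt_snd).rpow_const (Or.inl ?_)).mul continuousAt_const)
      simpa using hX.ne'
    have hc' := hc.tendsto.mono_left hle
    simp only [Real.zero_rpow (by linarith : 1 - s ≠ 0), zero_mul] at hc'
    refine squeeze_zero' ?_ ?_ hc'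
    · filter_upwards [hn] with z hz
      exact mul_nonneg (Real.rpow_nonneg hz.1.le _)
        (eulerIntegral_pos hb (by linarith) hz.1 (by linarith)).le
    · filter_upwards [hn] with z hz
      exact mul_le_mul_of_nonneg_left
        (eulerIntegral_sub_le hb hs (by linarith) hz.1 hz.2.le) (Real.rpow_nonneg hz.1.le _)
  have t3 := ((t1.const_mul (-(((N : ℝ) - a) / 2 - s))).sub (t2.const_mul (a / 2 + s))).const_mul
    (Real.Gamma (a / 2 + s) / (Real.Gamma s * Real.Gamma (a / 2)))
  refine (t3.congr fun z => ?_).trans_eq ?_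
  · rw [powerProfileT]
    ring
  · rw [profileSlope]
    congr 1
    ring

/-- Locally uniform convergence is equivalent to convergence as `t → 0` and `y → x` jointly,
compared with the limit function at `y`. As that function is continuous off the origin, the joint
limit of the profile suffices. -/
lemma tendsto_normal_derivative (hs : 0 < s) (hs1 : s < 1) (ha : 0 < a) (haN : a < N) :
    TendstoLocallyUniformlyOn
        (fun (t : ℝ) (x : EuclideanSpace ℝ (Fin N)) =>
          -(t ^ (1 - 2 * s) * partialT (poissonExtension s fun x => ‖x‖ ^ (-a)) t x))
        (fun x => kappa s * (powerGamma N s a * ‖x‖ ^ (-2 * s) * ‖x‖ ^ (-a)))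
        (𝓝[>] 0) {0}ᶜ := by
  rw [tendstoLocallyUniformlyOn_iff_forall_tendsto]
  intro x hx
  have hx : 0 < ‖x‖ := norm_pos_iff.2 hx
  set f : EuclideanSpace ℝ (Fin N) → ℝ :=
    fun x => kappa s * (powerGamma N s a * ‖x‖ ^ (-2 * s) * ‖x‖ ^ (-a)) with hf
  have hfc : ContinuousAt f x := by
    refine continuousAt_const.mul ((continuousAt_const.mul
      (continuous_norm.continuousAt.rpow_const (Or.inl hx.ne'))).mul
      (continuous_norm.continuousAt.rpow_const (Or.inl hx.ne')))
  have t1 : Tendsto (fun y : ℝ × EuclideanSpace ℝ (Fin N) => f y.2)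
      (𝓝[>] 0 ×ˢ 𝓝[{0}ᶜ] x) (𝓝 (f x)) :=
    (hfc.tendsto.mono_left nhdsWithin_le_nhds).comp tendsto_snd
  have hsq : Tendsto (fun y : ℝ × EuclideanSpace ℝ (Fin N) => (y.1 ^ 2, ‖y.2‖ ^ 2))
      (𝓝[>] 0 ×ˢ 𝓝[{0}ᶜ] x) (𝓝[>] 0 ×ˢ 𝓝 (‖x‖ ^ 2)) := by
    refine Tendsto.prodMap (f := fun t : ℝ => t ^ 2)
      (g := fun y : EuclideanSpace ℝ (Fin N) => ‖y‖ ^ 2) ?_ ?_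
    · refine tendsto_nhdsWithin_iff.2 ⟨?_, ?_⟩
      · have : Tendsto (fun t : ℝ => t ^ 2) (𝓝 0) (𝓝 (0 ^ 2)) := (continuous_pow 2).tendsto 0
        rw [zero_pow two_ne_zero] at this
        exact this.mono_left nhdsWithin_le_nhds
      · filter_upwards [self_mem_nhdsWithin] with t (ht : 0 < t)
        exact pow_pos ht 2
    · exact ((continuous_norm.pow 2).tendsto x).mono_left nhdsWithin_le_nhds
  have t2 : Tendsto (fun y : ℝ × EuclideanSpace ℝ (Fin N) =>
      -(y.1 ^ (1 - 2 * s) * partialT (poissonExtension s fun x => ‖x‖ ^ (-a)) y.1 y.2))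
      (𝓝[>] 0 ×ˢ 𝓝[{0}ᶜ] x) (𝓝 (f x)) := by
    have t3 := ((tendsto_rpow_mul_powerProfileT hs hs1 ha haN (X := ‖x‖ ^ 2)
      (by positivity)).comp hsq).const_mul (-2)
    have e : -2 * (profileSlope N s a * (‖x‖ ^ 2) ^ (-(a / 2 + s))) = f x := by
      rw [hf]
      beta_reduce
      rw [← mul_assoc (-2), ← kappa_mul_powerGamma hs hs1 ha haN, mul_assoc (powerGamma N s a),
        ← mul_assoc, ← Real.rpow_add hx, ← Real.rpow_natCast, ← Real.rpow_mul hx.le]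
      congr 2
      push_cast
      ring
    rw [e] at t3
    refine t3.congr' ?_
    have hn : ∀ᶠ y : ℝ × EuclideanSpace ℝ (Fin N) in 𝓝[>] 0 ×ˢ 𝓝[{0}ᶜ] x, 0 < y.1 :=
      (eventually_mem_nhdsWithin (a := (0 : ℝ)) (s := Ioi 0)).prod_inl _
    filter_upwards [hn] with y hy
    rw [partialT_poissonExtension_power hs ha haN hy, Function.comp_apply]
    have e2 : (y.1 ^ 2) ^ (1 - s) = y.1 ^ (1 - 2 * s) * y.1 := by
      rw [← Real.rpow_add_one hy.ne', ← Real.rpow_natCast, ← Real.rpow_mul hy.le]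
      congr 1
      push_cast
      ring
    simp only [e2]
    ring
  exact ((t1.prodMk_nhds t2).mono_right (nhds_le_uniformity _))

end NormalDerivative

/-! ### Weighted square integrability of the gradient. -/

section Gradient
variable {N : ℕ} {s a : ℝ}

lemma gradSq_poissonExtension_power (hs : 0 < s) (ha : 0 < a) (haN : a < N) {t : ℝ} (ht : 0 < t)
    (x : EuclideanSpace ℝ (Fin N)) :
    gradSq (poissonExtension s fun x => ‖x‖ ^ (-a)) t x =
      4 * t ^ 2 * powerProfileT N s a (t ^ 2) (‖x‖ ^ 2) ^ 2 +
        4 * ‖x‖ ^ 2 * powerProfileX N s a (t ^ 2) (‖x‖ ^ 2) ^ 2 := by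
  have hsum : ∑ i, x i ^ 2 = ‖x‖ ^ 2 := by rw [EuclideanSpace.real_norm_sq_eq]
  rw [gradSq, partialT_poissonExtension_power hs ha haN ht]
  simp_rw [partialX_poissonExtension_power hs ha haN ht, mul_pow]
  rw [← Finset.sum_mul, ← Finset.mul_sum, hsum]
  ring

lemma rpow_neg_add_le {T X c μ ν : ℝ} (hT : 0 < T) (hX : 0 < X) (hμ : 0 ≤ μ) (hν : 0 ≤ ν)
    (hc : c = μ + ν) : (T + X) ^ (-c) ≤ T ^ (-μ) * X ^ (-ν) := by
  have hTX : 0 < T + X := by positivity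
  rw [hc, neg_add, Real.rpow_add hTX]
  have h1 : (T + X) ^ (-μ) ≤ T ^ (-μ) :=
    Real.rpow_le_rpow_of_nonpos hT (by linarith) (by linarith)
  have h2 : (T + X) ^ (-ν) ≤ X ^ (-ν) :=
    Real.rpow_le_rpow_of_nonpos hX (by linarith) (by linarith)
  gcongr

/-- The powers of `T + X` from the two derivative bounds are split between `T` and `X`. The
parameter `δ` leaves `t^(2δ-1)`, integrable at `0`, at the cost of a slightly worse power of `|x|`.
-/
lemma exists_weighted_gradSq_le (hs : 0 < s) (hs1 : s < 1) (ha : 0 < a) (haN : a < N) {δ : ℝ}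
    (hδs : δ ≤ s) (hδs1 : δ ≤ 1 - s) (hδ : 0 < δ) :
    ∃ K, ∀ (t : ℝ) (x : EuclideanSpace ℝ (Fin N)), 0 < t → x ≠ 0 →
      t ^ (1 - 2 * s) * gradSq (poissonExtension s fun x => ‖x‖ ^ (-a)) t x ≤
        K * (t ^ (2 * δ - 1) * ‖x‖ ^ (-(2 * (a + s + δ)))) := by
  obtain ⟨K, hK, hKle⟩ := exists_abs_powerProfileT_le N hs hs1 ha haN
  obtain ⟨L, hL, hLle⟩ := exists_abs_powerProfileX_le N hs ha haN
  refine ⟨4 * K ^ 2 + 4 * L ^ 2, fun t x ht hx => ?_⟩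
  have hx : 0 < ‖x‖ := norm_pos_iff.2 hx
  have hT : 0 < t ^ 2 := by positivity
  have hX : 0 < ‖x‖ ^ 2 := by positivity
  have hE : 0 < t ^ 2 + ‖x‖ ^ 2 := by positivity
  have sqrp : ∀ y r : ℝ, 0 < y → (y ^ 2) ^ r = y ^ (2 * r) := by
    intro y r hy
    rw [← Real.rpow_natCast, ← Real.rpow_mul hy.le]
    push_cast
    rfl
  have rpsq : ∀ y r : ℝ, 0 < y → (y ^ r) ^ 2 = y ^ (2 * r) := by
    intro y r hy
    rw [← Real.rpow_natCast, ← Real.rpow_mul hy.le]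
    push_cast
    ring_nf
  have b1 := pow_le_pow_left₀ (abs_nonneg _) (hKle _ _ hT hX.le) 2
  have b2 := pow_le_pow_left₀ (abs_nonneg _) (hLle _ _ hT hX.le) 2
  rw [sq_abs, mul_pow, mul_pow, rpsq _ _ hE, rpsq _ _ hT, sqrp _ _ ht] at b1
  rw [sq_abs, mul_pow, rpsq _ _ hE] at b2
  have c1 := rpow_neg_add_le hT hX (show 0 ≤ s - δ by linarith) (show 0 ≤ a + s + δ by linarith)
    (show a + 2 * s = s - δ + (a + s + δ) by ring)
  have c2 := rpow_neg_add_le hT hX (show 0 ≤ 1 - s - δ by linarith)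
    (show 0 ≤ a + s + δ by linarith) (show a + 1 = 1 - s - δ + (a + s + δ) by ring)
  rw [sqrp _ _ ht, sqrp _ _ hx] at c1 c2
  rw [gradSq_poissonExtension_power hs ha haN ht, mul_add, add_mul]
  refine add_le_add ?_ ?_
  · calc t ^ (1 - 2 * s) * (4 * t ^ 2 * powerProfileT N s a (t ^ 2) (‖x‖ ^ 2) ^ 2)
        ≤ t ^ (1 - 2 * s) * (4 * t ^ 2 * (K ^ 2 * (t ^ 2 + ‖x‖ ^ 2) ^ (2 * (-(a / 2 + s))) *
          t ^ (2 * (2 * (s - 1))))) := by gcongr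
      _ = 4 * K ^ 2 * ((t ^ (1 - 2 * s) * t ^ 2 * t ^ (2 * (2 * (s - 1)))) *
          (t ^ 2 + ‖x‖ ^ 2) ^ (-(a + 2 * s))) := by
          rw [show 2 * (-(a / 2 + s)) = -(a + 2 * s) by ring]
          ring
      _ ≤ 4 * K ^ 2 * ((t ^ (1 - 2 * s) * t ^ 2 * t ^ (2 * (2 * (s - 1)))) *
          (t ^ (2 * -(s - δ)) * ‖x‖ ^ (2 * -(a + s + δ)))) := by gcongr
      _ = 4 * K ^ 2 * ((t ^ (1 - 2 * s) * t ^ 2 * t ^ (2 * (2 * (s - 1))) *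
          t ^ (2 * -(s - δ))) * ‖x‖ ^ (2 * -(a + s + δ))) := by ring
      _ = _ := by
          rw [← Real.rpow_natCast t 2, ← Real.rpow_add ht, ← Real.rpow_add ht, ← Real.rpow_add ht]
          congr 3
          · push_cast
            ring
          · ring
  · calc t ^ (1 - 2 * s) * (4 * ‖x‖ ^ 2 * powerProfileX N s a (t ^ 2) (‖x‖ ^ 2) ^ 2)
        ≤ t ^ (1 - 2 * s) * (4 * (t ^ 2 + ‖x‖ ^ 2) *
          (L ^ 2 * (t ^ 2 + ‖x‖ ^ 2) ^ (2 * (-(a / 2 + 1))))) := by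
          gcongr
          linarith
      _ = 4 * L ^ 2 * (t ^ (1 - 2 * s) * (t ^ 2 + ‖x‖ ^ 2) ^ (-(a + 1))) := by
          have : (t ^ 2 + ‖x‖ ^ 2) ^ (-(a + 1)) =
              (t ^ 2 + ‖x‖ ^ 2) ^ (2 * (-(a / 2 + 1))) * (t ^ 2 + ‖x‖ ^ 2) := by
            rw [← Real.rpow_add_one hE.ne']
            congr 1
            ring
          rw [this]
          ring
      _ ≤ 4 * L ^ 2 * (t ^ (1 - 2 * s) *
          (t ^ (2 * -(1 - s - δ)) * ‖x‖ ^ (2 * -(a + s + δ)))) := by gcongr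
      _ = _ := by
          rw [← mul_assoc (t ^ (1 - 2 * s)), ← Real.rpow_add ht]
          congr 3
          · ring
          · ring

lemma integrableOn_weighted_gradSq (hs : 0 < s) (hs1 : s < 1) (ha : 0 < a) (haN : a < N)
    (hα : 2 * a + 2 * s < N) {R : ℝ} (hR : 0 < R) :
    IntegrableOn (fun z : ℝ × EuclideanSpace ℝ (Fin N) =>
      z.1 ^ (1 - 2 * s) * gradSq (poissonExtension s fun x => ‖x‖ ^ (-a)) z.1 z.2)
      (upperHalfBall N R) := by
  have hN : 0 < N := by
    have : (0 : ℝ) < N := ha.trans haN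
    exact_mod_cast this
  have : Nontrivial (EuclideanSpace ℝ (Fin N)) := by
    have : Nonempty (Fin N) := ⟨⟨0, hN⟩⟩
    infer_instance
  -- The conditions `δ < s` and `δ < 1 - s` permit the splitting, while `2(a+s+δ) < N` makes the
  -- power of `|x|` locally integrable. This room exists exactly because `2a + 2s < N`.
  obtain ⟨δ, hδ, hδ1⟩ := exists_between
    (show 0 < min (min s (1 - s)) (((N : ℝ) - 2 * a - 2 * s) / 2) from
      lt_min (lt_min hs (by linarith)) (by linarith))
  simp only [lt_min_iff] at hδ1
  obtain ⟨K, hK⟩ := exists_weighted_gradSq_le (N := N) hs hs1 ha haN hδ1.1.1.le hδ1.1.2.le hδ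
  have hopen : IsOpen (upperHalfBall N R) :=
    (isOpen_lt continuous_const continuous_fst).inter 
      (isOpen_lt (f := fun z : ℝ × EuclideanSpace ℝ (Fin N) => z.1 ^ 2 + ‖z.2‖ ^ 2) (by fun_prop)
        continuous_const)
  have hsub : upperHalfBall N R ⊆ Ioo 0 R ×ˢ Metric.ball 0 R := by
    intro z hz
    have h1 : 0 < z.1 := hz.1
    have h2 := hz.2
    refine ⟨⟨h1, ?_⟩, mem_ball_zero_iff.2 ?_⟩
    · exact lt_of_pow_lt_pow_left₀ 2 hR.le (by nlinarith [sq_nonneg ‖z.2‖])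
    · exact lt_of_pow_lt_pow_left₀ 2 hR.le (by nlinarith [sq_nonneg z.1])
  have i1 : IntegrableOn (fun t : ℝ => t ^ (2 * δ - 1)) (Ioo 0 R) :=
    (intervalIntegral.integrableOn_Ioo_rpow_iff hR).2 (by linarith)
  have i2 : IntegrableOn (fun x : EuclideanSpace ℝ (Fin N) => ‖x‖ ^ (-(2 * (a + s + δ))))
      (Metric.ball 0 R) := by
    refine integrableOn_ball_of_norm_le_rpow (C := 1) (α := 2 * (a + s + δ)) ?_ ?_ ?_ ?_
    · rw [finrank_euclideanSpace, Fintype.card_fin]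
      exact hN
    · rw [finrank_euclideanSpace, Fintype.card_fin]
      linarith [hδ1.2]
    · refine ae_of_all _ fun x => ?_
      rw [one_mul, Real.norm_eq_abs, abs_of_nonneg (by positivity)]
    · exact (by fun_prop : Measurable _).aestronglyMeasurable
  have i3 : IntegrableOn (fun z : ℝ × EuclideanSpace ℝ (Fin N) =>
      K * (z.1 ^ (2 * δ - 1) * ‖z.2‖ ^ (-(2 * (a + s + δ))))) (Ioo 0 R ×ˢ Metric.ball 0 R) := by
    have := (i1.mul_prod i2).const_mul K
    rwa [Measure.prod_restrict] at this
  refine Integrable.mono' (i3.mono_set hsub) ?_ ?_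
  · have hcont : ContinuousOn (fun z : ℝ × EuclideanSpace ℝ (Fin N) => z.1 ^ (1 - 2 * s) *
        (4 * z.1 ^ 2 * powerProfileT N s a (z.1 ^ 2) (‖z.2‖ ^ 2) ^ 2 +
        4 * ‖z.2‖ ^ 2 * powerProfileX N s a (z.1 ^ 2) (‖z.2‖ ^ 2) ^ 2))
        (upperHalfBall N R) := by
      have hmaps : MapsTo (fun z : ℝ × EuclideanSpace ℝ (Fin N) => (z.1 ^ 2, ‖z.2‖ ^ 2))
          (upperHalfBall N R) eulerDomain := by
        intro z hz
        have h1 : 0 < z.1 := hz.1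
        exact ⟨by positivity, by positivity⟩
      have hc : ContinuousOn (fun z : ℝ × EuclideanSpace ℝ (Fin N) => (z.1 ^ 2, ‖z.2‖ ^ 2))
          (upperHalfBall N R) := by fun_prop
      have c1 := (continuousOn_powerProfileT (s := s) ha haN).comp hc hmaps
      have c2 := (continuousOn_powerProfileX (s := s) ha haN).comp hc hmaps
      refine (continuousOn_fst.rpow_const fun z hz => Or.inl (ne_of_gt hz.1)).mul ?_
      refine ContinuousOn.add (ContinuousOn.mul (by fun_prop) (c1.pow 2))
        (ContinuousOn.mul (by fun_prop) (c2.pow 2))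
    refine (hcont.aestronglyMeasurable hopen.measurableSet).congr ?_
    filter_upwards [ae_restrict_mem hopen.measurableSet] with z hz
    rw [gradSq_poissonExtension_power hs ha haN hz.1]
  · have hne : ∀ᵐ z : ℝ × EuclideanSpace ℝ (Fin N), z.2 ≠ 0 :=
      Measure.quasiMeasurePreserving_snd.ae (Measure.ae_ne volume (0 : EuclideanSpace ℝ (Fin N)))
    filter_upwards [ae_restrict_mem hopen.measurableSet, ae_restrict_of_ae hne] with z hz hz0
    have h1 : 0 < z.1 := hz.1
    rw [Real.norm_eq_abs, abs_of_nonneg]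
    · exact hK z.1 z.2 h1 hz0
    · exact mul_nonneg (Real.rpow_nonneg h1.le _)
        (add_nonneg (sq_nonneg _) (Finset.sum_nonneg fun i _ => sq_nonneg _))

end Gradient

/-! ### Continuity and monotonicity of `γ_α`. -/

section HardyConstant

lemma continuousOn_hardyGamma {N : ℕ} {s : ℝ} (hs : 0 < s) :
    ContinuousOn (hardyGamma N s) (Ico 0 ((N : ℝ) / 2 - s)) := by
  have hΓ : ∀ x : ℝ, 0 < x → ContinuousAt Real.Gamma x := fun x hx =>
    (Real.differentiableAt_Gamma fun m => by
      have : (0 : ℝ) ≤ m := m.cast_nonneg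
      linarith).continuousAt
  intro α ⟨h0, h1⟩
  have c : ∀ c d : ℝ, 0 < (c + d * α) / 4 →
      ContinuousAt (fun α : ℝ => Real.Gamma ((c + d * α) / 4)) α := fun c d h =>
    ContinuousAt.comp (g := Real.Gamma) (hΓ _ h) (by fun_prop)
  have c1 := c (N + 2 * s) 2 (by linarith)
  have c2 := c (N - 2 * s) (-2) (by linarith)
  have c3 := c (N + 2 * s) (-2) (by linarith)
  have c4 := c (N - 2 * s) 2 (by linarith)
  have n2 := (Real.Gamma_pos_of_pos (show 0 < ((N : ℝ) - 2 * s + -2 * α) / 4 by linarith)).ne'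
  have n4 := (Real.Gamma_pos_of_pos (show 0 < ((N : ℝ) - 2 * s + 2 * α) / 4 by linarith)).ne'
  have := (continuousAt_const (y := (2 : ℝ) ^ (2 * s))).mul (c1.div c2 n2) |>.mul (c3.div c4 n4)
  refine ContinuousAt.continuousWithinAt (this.congr (Eventually.of_forall fun β => ?_))
  simp only [Pi.mul_apply, Pi.div_apply, hardyGamma, neg_mul, ← sub_eq_add_neg]

/-- In Euler's approximants the factorials cancel, the power of `n` does not depend on `h`, and the
factors with `+h` and `-h` pair into differences of squares. -/
lemma gammaSeq_ratio {A B h : ℝ} (n : ℕ) (hn : n ≠ 0) (hA : 0 < A - h) (hB : 0 < B - h) (h0 : 0 ≤ h) :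
    Real.GammaSeq (A + h) n * Real.GammaSeq (A - h) n /
      (Real.GammaSeq (B - h) n * Real.GammaSeq (B + h) n) =
    (n : ℝ) ^ (2 * A - 2 * B) *
      ∏ j ∈ Finset.range (n + 1), (((B + j) ^ 2 - h ^ 2) / ((A + j) ^ 2 - h ^ 2)) := by
  have hn0 : (0 : ℝ) < n := by positivity
  have hp : ∀ x : ℝ, 0 < x → 0 < ∏ j ∈ Finset.range (n + 1), (x + (j : ℝ)) := fun x hx =>
    Finset.prod_pos fun j _ => by positivity
  have e : ∀ C : ℝ, ∏ j ∈ Finset.range (n + 1), ((C + (j : ℝ)) ^ 2 - h ^ 2) =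
      (∏ j ∈ Finset.range (n + 1), (C + h + (j : ℝ))) *
        ∏ j ∈ Finset.range (n + 1), (C - h + (j : ℝ)) := by
    intro C
    rw [← Finset.prod_mul_distrib]
    exact Finset.prod_congr rfl fun j _ => by ring
  have e2 : (n : ℝ) ^ (2 * A - 2 * B) =
      (n : ℝ) ^ (A + h) * (n : ℝ) ^ (A - h) / ((n : ℝ) ^ (B - h) * (n : ℝ) ^ (B + h)) := by
    rw [← Real.rpow_add hn0, ← Real.rpow_add hn0, ← Real.rpow_sub hn0]
    congr 1
    ring
  rw [Finset.prod_div_distrib, e, e, e2]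
  have p1 := hp (A + h) (by linarith)
  have p2 := hp (A - h) hA
  have p3 := hp (B + h) (by linarith)
  have p4 := hp (B - h) hB
  simp only [Real.GammaSeq]
  field_simp

/-- Since `B < A`, every factor `((B+j)² - h²) / ((A+j)² - h²)` decreases strictly in `h`. A
termwise comparison would lose strictness in the limit, so the gain of the factor `j = 0` is kept as
a constant `q < 1`, independent of `n`. -/
lemma gamma_ratio_strictAnti {A B h h' : ℝ} (hBA : B < A) (h0 : 0 ≤ h) (hh : h < h') (hB : h' < B) :
    Real.Gamma (A + h') * Real.Gamma (A - h') / (Real.Gamma (B - h') * Real.Gamma (B + h')) <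
      Real.Gamma (A + h) * Real.Gamma (A - h) / (Real.Gamma (B - h) * Real.Gamma (B + h)) := by
  have tend : ∀ h, 0 ≤ h → h < B → Tendsto (fun n => Real.GammaSeq (A + h) n *
      Real.GammaSeq (A - h) n / (Real.GammaSeq (B - h) n * Real.GammaSeq (B + h) n)) atTop
      (𝓝 (Real.Gamma (A + h) * Real.Gamma (A - h) /
        (Real.Gamma (B - h) * Real.Gamma (B + h)))) := fun h h0 hB =>
    ((Real.GammaSeq_tendsto_Gamma _).mul (Real.GammaSeq_tendsto_Gamma _)).div
      ((Real.GammaSeq_tendsto_Gamma _).mul (Real.GammaSeq_tendsto_Gamma _))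
      (mul_pos (Real.Gamma_pos_of_pos (by linarith)) (Real.Gamma_pos_of_pos (by linarith))).ne'
  set q : ℝ := (B ^ 2 - h' ^ 2) / (A ^ 2 - h' ^ 2) / ((B ^ 2 - h ^ 2) / (A ^ 2 - h ^ 2)) with hq
  have hstep : ∀ j : ℝ, 0 ≤ j → 0 < ((B + j) ^ 2 - h' ^ 2) / ((A + j) ^ 2 - h' ^ 2) ∧
      ((B + j) ^ 2 - h' ^ 2) / ((A + j) ^ 2 - h' ^ 2) <
        ((B + j) ^ 2 - h ^ 2) / ((A + j) ^ 2 - h ^ 2) := by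
    intro j hj
    have x1 : 0 < (B + j) ^ 2 - h' ^ 2 := by nlinarith
    have x2 : (B + j) ^ 2 < (A + j) ^ 2 := by nlinarith
    have x3 : h ^ 2 < h' ^ 2 := by nlinarith
    refine ⟨div_pos x1 (by linarith), ?_⟩
    rw [div_lt_div_iff₀ (by linarith) (by linarith)]
    nlinarith
  have hstep0 := hstep 0 le_rfl
  simp only [add_zero] at hstep0
  have hq1 : q < 1 := (div_lt_one (hstep0.1.trans hstep0.2)).2 hstep0.2
  have hle : ∀ᶠ n : ℕ in atTop, Real.GammaSeq (A + h') n * Real.GammaSeq (A - h') n /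
      (Real.GammaSeq (B - h') n * Real.GammaSeq (B + h') n) ≤
      q * (Real.GammaSeq (A + h) n * Real.GammaSeq (A - h) n /
        (Real.GammaSeq (B - h) n * Real.GammaSeq (B + h) n)) := by
    filter_upwards [eventually_ne_atTop 0] with n hn
    rw [gammaSeq_ratio n hn (by linarith) (by linarith) (h0.trans hh.le),
      gammaSeq_ratio n hn (by linarith) (by linarith) h0, mul_left_comm]
    refine mul_le_mul_of_nonneg_left ?_ (by positivity)
    -- Isolates the factor `j = 0`, whose ratio is exactly `q`; the remaining factors are compared
    -- weakly.
    rw [Finset.prod_range_succ', Finset.prod_range_succ', mul_left_comm]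
    simp only [Nat.cast_zero, add_zero]
    rw [hq, div_mul_cancel₀ _ (hstep0.1.trans hstep0.2).ne']
    refine mul_le_mul_of_nonneg_right ?_ hstep0.1.le
    exact Finset.prod_le_prod (fun j _ => (hstep _ (Nat.cast_nonneg _)).1.le)
      fun j _ => (hstep _ (Nat.cast_nonneg _)).2.le
  have hlim := le_of_tendsto_of_tendsto (tend h' (h0.trans hh.le) hB)
    ((tend h h0 (hh.trans hB)).const_mul q) hle
  refine hlim.trans_lt (mul_lt_of_lt_one_left ?_ hq1)
  have g1 := Real.Gamma_pos_of_pos (show 0 < A + h by linarith)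
  have g2 := Real.Gamma_pos_of_pos (show 0 < A - h by linarith)
  have g3 := Real.Gamma_pos_of_pos (show 0 < B + h by linarith)
  have g4 := Real.Gamma_pos_of_pos (show 0 < B - h by linarith)
  positivity

lemma strictAntiOn_hardyGamma {N : ℕ} {s : ℝ} (hs : 0 < s) :
    StrictAntiOn (hardyGamma N s) (Ico 0 ((N : ℝ) / 2 - s)) := by
  have e : ∀ α, hardyGamma N s α = 2 ^ (2 * s) *
      (Real.Gamma (((N : ℝ) + 2 * s) / 4 + α / 2) * Real.Gamma (((N : ℝ) + 2 * s) / 4 - α / 2) /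
      (Real.Gamma (((N : ℝ) - 2 * s) / 4 - α / 2) *
        Real.Gamma (((N : ℝ) - 2 * s) / 4 + α / 2))) := by
    intro α
    rw [hardyGamma, mul_assoc, div_mul_div_comm]
    congr 4
    all_goals ring
  intro α hα β hβ hαβ
  rw [e, e]
  have h0 : 0 ≤ α := hα.1
  have h1 : β < (N : ℝ) / 2 - s := hβ.2
  exact mul_lt_mul_of_pos_left (gamma_ratio_strictAnti (by linarith) (by linarith)
    (by linarith) (by linarith)) (by positivity)

end HardyConstant

/-! ### The symbol of `(1 - P_t) / t^(2s)`. -/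

section Multiplier
variable {s : ℝ}

/-- The source of the power `A^s`, hence of `|ξ|^(2s)`. With `σ = 1/u`, write `1 - e^(-Au) = ∫₀^A u
e^(-ru) dr` and exchange: the `u`-integral is `Γ(1-s) r^(s-1)`, which requires `s < 1`, and the
`r`-integral requires `s > 0`. -/
lemma lintegral_rpow_mul_one_sub_exp (hs : 0 < s) (hs1 : s < 1) {A : ℝ} (hA : 0 ≤ A) :
    ∫⁻ σ in Ioi (0 : ℝ), ENNReal.ofReal (σ ^ (s - 1) * (1 - Real.exp (-(A / σ)))) =
      ENNReal.ofReal (Real.Gamma (1 - s) / s * A ^ s) := by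
  have hΓ := Real.Gamma_pos_of_pos (show 0 < 1 - s by linarith)
  have hexp : ∀ u : ℝ, 0 < u → ENNReal.ofReal (1 - Real.exp (-(A * u))) =
      ∫⁻ r in Ioc 0 A, ENNReal.ofReal (u * Real.exp (-(r * u))) := by
    intro u hu
    have hint : IntervalIntegrable (fun r : ℝ => u * Real.exp (-(r * u))) volume 0 A :=
      (by fun_prop : Continuous _).intervalIntegrable _ _
    have hval : ∫ r in (0 : ℝ)..A, u * Real.exp (-(r * u)) = 1 - Real.exp (-(A * u)) := by
      rw [intervalIntegral.integral_eq_sub_of_hasDerivAt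
        (f := fun r : ℝ => -Real.exp (-(r * u))) (fun r _ => ?_) hint]
      · simp
        ring
      · have := (((hasDerivAt_id r).mul_const u).neg.exp).neg
        refine this.congr_deriv ?_
        simp
        ring
    rw [← hval, intervalIntegral.integral_of_le hA]
    refine ofReal_integral_eq_lintegral_ofReal
      ((intervalIntegrable_iff_integrableOn_Ioc_of_le hA).1 hint) ?_
    exact ae_of_all _ fun r => by positivity
  calc ∫⁻ σ in Ioi (0 : ℝ), ENNReal.ofReal (σ ^ (s - 1) * (1 - Real.exp (-(A / σ))))
      = ∫⁻ u in Ioi (0 : ℝ), ∫⁻ r in Ioc 0 A,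
          ENNReal.ofReal (u ^ (1 - s - 1) * Real.exp (-(r * u))) := by
        rw [lintegral_Ioi_comp_const_div one_pos]
        refine setLIntegral_congr_fun measurableSet_Ioi fun u (hu : 0 < u) => ?_
        have e : A / (1 / u) = A * u := by field_simp
        rw [ENNReal.ofReal_mul (by positivity), e, hexp u hu, ← mul_assoc,
          ← ENNReal.ofReal_mul (by positivity), ← lintegral_const_mul _ (by fun_prop)]
        refine lintegral_congr fun r => ?_
        rw [← ENNReal.ofReal_mul (by positivity)]
        congr 1
        have e2 : u ^ (1 - s - 1) * u = (u ^ (s - 1))⁻¹ := by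
          rw [← Real.rpow_add_one hu.ne', ← Real.rpow_neg hu.le]
          congr 1
          ring
        rw [one_div u, Real.inv_rpow hu.le, ← e2]
        field_simp
    _ = ∫⁻ r in Ioc 0 A, ENNReal.ofReal (Real.Gamma (1 - s) * r ^ (s - 1)) := by
        rw [lintegral_lintegral_swap (by fun_prop)]
        refine setLIntegral_congr_fun measurableSet_Ioc fun r hr => ?_
        rw [lintegral_rpow_mul_exp_neg (by linarith) hr.1, neg_sub]
    _ = _ := by
        have hint : IntervalIntegrable (fun r : ℝ => Real.Gamma (1 - s) * r ^ (s - 1))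
            volume 0 A :=
          (intervalIntegral.intervalIntegrable_rpow' (by linarith)).const_mul _
        rw [← ofReal_integral_eq_lintegral_ofReal
          ((intervalIntegrable_iff_integrableOn_Ioc_of_le hA).1 hint),
          ← intervalIntegral.integral_of_le hA, intervalIntegral.integral_const_mul,
          integral_rpow (Or.inl (by linarith)), sub_add_cancel, Real.zero_rpow hs.ne', sub_zero]
        · congr 1
          ring
        · filter_upwards [ae_restrict_mem measurableSet_Ioc] with r hr
          have := hr.1
          positivity

lemma rpow_mul_one_sub_exp_integral (hs : 0 < s) (hs1 : s < 1) {A : ℝ} (hA : 0 ≤ A) :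
    IntegrableOn (fun σ : ℝ => σ ^ (s - 1) * (1 - Real.exp (-(A / σ)))) (Ioi 0) ∧
      ∫ σ in Ioi (0 : ℝ), σ ^ (s - 1) * (1 - Real.exp (-(A / σ))) =
        Real.Gamma (1 - s) / s * A ^ s := by
  have hΓ := Real.Gamma_pos_of_pos (show 0 < 1 - s by linarith)
  refine integrableOn_and_integral_of_lintegral (by fun_prop) (fun σ hσ => ?_) (by positivity)
    (lintegral_rpow_mul_one_sub_exp hs hs1 hA)
  have : Real.exp (-(A / σ)) ≤ 1 := Real.exp_le_one_iff.2 (neg_nonpos.2 (by positivity))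
  exact mul_nonneg (by positivity) (by linarith)

lemma integrableOn_rpow_mul_exp_neg (hs : 0 < s) {T : ℝ} (hT : 0 < T) :
    IntegrableOn (fun σ : ℝ => σ ^ (s - 1) * Real.exp (-(T * σ))) (Ioi 0) := by
  have h := Real.Gamma_pos_of_pos hs
  exact (integrableOn_and_integral_of_lintegral (by fun_prop) (fun σ hσ => by positivity)
    (by positivity) (lintegral_rpow_mul_exp_neg hs hT)).1

/-- `Γ(s)⁻¹ ∫₀^∞ σ^(s-1) e^(-Tσ) (1 - e^(-A/σ)) dσ`, with `A = π²|ξ|²` the symbol of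
`(1 - P_t) / t^(2s)`, `T = t²`. -/
noncomputable def poissonSymbol (s T A : ℝ) : ℝ :=
  (Real.Gamma s)⁻¹ * ∫ σ in Ioi (0 : ℝ), Real.exp (-(T * σ)) *
    (σ ^ (s - 1) * (1 - Real.exp (-(A / σ))))

lemma poissonSymbol_zero (hs : 0 < s) (hs1 : s < 1) {A : ℝ} (hA : 0 ≤ A) :
    poissonSymbol s 0 A = Real.Gamma (1 - s) / (s * Real.Gamma s) * A ^ s := by
  simp only [poissonSymbol, zero_mul, neg_zero, Real.exp_zero, one_mul]
  rw [(rpow_mul_one_sub_exp_integral hs hs1 hA).2]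
  ring

lemma rpow_mul_one_sub_exp_nonneg {A σ : ℝ} (hA : 0 ≤ A) (hσ : 0 < σ) :
    0 ≤ σ ^ (s - 1) * (1 - Real.exp (-(A / σ))) := by
  have : Real.exp (-(A / σ)) ≤ 1 := Real.exp_le_one_iff.2 (neg_nonpos.2 (by positivity))
  exact mul_nonneg (by positivity) (by linarith)

lemma norm_exp_mul_le {T A σ : ℝ} (hT : 0 ≤ T) (hA : 0 ≤ A) (hσ : 0 < σ) :
    ‖Real.exp (-(T * σ)) * (σ ^ (s - 1) * (1 - Real.exp (-(A / σ))))‖ ≤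
      σ ^ (s - 1) * (1 - Real.exp (-(A / σ))) := by
  have h := rpow_mul_one_sub_exp_nonneg (s := s) hA hσ
  rw [Real.norm_eq_abs, abs_of_nonneg (mul_nonneg (Real.exp_pos _).le h)]
  exact mul_le_of_le_one_left h (Real.exp_le_one_iff.2 (neg_nonpos.2 (by positivity)))

lemma poissonSymbol_nonneg (hs : 0 < s) {T A : ℝ} (hA : 0 ≤ A) : 0 ≤ poissonSymbol s T A := by
  have h := Real.Gamma_pos_of_pos hs
  refine mul_nonneg (by positivity) (setIntegral_nonneg measurableSet_Ioi fun σ hσ => ?_)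
  exact mul_nonneg (Real.exp_pos _).le (rpow_mul_one_sub_exp_nonneg hA hσ)

lemma poissonSymbol_le (hs : 0 < s) (hs1 : s < 1) {T A : ℝ} (hT : 0 ≤ T) (hA : 0 ≤ A) :
    poissonSymbol s T A ≤ poissonSymbol s 0 A := by
  have h := Real.Gamma_pos_of_pos hs
  have hint := (rpow_mul_one_sub_exp_integral hs hs1 hA).1
  refine mul_le_mul_of_nonneg_left ?_ (by positivity)
  simp only [zero_mul, neg_zero, Real.exp_zero, one_mul]
  refine setIntegral_mono_on (hint.mono' (by fun_prop : Measurable _).aestronglyMeasurable ?_) hint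
    measurableSet_Ioi fun σ hσ => (le_abs_self _).trans (norm_exp_mul_le hT hA hσ)
  filter_upwards [ae_restrict_mem measurableSet_Ioi] with σ hσ
  exact norm_exp_mul_le hT hA hσ

/-- The integrand at `T = 0` dominates all the others, since `T` enters only through `e^(-Tσ) ≤ 1`.
-/
lemma tendsto_poissonSymbol (hs : 0 < s) (hs1 : s < 1) {A : ℝ} (hA : 0 ≤ A) :
    Tendsto (fun T => poissonSymbol s T A) (𝓝[>] 0) (𝓝 (poissonSymbol s 0 A)) := by
  refine Tendsto.const_mul _ (tendsto_integral_filter_of_dominated_convergence _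
    (Eventually.of_forall fun T => (by fun_prop : Measurable _).aestronglyMeasurable) ?_
    (rpow_mul_one_sub_exp_integral hs hs1 hA).1 (ae_of_all _ fun σ => ?_))
  · filter_upwards [self_mem_nhdsWithin] with T (hT : 0 < T)
    filter_upwards [ae_restrict_mem measurableSet_Ioi] with σ hσ
    exact norm_exp_mul_le hT.le hA hσ
  · have : Continuous fun T : ℝ => Real.exp (-(T * σ)) *
      (σ ^ (s - 1) * (1 - Real.exp (-(A / σ)))) := by fun_prop
    exact (this.tendsto 0).mono_left nhdsWithin_le_nhds

lemma integrableOn_rpow_mul_exp_mul_exp (hs : 0 < s) {T A : ℝ} (hT : 0 < T) (hA : 0 ≤ A) :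
    IntegrableOn (fun σ : ℝ => σ ^ (s - 1) * Real.exp (-(T * σ)) * Real.exp (-(A / σ)))
      (Ioi 0) := by
  refine (integrableOn_rpow_mul_exp_neg hs hT).mono'
    (by fun_prop : Measurable _).aestronglyMeasurable ?_
  filter_upwards [ae_restrict_mem measurableSet_Ioi] with σ (hσ : 0 < σ)
  rw [Real.norm_eq_abs, abs_of_nonneg (by positivity)]
  exact mul_le_of_le_one_right (by positivity)
    (Real.exp_le_one_iff.2 (neg_nonpos.2 (by positivity)))

lemma poissonSymbol_eq (hs : 0 < s) {T A : ℝ} (hT : 0 < T) (hA : 0 ≤ A) :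
    T ^ s / Real.Gamma s * ∫ σ in Ioi (0 : ℝ), σ ^ (s - 1) * Real.exp (-(T * σ)) *
      Real.exp (-(A / σ)) = 1 - T ^ s * poissonSymbol s T A := by
  have h := Real.Gamma_pos_of_pos hs
  have e : ∫ σ in Ioi (0 : ℝ), Real.exp (-(T * σ)) * (σ ^ (s - 1) * (1 - Real.exp (-(A / σ)))) =
      (∫ σ in Ioi (0 : ℝ), σ ^ (s - 1) * Real.exp (-(T * σ))) -
        ∫ σ in Ioi (0 : ℝ), σ ^ (s - 1) * Real.exp (-(T * σ)) * Real.exp (-(A / σ)) := by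
    rw [← integral_sub (integrableOn_rpow_mul_exp_neg hs hT)
      (integrableOn_rpow_mul_exp_mul_exp hs hT hA)]
    congr 1
    funext σ
    ring
  rw [poissonSymbol, e, Real.integral_rpow_mul_exp_neg_mul_Ioi hs hT, one_div,
    Real.inv_rpow hT.le]
  have : 0 < T ^ s := by positivity
  field_simp
  ring

end Multiplier

/-! ### The Fourier transform of the Poisson kernel. -/

section PoissonFourier
variable {N : ℕ} {s : ℝ}

lemma integrable_halfSpacePoissonKernel (hs : 0 < s) {t : ℝ} (ht : 0 < t) :
    Integrable (halfSpacePoissonKernel (N := N) s t) := by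
  have e : halfSpacePoissonKernel (N := N) s t = fun z =>
      poissonConst N s * (t ^ 2) ^ s * (‖z‖ ^ 2 + t ^ 2) ^ (-((N : ℝ) / 2 + s)) :=
    funext fun z => halfSpacePoissonKernel_eq ht z
  rw [e]
  refine Integrable.const_mul ⟨(by fun_prop : Measurable _).aestronglyMeasurable, ?_⟩ _
  rw [hasFiniteIntegral_iff_ofReal (ae_of_all _ fun z => by positivity),
    lintegral_norm_sq_add_rpow hs (by positivity)]
  exact ENNReal.ofReal_lt_top

/-- Subordination: the kernel is a mixture of normalised Gaussians, with weights integrable in `σ`.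
-/
lemma halfSpacePoissonKernel_eq_integral (hs : 0 < s) {t : ℝ} (ht : 0 < t)
    (z : EuclideanSpace ℝ (Fin N)) :
    halfSpacePoissonKernel s t z = ∫ σ in Ioi (0 : ℝ), (t ^ 2) ^ s / Real.Gamma s *
      (σ ^ (s - 1) * Real.exp (-(t ^ 2 * σ))) *
        ((σ / Real.pi) ^ ((N : ℝ) / 2) * Real.exp (-(σ * ‖z‖ ^ 2))) := by
  have hM : 0 < (N : ℝ) / 2 + s := by positivity
  have h1 := Real.Gamma_pos_of_pos hM
  have h2 := Real.Gamma_pos_of_pos hs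
  have hπ := Real.pi_pos
  have hA : 0 < ‖z‖ ^ 2 + t ^ 2 := by positivity
  have h := Real.integral_rpow_mul_exp_neg_mul_Ioi hM hA
  rw [one_div, Real.inv_rpow hA.le, ← Real.rpow_neg hA.le] at h
  rw [halfSpacePoissonKernel_eq ht, poissonConst_eq hs]
  calc _ = (t ^ 2) ^ s / Real.Gamma s * (Real.pi ^ ((N : ℝ) / 2))⁻¹ *
        ((‖z‖ ^ 2 + t ^ 2) ^ (-((N : ℝ) / 2 + s)) * Real.Gamma ((N : ℝ) / 2 + s)) := by
        field_simp
    _ = _ := by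
        rw [← h, ← integral_const_mul]
        refine setIntegral_congr_fun measurableSet_Ioi fun σ (hσ : 0 < σ) => ?_
        rw [Real.div_rpow hσ.le hπ.le,
          show (N : ℝ) / 2 + s - 1 = (s - 1) + N / 2 by ring, Real.rpow_add hσ,
          show -((‖z‖ ^ 2 + t ^ 2) * σ) = -(t ^ 2 * σ) + -(σ * ‖z‖ ^ 2) by ring, Real.exp_add]
        ring

/-- Transform the Gaussian mixture termwise. Fubini is allowed because each Gaussian has mass one
after normalisation, so the norms integrate to the mixing weight `k`. -/
lemma fourier_halfSpacePoissonKernel (hs : 0 < s) {t : ℝ} (ht : 0 < t)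
    (ξ : EuclideanSpace ℝ (Fin N)) :
    𝓕 (fun z : EuclideanSpace ℝ (Fin N) => (halfSpacePoissonKernel s t z : ℂ)) ξ =
      ((1 - (t ^ 2) ^ s * poissonSymbol s (t ^ 2) (Real.pi ^ 2 * ‖ξ‖ ^ 2) : ℝ) : ℂ) := by
  have hT : 0 < t ^ 2 := by positivity
  have hπ := Real.pi_pos
  have hΓ := Real.Gamma_pos_of_pos hs
  set k : ℝ → ℝ := fun σ => (t ^ 2) ^ s / Real.Gamma s *
      (σ ^ (s - 1) * Real.exp (-(t ^ 2 * σ))) with hk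
  have hkint : IntegrableOn k (Ioi 0) := (integrableOn_rpow_mul_exp_neg hs hT).const_mul _
  have hgauss : ∀ σ : ℝ, 0 < σ → Integrable (fun z : EuclideanSpace ℝ (Fin N) =>
      Real.exp (-(σ * ‖z‖ ^ 2))) ∧ ∫ z : EuclideanSpace ℝ (Fin N), Real.exp (-(σ * ‖z‖ ^ 2)) =
        ((σ / Real.pi) ^ ((N : ℝ) / 2))⁻¹ := by
    intro σ hσ
    have h := GaussianFourier.integral_rexp_neg_mul_sq_norm (V := EuclideanSpace ℝ (Fin N)) hσ
    simp only [finrank_euclideanSpace, Fintype.card_fin, neg_mul] at h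
    refine ⟨Integrable.of_integral_ne_zero (by rw [h]; positivity), ?_⟩
    rw [h, ← Real.inv_rpow (by positivity), inv_div]
  have hprod : Integrable (fun p : EuclideanSpace ℝ (Fin N) × ℝ =>
      Complex.exp (((-2 * Real.pi * inner ℝ p.1 ξ : ℝ) : ℂ) * Complex.I) *
        ((k p.2 * ((p.2 / Real.pi) ^ ((N : ℝ) / 2) * Real.exp (-(p.2 * ‖p.1‖ ^ 2))) : ℝ) : ℂ))
      (volume.prod (volume.restrict (Ioi 0))) := by
    have hm : Measurable (fun p : EuclideanSpace ℝ (Fin N) × ℝ =>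
      Complex.exp (((-2 * Real.pi * inner ℝ p.1 ξ : ℝ) : ℂ) * Complex.I) *
        ((k p.2 * ((p.2 / Real.pi) ^ ((N : ℝ) / 2) * Real.exp (-(p.2 * ‖p.1‖ ^ 2))) : ℝ) : ℂ)) := by
      rw [hk]
      fun_prop
    refine (integrable_prod_iff' hm.aestronglyMeasurable).2 ⟨?_, ?_⟩
    · filter_upwards [ae_restrict_mem measurableSet_Ioi] with σ (hσ : 0 < σ)
      have := ((hgauss σ hσ).1.const_mul (k σ * (σ / Real.pi) ^ ((N : ℝ) / 2)))
      refine this.mono' (by fun_prop : Measurable _).aestronglyMeasurable (ae_of_all _ fun z => ?_)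
      have hkσ : 0 ≤ k σ := by rw [hk]; positivity
      rw [norm_mul, Complex.norm_exp_ofReal_mul_I, one_mul, Complex.norm_real, Real.norm_eq_abs,
        abs_of_nonneg (by positivity), ← mul_assoc (k σ)]
    · refine hkint.congr_fun (fun σ (hσ : 0 < σ) => ?_) measurableSet_Ioi
      have hkσ : 0 ≤ k σ := by rw [hk]; positivity
      have e : ∀ z : EuclideanSpace ℝ (Fin N),
          ‖Complex.exp (((-2 * Real.pi * inner ℝ z ξ : ℝ) : ℂ) * Complex.I) *
          ((k σ * ((σ / Real.pi) ^ ((N : ℝ) / 2) * Real.exp (-(σ * ‖z‖ ^ 2))) : ℝ) : ℂ)‖ =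
          k σ * (σ / Real.pi) ^ ((N : ℝ) / 2) * Real.exp (-(σ * ‖z‖ ^ 2)) := by
        intro z
        rw [norm_mul, Complex.norm_exp_ofReal_mul_I, one_mul, Complex.norm_real, Real.norm_eq_abs,
          abs_of_nonneg (by positivity), ← mul_assoc (k σ)]
      simp only [e]
      rw [integral_const_mul, (hgauss σ hσ).2, mul_assoc, mul_inv_cancel₀ (by positivity), mul_one]
  rw [Real.fourier_eq']
  calc ∫ v : EuclideanSpace ℝ (Fin N), Complex.exp (((-2 * Real.pi * inner ℝ v ξ : ℝ) : ℂ) *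
        Complex.I) • (halfSpacePoissonKernel s t v : ℂ)
      = ∫ v : EuclideanSpace ℝ (Fin N), ∫ σ in Ioi (0 : ℝ),
        Complex.exp (((-2 * Real.pi * inner ℝ v ξ : ℝ) : ℂ) * Complex.I) *
        ((k σ * ((σ / Real.pi) ^ ((N : ℝ) / 2) * Real.exp (-(σ * ‖v‖ ^ 2))) : ℝ) : ℂ) := by
        congr 1
        funext v
        rw [integral_const_mul, integral_complex_ofReal, halfSpacePoissonKernel_eq_integral hs ht,
          smul_eq_mul]
    _ = ∫ σ in Ioi (0 : ℝ), ∫ v : EuclideanSpace ℝ (Fin N),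
        Complex.exp (((-2 * Real.pi * inner ℝ v ξ : ℝ) : ℂ) * Complex.I) *
        ((k σ * ((σ / Real.pi) ^ ((N : ℝ) / 2) * Real.exp (-(σ * ‖v‖ ^ 2))) : ℝ) : ℂ) :=
        integral_integral_swap hprod
    _ = ∫ σ in Ioi (0 : ℝ), (((t ^ 2) ^ s / Real.Gamma s * (σ ^ (s - 1) *
        Real.exp (-(t ^ 2 * σ)) * Real.exp (-(Real.pi ^ 2 * ‖ξ‖ ^ 2 / σ))) : ℝ) : ℂ) := by
        refine setIntegral_congr_fun measurableSet_Ioi fun σ (hσ : 0 < σ) => ?_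
        beta_reduce
        have hg := fourier_gaussian_innerProductSpace (V := EuclideanSpace ℝ (Fin N))
          (b := (σ : ℂ)) (by simpa using hσ) ξ
        rw [Real.fourier_eq'] at hg
        have e : ∀ v : EuclideanSpace ℝ (Fin N),
            Complex.exp (((-2 * Real.pi * inner ℝ v ξ : ℝ) : ℂ) * Complex.I) *
            ((k σ * ((σ / Real.pi) ^ ((N : ℝ) / 2) * Real.exp (-(σ * ‖v‖ ^ 2))) : ℝ) : ℂ) =
            ((k σ * (σ / Real.pi) ^ ((N : ℝ) / 2) : ℝ) : ℂ) *
            (Complex.exp (((-2 * Real.pi * inner ℝ v ξ : ℝ) : ℂ) * Complex.I) •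
              Complex.exp (-(σ : ℂ) * (‖v‖ : ℂ) ^ 2)) := by
          intro v
          rw [smul_eq_mul]
          push_cast
          rw [show -(σ : ℂ) * (‖v‖ : ℂ) ^ 2 = -((σ : ℂ) * (‖v‖ : ℂ) ^ 2) by ring]
          ring
        simp_rw [e]
        rw [integral_const_mul, hg, finrank_euclideanSpace, Fintype.card_fin]
        have e1 : ((Real.pi : ℂ) / (σ : ℂ)) ^ ((N : ℂ) / 2) =
            ((((σ / Real.pi) ^ ((N : ℝ) / 2))⁻¹ : ℝ) : ℂ) := by
          rw [← Real.inv_rpow (by positivity), inv_div, Complex.ofReal_cpow (by positivity)]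
          push_cast
          rfl
        have e2 : Complex.exp (-(Real.pi : ℂ) ^ 2 * (‖ξ‖ : ℂ) ^ 2 / (σ : ℂ)) =
            ((Real.exp (-(Real.pi ^ 2 * ‖ξ‖ ^ 2 / σ)) : ℝ) : ℂ) := by
          push_cast
          congr 1
          ring
        rw [e1, e2, ← Complex.ofReal_mul, ← Complex.ofReal_mul, hk]
        congr 1
        have : (σ / Real.pi) ^ ((N : ℝ) / 2) ≠ 0 := by positivity
        field_simp
    _ = _ := by
        rw [integral_complex_ofReal, integral_const_mul, poissonSymbol_eq hs hT (by positivity)]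

end PoissonFourier

/-! ### Difference quotients of the Poisson semigroup on test functions. -/

section PoissonConvolution
variable {N : ℕ} {s : ℝ} {φ : EuclideanSpace ℝ (Fin N) → ℂ}

/-- The convolution `P_t * φ`. -/
noncomputable def poissonConv (s t : ℝ) (φ : EuclideanSpace ℝ (Fin N) → ℂ)
    (x : EuclideanSpace ℝ (Fin N)) : ℂ :=
  ∫ z, (halfSpacePoissonKernel s t (x - z) : ℂ) * φ z

lemma integrable_norm_pow_mul_fourier (hφ : ContDiff ℝ ∞ φ) (hc : HasCompactSupport φ) (k : ℕ) :
    Integrable (fun ξ => ‖ξ‖ ^ k * ‖𝓕 φ ξ‖) :=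
  (𝓕 (hc.toSchwartzMap hφ)).integrable_pow_mul volume k

lemma continuous_fourier_testFunction (hφ : ContDiff ℝ ∞ φ) (hc : HasCompactSupport φ) :
    Continuous (𝓕 φ) :=
  (𝓕 (hc.toSchwartzMap hφ)).continuous

lemma integrable_fourier_testFunction (hφ : ContDiff ℝ ∞ φ) (hc : HasCompactSupport φ) :
    Integrable (𝓕 φ) :=
  (𝓕 (hc.toSchwartzMap hφ)).integrable

lemma testFunction_eq_integral (hφ : ContDiff ℝ ∞ φ) (hc : HasCompactSupport φ)
    (x : EuclideanSpace ℝ (Fin N)) :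
    φ x = ∫ ξ, Complex.exp (((2 * Real.pi * inner ℝ ξ x : ℝ) : ℂ) * Complex.I) * 𝓕 φ ξ := by
  have h := hφ.continuous.fourierInv_fourier_eq (hφ.continuous.integrable_of_hasCompactSupport hc)
    (integrable_fourier_testFunction hφ hc)
  conv_lhs => rw [← h]
  rw [Real.fourierInv_eq']
  rfl

lemma measurable_poissonSymbol (T : ℝ) : Measurable (fun A => poissonSymbol s T A) := by
  refine measurable_const.mul ?_
  exact (StronglyMeasurable.integral_prod_right (ν := volume.restrict (Ioi (0 : ℝ)))
    (f := fun A σ : ℝ => Real.exp (-(T * σ)) * (σ ^ (s - 1) * (1 - Real.exp (-(A / σ)))))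
    (by fun_prop : Measurable _).stronglyMeasurable).measurable

lemma norm_exp_mul_fourier (ξ x : EuclideanSpace ℝ (Fin N)) :
    ‖Complex.exp (((2 * Real.pi * inner ℝ ξ x : ℝ) : ℂ) * Complex.I) * 𝓕 φ ξ‖ = ‖𝓕 φ ξ‖ := by
  rw [norm_mul, Complex.norm_exp_ofReal_mul_I, one_mul]

lemma integrable_exp_mul_fourier (hφ : ContDiff ℝ ∞ φ) (hc : HasCompactSupport φ)
    (x : EuclideanSpace ℝ (Fin N)) :
    Integrable (fun ξ =>
      Complex.exp (((2 * Real.pi * inner ℝ ξ x : ℝ) : ℂ) * Complex.I) * 𝓕 φ ξ) := by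
  have hm := continuous_fourier_testFunction hφ hc
  refine (integrable_fourier_testFunction hφ hc).norm.mono'
    (by fun_prop : Continuous _).aestronglyMeasurable (ae_of_all _ fun ξ => ?_)
  rw [norm_exp_mul_fourier]

lemma integrable_poissonSymbol_mul (hs : 0 < s) (hs1 : s < 1) (hφ : ContDiff ℝ ∞ φ)
    (hc : HasCompactSupport φ) :
    Integrable (fun ξ : EuclideanSpace ℝ (Fin N) =>
      poissonSymbol s 0 (Real.pi ^ 2 * ‖ξ‖ ^ 2) * ‖𝓕 φ ξ‖) := by
  have hΓ := Real.Gamma_pos_of_pos hs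
  have hΓ' := Real.Gamma_pos_of_pos (show 0 < 1 - s by linarith)
  set c := Real.Gamma (1 - s) / (s * Real.Gamma s) with hcdef
  have hc0 : 0 ≤ c := by positivity
  have h1 := ((integrable_norm_pow_mul_fourier hφ hc 0).const_mul c).add
    ((integrable_norm_pow_mul_fourier hφ hc 2).const_mul (c * Real.pi ^ 2))
  refine h1.mono' ?_ (ae_of_all _ fun ξ => ?_)
  · have hm := (continuous_fourier_testFunction hφ hc).measurable
    exact ((measurable_poissonSymbol 0).comp (by fun_prop)).mul hm.norm |>.aestronglyMeasurable
  · have hA : 0 ≤ Real.pi ^ 2 * ‖ξ‖ ^ 2 := by positivity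
    rw [Real.norm_eq_abs, abs_of_nonneg (mul_nonneg (poissonSymbol_nonneg hs hA) (norm_nonneg _)),
      poissonSymbol_zero hs hs1 hA, ← hcdef]
    -- As `s < 1`, the limiting symbol grows at most quadratically, so the moments of order `0` and
    -- `2` of the Schwartz function `𝓕 φ` suffice.
    have h2 : (Real.pi ^ 2 * ‖ξ‖ ^ 2) ^ s ≤ 1 + Real.pi ^ 2 * ‖ξ‖ ^ 2 := by
      rcases le_total (Real.pi ^ 2 * ‖ξ‖ ^ 2) 1 with h | h
      · exact (Real.rpow_le_one hA h hs.le).trans (by linarith)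
      · have := Real.rpow_le_rpow_of_exponent_le h hs1.le
        rw [Real.rpow_one] at this
        linarith
    calc c * (Real.pi ^ 2 * ‖ξ‖ ^ 2) ^ s * ‖𝓕 φ ξ‖
        ≤ c * (1 + Real.pi ^ 2 * ‖ξ‖ ^ 2) * ‖𝓕 φ ξ‖ := by gcongr
      _ = _ := by
        simp only [Pi.add_apply]
        ring

lemma integrable_poissonSymbol_mul_exp (hs : 0 < s) (hs1 : s < 1) (hφ : ContDiff ℝ ∞ φ)
    (hc : HasCompactSupport φ) {T : ℝ} (hT : 0 ≤ T) (x : EuclideanSpace ℝ (Fin N)) :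
    Integrable (fun ξ : EuclideanSpace ℝ (Fin N) =>
      (poissonSymbol s T (Real.pi ^ 2 * ‖ξ‖ ^ 2) : ℂ) *
        (Complex.exp (((2 * Real.pi * inner ℝ ξ x : ℝ) : ℂ) * Complex.I) * 𝓕 φ ξ)) ∧
    ∀ ξ : EuclideanSpace ℝ (Fin N), ‖(poissonSymbol s T (Real.pi ^ 2 * ‖ξ‖ ^ 2) : ℂ) *
        (Complex.exp (((2 * Real.pi * inner ℝ ξ x : ℝ) : ℂ) * Complex.I) * 𝓕 φ ξ)‖ ≤
      poissonSymbol s 0 (Real.pi ^ 2 * ‖ξ‖ ^ 2) * ‖𝓕 φ ξ‖ := by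
  have hle : ∀ ξ : EuclideanSpace ℝ (Fin N), ‖(poissonSymbol s T (Real.pi ^ 2 * ‖ξ‖ ^ 2) : ℂ) *
        (Complex.exp (((2 * Real.pi * inner ℝ ξ x : ℝ) : ℂ) * Complex.I) * 𝓕 φ ξ)‖ ≤
      poissonSymbol s 0 (Real.pi ^ 2 * ‖ξ‖ ^ 2) * ‖𝓕 φ ξ‖ := by
    intro ξ
    have hA : 0 ≤ Real.pi ^ 2 * ‖ξ‖ ^ 2 := by positivity
    rw [norm_mul, norm_exp_mul_fourier, Complex.norm_real, Real.norm_eq_abs,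
      abs_of_nonneg (poissonSymbol_nonneg hs hA)]
    exact mul_le_mul_of_nonneg_right (poissonSymbol_le hs hs1 hT hA) (norm_nonneg _)
  refine ⟨(integrable_poissonSymbol_mul hs hs1 hφ hc).mono' ?_ (ae_of_all _ hle), hle⟩
  have hm := (continuous_fourier_testFunction hφ hc).measurable
  have h2 : Measurable fun ξ : EuclideanSpace ℝ (Fin N) =>
      poissonSymbol s T (Real.pi ^ 2 * ‖ξ‖ ^ 2) :=
    (measurable_poissonSymbol T).comp (by fun_prop)
  exact (h2.complex_ofReal.mul (by fun_prop)).aestronglyMeasurable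

/-- For `h(ξ) = e^(2πi ξ·x) 𝓕 φ(ξ)` one has `𝓕 h(y) = φ(x - y)`. The multiplication formula `∫ 𝓕 h ·
P = ∫ h · 𝓕 P` then inserts the transform of the kernel. -/
lemma sub_poissonConv_eq (hs : 0 < s) (hs1 : s < 1) (hφ : ContDiff ℝ ∞ φ)
    (hc : HasCompactSupport φ) {t : ℝ} (ht : 0 < t) (x : EuclideanSpace ℝ (Fin N)) :
    φ x - poissonConv s t φ x = (((t ^ 2) ^ s : ℝ) : ℂ) * ∫ ξ,
      (poissonSymbol s (t ^ 2) (Real.pi ^ 2 * ‖ξ‖ ^ 2) : ℂ) *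
        (Complex.exp (((2 * Real.pi * inner ℝ ξ x : ℝ) : ℂ) * Complex.I) * 𝓕 φ ξ) := by
  set h : EuclideanSpace ℝ (Fin N) → ℂ := fun ξ =>
    Complex.exp (((2 * Real.pi * inner ℝ ξ x : ℝ) : ℂ) * Complex.I) * 𝓕 φ ξ with hh
  have hint : Integrable h := integrable_exp_mul_fourier hφ hc x
  have hP : Integrable (fun z : EuclideanSpace ℝ (Fin N) => (halfSpacePoissonKernel s t z : ℂ)) :=
    (integrable_halfSpacePoissonKernel hs ht).ofReal
  have hF : ∀ y, 𝓕 h y = φ (x - y) := by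
    intro y
    rw [Real.fourier_eq', testFunction_eq_integral hφ hc (x - y)]
    congr 1
    funext ξ
    rw [hh, smul_eq_mul, ← mul_assoc, ← Complex.exp_add, inner_sub_right]
    congr 2
    push_cast
    ring
  have hflip : ∫ y, 𝓕 h y • (halfSpacePoissonKernel s t y : ℂ) = ∫ ξ, h ξ •
      𝓕 (fun z : EuclideanSpace ℝ (Fin N) => (halfSpacePoissonKernel s t z : ℂ)) ξ := by
    simpa using! (VectorFourier.integral_fourierIntegral_smul_eq_flip
      (L := innerₗ (EuclideanSpace ℝ (Fin N))) Real.continuous_fourierChar continuous_inner hint hP)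
  have hconv : poissonConv s t φ x = ∫ y, 𝓕 h y • (halfSpacePoissonKernel s t y : ℂ) := by
    rw [poissonConv, ← integral_sub_left_eq_self _ volume x]
    congr 1
    funext y
    rw [hF, sub_sub_cancel, smul_eq_mul, mul_comm]
  have hT : 0 ≤ t ^ 2 := by positivity
  have i1 := (integrable_poissonSymbol_mul_exp hs hs1 hφ hc hT x).1
  rw [hconv, hflip, testFunction_eq_integral hφ hc x]
  simp_rw [fourier_halfSpacePoissonKernel hs ht]
  have e : ∀ ξ, h ξ • ((1 - (t ^ 2) ^ s * poissonSymbol s (t ^ 2) (Real.pi ^ 2 * ‖ξ‖ ^ 2) : ℝ) : ℂ)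
      = h ξ - (((t ^ 2) ^ s : ℝ) : ℂ) *
        ((poissonSymbol s (t ^ 2) (Real.pi ^ 2 * ‖ξ‖ ^ 2) : ℂ) * h ξ) := by
    intro ξ
    rw [smul_eq_mul]
    push_cast
    ring
  simp_rw [e]
  rw [integral_sub hint (i1.const_mul _), integral_const_mul]
  ring

/-- Dominated convergence on the Fourier side; the powers of `2` come from `ζ = 2πξ`, the symbol
being a power of `π²|ξ|²`. -/
lemma tendsto_sub_poissonConv_div (hs : 0 < s) (hs1 : s < 1) (hφ : ContDiff ℝ ∞ φ)
    (hc : HasCompactSupport φ) (x : EuclideanSpace ℝ (Fin N)) :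
    Tendsto (fun t : ℝ => (((t ^ 2) ^ s : ℝ) : ℂ)⁻¹ * (φ x - poissonConv s t φ x)) (𝓝[>] 0)
      (𝓝 (((Real.Gamma (1 - s) / (s * Real.Gamma s * 2 ^ (2 * s)) : ℝ) : ℂ) *
        fracLaplacian s φ x)) := by
  have hsq : Tendsto (fun t : ℝ => t ^ 2) (𝓝[>] 0) (𝓝[>] 0) := by
    refine tendsto_nhdsWithin_iff.2 ⟨?_, ?_⟩
    · have : Tendsto (fun t : ℝ => t ^ 2) (𝓝 0) (𝓝 (0 ^ 2)) := (continuous_pow 2).tendsto 0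
      rw [zero_pow two_ne_zero] at this
      exact this.mono_left nhdsWithin_le_nhds
    · filter_upwards [self_mem_nhdsWithin] with t (ht : 0 < t)
      exact pow_pos ht 2
  have hlim : Tendsto (fun t : ℝ => ∫ ξ : EuclideanSpace ℝ (Fin N),
      (poissonSymbol s (t ^ 2) (Real.pi ^ 2 * ‖ξ‖ ^ 2) : ℂ) *
        (Complex.exp (((2 * Real.pi * inner ℝ ξ x : ℝ) : ℂ) * Complex.I) * 𝓕 φ ξ)) (𝓝[>] 0)
      (𝓝 (∫ ξ : EuclideanSpace ℝ (Fin N), (poissonSymbol s 0 (Real.pi ^ 2 * ‖ξ‖ ^ 2) : ℂ) *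
        (Complex.exp (((2 * Real.pi * inner ℝ ξ x : ℝ) : ℂ) * Complex.I) * 𝓕 φ ξ))) := by
    refine tendsto_integral_filter_of_dominated_convergence _
      (Eventually.of_forall fun t =>
        (integrable_poissonSymbol_mul_exp hs hs1 hφ hc (sq_nonneg t) x).1.aestronglyMeasurable)
      (Eventually.of_forall fun t => ae_of_all _
        (integrable_poissonSymbol_mul_exp hs hs1 hφ hc (sq_nonneg t) x).2)
      (integrable_poissonSymbol_mul hs hs1 hφ hc) (ae_of_all _ fun ξ => ?_)
    refine Tendsto.mul_const _ ?_
    exact (Complex.continuous_ofReal.tendsto _).comp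
      ((tendsto_poissonSymbol hs hs1 (by positivity)).comp hsq)
  have e : ((Real.Gamma (1 - s) / (s * Real.Gamma s * 2 ^ (2 * s)) : ℝ) : ℂ) *
        fracLaplacian s φ x = ∫ ξ : EuclideanSpace ℝ (Fin N),
        (poissonSymbol s 0 (Real.pi ^ 2 * ‖ξ‖ ^ 2) : ℂ) *
        (Complex.exp (((2 * Real.pi * inner ℝ ξ x : ℝ) : ℂ) * Complex.I) * 𝓕 φ ξ) := by
    rw [fracLaplacian, Real.fourierInv_eq', ← integral_const_mul]
    congr 1
    funext ξ
    have hΓ := Real.Gamma_pos_of_pos hs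
    have hπ := Real.pi_pos
    have e1 : (2 * Real.pi * ‖ξ‖) ^ (2 * s) = 2 ^ (2 * s) * (Real.pi ^ 2 * ‖ξ‖ ^ 2) ^ s := by
      rw [mul_assoc, Real.mul_rpow (by positivity) (by positivity), ← mul_pow,
        ← Real.rpow_natCast (Real.pi * ‖ξ‖), ← Real.rpow_mul (by positivity)]
      push_cast
      rfl
    have e2 : poissonSymbol s 0 (Real.pi ^ 2 * ‖ξ‖ ^ 2) =
        Real.Gamma (1 - s) / (s * Real.Gamma s * 2 ^ (2 * s)) *
          (2 * Real.pi * ‖ξ‖) ^ (2 * s) := by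
      rw [poissonSymbol_zero hs hs1 (by positivity), e1]
      field_simp
    rw [e2, smul_eq_mul, Complex.ofReal_mul (Real.Gamma (1 - s) / (s * Real.Gamma s * 2 ^ (2 * s)))
      ((2 * Real.pi * ‖ξ‖) ^ (2 * s))]
    ring
  rw [e]
  refine hlim.congr' ?_
  filter_upwards [self_mem_nhdsWithin] with t (ht : 0 < t)
  have h0 : (((t ^ 2) ^ s : ℝ) : ℂ) ≠ 0 := by
    exact_mod_cast (show 0 < (t ^ 2) ^ s by positivity).ne'
  rw [sub_poissonConv_eq hs hs1 hφ hc ht, inv_mul_cancel_left₀ h0]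

/-- Far from the support `|x - z| ≥ |x|/2`; dropping `t²` from the denominator keeps the full factor
`t^(2s)` and gives decay of order `N + 2s`. -/
lemma norm_poissonConv_le (hs : 0 < s) {t R : ℝ} (ht : 0 < t) (hR : 0 < R)
    (hφ : Integrable φ) (hsupp : ∀ z, φ z ≠ 0 → ‖z‖ ≤ R)
    {x : EuclideanSpace ℝ (Fin N)} (hx : 2 * R ≤ ‖x‖) :
    ‖poissonConv s t φ x‖ ≤ (t ^ 2) ^ s *
      (poissonConst N s * 2 ^ ((N : ℝ) + 2 * s) * (∫ z, ‖φ z‖) * ‖x‖ ^ (-((N : ℝ) + 2 * s))) := by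
  have hx0 : 0 < ‖x‖ := by linarith
  have hp := poissonConst_pos (N := N) hs
  have e : (t ^ 2) ^ s * (poissonConst N s * 2 ^ ((N : ℝ) + 2 * s) * (∫ z, ‖φ z‖) *
      ‖x‖ ^ (-((N : ℝ) + 2 * s))) = ∫ z, (t ^ 2) ^ s * (poissonConst N s *
        2 ^ ((N : ℝ) + 2 * s) * ‖x‖ ^ (-((N : ℝ) + 2 * s))) * ‖φ z‖ := by
    rw [integral_const_mul]
    ring
  rw [e, poissonConv]
  refine norm_integral_le_of_norm_le (hφ.norm.const_mul _) (ae_of_all _ fun z => ?_)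
  rw [norm_mul, Complex.norm_real, Real.norm_eq_abs,
    abs_of_pos (halfSpacePoissonKernel_pos hs ht _)]
  by_cases hz : φ z = 0
  · simp [hz]
  · refine mul_le_mul_of_nonneg_right ?_ (norm_nonneg _)
    have h1 : ‖x‖ / 2 ≤ ‖x - z‖ := by
      have := norm_sub_norm_le x z
      linarith [hsupp z hz]
    have h2 : (‖x - z‖ ^ 2 + t ^ 2) ^ (-((N : ℝ) / 2 + s)) ≤
        ((‖x‖ / 2) ^ 2) ^ (-((N : ℝ) / 2 + s)) := by
      refine Real.rpow_le_rpow_of_nonpos (by positivity) ?_ (neg_nonpos.2 (by positivity))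
      have := pow_le_pow_left₀ (by positivity) h1 2
      linarith [sq_nonneg t]
    have h3 : ((‖x‖ / 2) ^ 2) ^ (-((N : ℝ) / 2 + s)) =
        2 ^ ((N : ℝ) + 2 * s) * ‖x‖ ^ (-((N : ℝ) + 2 * s)) := by
      rw [← Real.rpow_natCast, ← Real.rpow_mul (by positivity),
        Real.div_rpow hx0.le (by norm_num), show ((2 : ℕ) : ℝ) * -((N : ℝ) / 2 + s) =
          -((N : ℝ) + 2 * s) by push_cast; ring, Real.rpow_neg (by norm_num : (0 : ℝ) ≤ 2)]
      field_simp
    rw [halfSpacePoissonKernel_eq ht]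
    calc _ ≤ poissonConst N s * (t ^ 2) ^ s *
          (2 ^ ((N : ℝ) + 2 * s) * ‖x‖ ^ (-((N : ℝ) + 2 * s))) := by
          rw [← h3]
          gcongr
      _ = _ := by ring

/-- A majorant uniform in `t` that is integrable against every function of `𝓛¹_s`. Near the support
the Fourier formula gives a constant bound; far away `φ` vanishes and the decay of the kernel takes
over. -/
lemma exists_norm_sub_poissonConv_le (hs : 0 < s) (hs1 : s < 1) (hφ : ContDiff ℝ ∞ φ)
    (hc : HasCompactSupport φ) :
    ∃ C, 0 ≤ C ∧ ∀ t x, 0 < t →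
      ‖(((t ^ 2) ^ s : ℝ) : ℂ)⁻¹ * (φ x - poissonConv s t φ x)‖ ≤
        C / (1 + ‖x‖ ^ ((N : ℝ) + 2 * s)) := by
  have hint : Integrable φ := hφ.continuous.integrable_of_hasCompactSupport hc
  obtain ⟨R, hR1, hR⟩ : ∃ R : ℝ, 1 ≤ R ∧ ∀ z, φ z ≠ 0 → ‖z‖ ≤ R := by
    obtain ⟨R, hR, hle⟩ := hc.isCompact.isBounded.exists_pos_norm_le
    exact ⟨max 1 R, le_max_left _ _, fun z hz =>
      (hle z (subset_tsupport _ hz)).trans (le_max_right _ _)⟩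
  have hp := poissonConst_pos (N := N) hs
  set C1 := ∫ ξ : EuclideanSpace ℝ (Fin N), poissonSymbol s 0 (Real.pi ^ 2 * ‖ξ‖ ^ 2) * ‖𝓕 φ ξ‖
    with hC1
  set C2 := poissonConst N s * 2 ^ ((N : ℝ) + 2 * s) * (∫ z, ‖φ z‖) with hC2
  have hC1' : 0 ≤ C1 := integral_nonneg fun ξ =>
    mul_nonneg (poissonSymbol_nonneg hs (by positivity)) (norm_nonneg _)
  have hC2' : 0 ≤ C2 := by
    have : 0 ≤ ∫ z, ‖φ z‖ := integral_nonneg fun z => norm_nonneg _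
    positivity
  have hr : 0 < (N : ℝ) + 2 * s := by positivity
  refine ⟨C1 * (1 + (2 * R) ^ ((N : ℝ) + 2 * s)) + C2 * 2, by positivity, fun t x ht => ?_⟩
  have hts : 0 < (t ^ 2) ^ s := by positivity
  rw [norm_mul, norm_inv, Complex.norm_real, Real.norm_eq_abs, abs_of_pos hts,
    inv_mul_le_iff₀ hts]
  rcases le_total ‖x‖ (2 * R) with h | h
  · rw [sub_poissonConv_eq hs hs1 hφ hc ht, norm_mul, Complex.norm_real, Real.norm_eq_abs,
      abs_of_pos hts]
    refine mul_le_mul_of_nonneg_left ?_ hts.le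
    rw [le_div_iff₀ (by positivity)]
    have h1 : ‖∫ ξ : EuclideanSpace ℝ (Fin N),
        (poissonSymbol s (t ^ 2) (Real.pi ^ 2 * ‖ξ‖ ^ 2) : ℂ) *
        (Complex.exp (((2 * Real.pi * inner ℝ ξ x : ℝ) : ℂ) * Complex.I) * 𝓕 φ ξ)‖ ≤ C1 :=
      norm_integral_le_of_norm_le (integrable_poissonSymbol_mul hs hs1 hφ hc)
        (ae_of_all _ (integrable_poissonSymbol_mul_exp hs hs1 hφ hc (sq_nonneg t) x).2)
    have h2 : ‖x‖ ^ ((N : ℝ) + 2 * s) ≤ (2 * R) ^ ((N : ℝ) + 2 * s) :=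
      Real.rpow_le_rpow (norm_nonneg _) h hr.le
    have h3 := mul_le_mul h1 (add_le_add_right h2 1) (by positivity) hC1'
    linarith
  · have hx1 : 1 ≤ ‖x‖ := by linarith
    have h0 : φ x = 0 := by
      by_contra h0
      linarith [hR x h0]
    rw [h0, zero_sub, norm_neg]
    refine (norm_poissonConv_le hs ht (by linarith) hint hR h).trans
      (mul_le_mul_of_nonneg_left ?_ hts.le)
    have h1 : 1 ≤ ‖x‖ ^ ((N : ℝ) + 2 * s) := Real.one_le_rpow hx1 hr.le
    have h2 : 0 ≤ C1 * (1 + (2 * R) ^ ((N : ℝ) + 2 * s)) := by positivity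
    rw [← hC2, Real.rpow_neg (norm_nonneg _), ← div_eq_mul_inv,
      div_le_div_iff₀ (by positivity) (by positivity)]
    nlinarith

end PoissonConvolution

/-! ### Duality between the kernel and the power. -/

section DistributionalEquation
variable {N : ℕ} {s a : ℝ} {φ : EuclideanSpace ℝ (Fin N) → ℂ}

/-- The weight of `𝓛¹_s` is dominated by the kernel at `t = 1`, `x = 0`, so `ϑ ∈ 𝓛¹_s` follows from
convergence of its Poisson integral. -/
lemma one_div_one_add_rpow_le (hs : 0 < s) (y : EuclideanSpace ℝ (Fin N)) :
    1 / (1 + ‖y‖ ^ ((N : ℝ) + 2 * s)) ≤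
      2 ^ ((N : ℝ) / 2 + s) / poissonConst N s * halfSpacePoissonKernel s 1 (0 - y) := by
  have hp := poissonConst_pos (N := N) hs
  have hr : 0 < (N : ℝ) / 2 + s := by positivity
  rw [halfSpacePoissonKernel_eq one_pos, zero_sub, norm_neg, one_pow, Real.one_rpow, mul_one,
    ← mul_assoc, div_mul_cancel₀ _ hp.ne', Real.rpow_neg (by positivity), ← div_eq_mul_inv,
    div_le_div_iff₀ (by positivity) (by positivity), one_mul]
  have e : ‖y‖ ^ ((N : ℝ) + 2 * s) = (‖y‖ ^ 2) ^ ((N : ℝ) / 2 + s) := by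
    rw [← Real.rpow_natCast, ← Real.rpow_mul (norm_nonneg _)]
    congr 1
    push_cast
    ring
  rw [e]
  have h1 : (‖y‖ ^ 2 + 1) ^ ((N : ℝ) / 2 + s) ≤
      (2 * max (‖y‖ ^ 2) 1) ^ ((N : ℝ) / 2 + s) := by
    refine Real.rpow_le_rpow (by positivity) ?_ hr.le
    linarith [le_max_left (‖y‖ ^ 2) 1, le_max_right (‖y‖ ^ 2) 1]
  rw [Real.mul_rpow (by norm_num) (by positivity)] at h1
  refine h1.trans (mul_le_mul_of_nonneg_left ?_ (by positivity))
  have h0 : 0 ≤ (‖y‖ ^ 2) ^ ((N : ℝ) / 2 + s) := by positivity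
  rcases le_total (‖y‖ ^ 2) 1 with h | h
  · rw [max_eq_right h, Real.one_rpow]
    linarith
  · rw [max_eq_left h]
    linarith

lemma integrable_norm_rpow_div (hs : 0 < s) (ha : 0 < a) (haN : a < N) :
    Integrable (fun x : EuclideanSpace ℝ (Fin N) =>
      ‖x‖ ^ (-a) / (1 + ‖x‖ ^ ((N : ℝ) + 2 * s))) := by
  refine ((integrable_poisson_power hs ha haN one_pos 0).1.const_mul
    (2 ^ ((N : ℝ) / 2 + s) / poissonConst N s)).mono'
    (by fun_prop : Measurable _).aestronglyMeasurable (ae_of_all _ fun y => ?_)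
  rw [Real.norm_of_nonneg (by positivity), ← mul_assoc, div_eq_mul_one_div, mul_comm]
  exact mul_le_mul_of_nonneg_right (one_div_one_add_rpow_le hs y) (by positivity)

lemma integrable_mul_testFunction {f : EuclideanSpace ℝ (Fin N) → ℂ} (hf : ContinuousOn f {0}ᶜ)
    (hφ : Continuous φ) (hc : HasCompactSupport φ) (h0 : tsupport φ ⊆ {0}ᶜ) :
    Integrable (fun x => f x * φ x) := by
  have h1 : IntegrableOn (fun x => f x * φ x) (tsupport φ) :=
    ((hf.mono h0).mul hφ.continuousOn).integrableOn_compact hc.isCompact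
  refine (integrableOn_iff_integrable_of_support_subset fun x hx => ?_).1 h1
  exact subset_tsupport _ (right_ne_zero_of_mul hx)

lemma continuousOn_norm_rpow (r : ℝ) :
    ContinuousOn (fun x : EuclideanSpace ℝ (Fin N) => ‖x‖ ^ r) {0}ᶜ :=
  continuous_norm.continuousOn.rpow_const fun _ hx => Or.inl (norm_ne_zero_iff.2 hx)

lemma continuous_powerProfile_norm_sq (ha : 0 < a) (haN : a < N) {T : ℝ} (hT : 0 < T) :
    Continuous (fun x : EuclideanSpace ℝ (Fin N) => powerProfile N s a T (‖x‖ ^ 2)) := by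
  rw [← continuousOn_univ]
  refine (contDiffOn_powerProfile ha haN).continuousOn.comp
    (f := fun x : EuclideanSpace ℝ (Fin N) => (T, ‖x‖ ^ 2)) (by fun_prop) fun x _ => ?_
  exact ⟨hT, by positivity⟩

lemma stronglyMeasurable_poissonConv (t : ℝ) (hφ : Continuous φ) :
    StronglyMeasurable (poissonConv s t φ) := by
  have hP := measurable_halfSpacePoissonKernel (N := N) (s := s) (t := t)
  have hm := hφ.measurable
  exact StronglyMeasurable.integral_prod_right
    (f := fun x z : EuclideanSpace ℝ (Fin N) => (halfSpacePoissonKernel s t (x - z) : ℂ) * φ z)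
    (by fun_prop : Measurable _).stronglyMeasurable

lemma integrable_prod_poissonConv (hs : 0 < s) (ha : 0 < a) (haN : a < N) {t : ℝ} (ht : 0 < t)
    (hφ : Continuous φ) (hc : HasCompactSupport φ) :
    Integrable (Function.uncurry fun x z : EuclideanSpace ℝ (Fin N) =>
      ((‖x‖ ^ (-a) : ℝ) : ℂ) * ((halfSpacePoissonKernel s t (x - z) : ℂ) * φ z))
      (volume.prod volume) := by
  have hP := measurable_halfSpacePoissonKernel (N := N) (s := s) (t := t)
  have hm := hφ.measurable
  have hsymm : ∀ x z : EuclideanSpace ℝ (Fin N),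
      halfSpacePoissonKernel s t (x - z) = halfSpacePoissonKernel s t (z - x) := fun x z => by
    rw [halfSpacePoissonKernel, halfSpacePoissonKernel, norm_sub_rev]
  refine (integrable_prod_iff' (by fun_prop : Measurable _).aestronglyMeasurable).2
    ⟨ae_of_all _ fun z => ?_, ?_⟩
  · have h : Integrable (fun x => ((halfSpacePoissonKernel s t (z - x) * ‖x‖ ^ (-a) : ℝ) : ℂ) *
        φ z) := (integrable_poisson_power hs ha haN ht z).1.ofReal.mul_const (φ z)
    refine h.congr (ae_of_all _ fun x => ?_)
    simp only [Function.uncurry_apply_pair, hsymm x z]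
    push_cast
    ring
  · have e : ∀ z : EuclideanSpace ℝ (Fin N), ∫ x, ‖Function.uncurry (fun x z =>
        ((‖x‖ ^ (-a) : ℝ) : ℂ) * ((halfSpacePoissonKernel s t (x - z) : ℂ) * φ z)) (x, z)‖ =
        powerProfile N s a (t ^ 2) (‖z‖ ^ 2) * ‖φ z‖ := by
      intro z
      rw [← (integrable_poisson_power hs ha haN ht z).2, ← integral_mul_const]
      congr 1
      funext x
      rw [Function.uncurry_apply_pair, norm_mul, norm_mul, Complex.norm_real, Complex.norm_real,
        Real.norm_of_nonneg (by positivity), Real.norm_of_nonneg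
          (halfSpacePoissonKernel_pos hs ht _).le, hsymm]
      ring
    simp_rw [e]
    exact ((continuous_powerProfile_norm_sq ha haN (by positivity)).mul
      hφ.norm).integrable_of_hasCompactSupport hc.norm.mul_left

/-- Fubini and the evenness of the kernel transfer the convolution from `φ` to the power, where the
explicit profile is known. -/
lemma integral_mul_poissonConv (hs : 0 < s) (ha : 0 < a) (haN : a < N) {t : ℝ} (ht : 0 < t)
    (hφ : Continuous φ) (hc : HasCompactSupport φ) :
    Integrable (fun x => ((‖x‖ ^ (-a) : ℝ) : ℂ) * poissonConv s t φ x) ∧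
    ∫ x, ((‖x‖ ^ (-a) : ℝ) : ℂ) * poissonConv s t φ x =
      ∫ z, (powerProfile N s a (t ^ 2) (‖z‖ ^ 2) : ℂ) * φ z := by
  have hint := integrable_prod_poissonConv hs ha haN ht hφ hc
  constructor
  · refine hint.integral_prod_left.congr (ae_of_all _ fun x => ?_)
    simp only [Function.uncurry_apply_pair]
    rw [integral_const_mul]
    rfl
  · have h1 := integral_integral_swap hint
    simp_rw [integral_const_mul] at h1
    refine h1.trans ?_
    congr 1
    funext z
    rw [← (integrable_poisson_power hs ha haN ht z).2, ← integral_complex_ofReal,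
      ← integral_mul_const]
    congr 1
    funext x
    rw [halfSpacePoissonKernel, halfSpacePoissonKernel, norm_sub_rev]
    push_cast
    ring

/-- L'Hôpital's rule against `T^s` reduces the difference quotient to the known limit of `T^(1-s)
g_T`, divided by `s`. -/
lemma tendsto_powerProfile_sub_div (hs : 0 < s) (hs1 : s < 1) (ha : 0 < a) (haN : a < N) {X : ℝ}
    (hX : 0 < X) :
    Tendsto (fun T => (powerProfile N s a 0 X - powerProfile N s a T X) / T ^ s) (𝓝[>] 0)
      (𝓝 (-(profileSlope N s a / s) * X ^ (-(a / 2 + s)))) := by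
  refine HasDerivAt.lhopital_zero_nhdsGT (f' := fun T => -powerProfileT N s a T X)
    (g' := fun T => s * T ^ (s - 1)) ?_ ?_ ?_ ?_ ?_ ?_
  · filter_upwards [self_mem_nhdsWithin] with T (hT : 0 < T)
    exact (hasDerivAt_powerProfile_fst ha haN hT (by positivity)).const_sub _
  · filter_upwards [self_mem_nhdsWithin] with T (hT : 0 < T)
    exact Real.hasDerivAt_rpow_const (Or.inl hT.ne')
  · filter_upwards [self_mem_nhdsWithin] with T (hT : 0 < T)
    positivity
  · have h := continuousWithinAt_powerProfile (N := N) hs ha haN le_rfl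
      (show 0 < 0 + X by linarith)
    have h2 : Tendsto (fun T : ℝ => (T, X)) (𝓝[>] 0) (𝓝[{z : ℝ × ℝ | 0 ≤ z.1}] (0, X)) := by
      refine tendsto_nhdsWithin_iff.2 ⟨?_, ?_⟩
      · exact ((by fun_prop : Continuous fun T : ℝ => (T, X)).tendsto 0).mono_left
          nhdsWithin_le_nhds
      · filter_upwards [self_mem_nhdsWithin] with T (hT : 0 < T)
        exact hT.le
    have h3 := (h.tendsto.comp h2).const_sub (powerProfile N s a 0 X)
    simpa using h3
  · have h := (Real.continuousAt_rpow_const 0 s (Or.inr hs.le)).tendsto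
    rw [Real.zero_rpow hs.ne'] at h
    exact h.mono_left nhdsWithin_le_nhds
  · have h := (tendsto_rpow_mul_powerProfileT hs hs1 ha haN hX).comp
      (tendsto_id.prodMk (tendsto_const_nhds (x := X)))
    have h2 := h.const_mul (-s⁻¹)
    have e : -s⁻¹ * (profileSlope N s a * X ^ (-(a / 2 + s))) =
        -(profileSlope N s a / s) * X ^ (-(a / 2 + s)) := by ring
    rw [e] at h2
    refine h2.congr' ?_
    filter_upwards [self_mem_nhdsWithin] with T (hT : 0 < T)
    simp only [Function.comp_apply, id]
    rw [show 1 - s = -(s - 1) by ring, Real.rpow_neg hT.le]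
    have := Real.rpow_pos_of_pos hT (s - 1)
    field_simp

end DistributionalEquation

/-! ### Passage to the limit in the two pairings. -/

section DistributionalEquation
variable {N : ℕ} {s a : ℝ} {φ : EuclideanSpace ℝ (Fin N) → ℂ}

lemma tendsto_integral_mul_sub_poissonConv (hs : 0 < s) (hs1 : s < 1) (ha : 0 < a) (haN : a < N)
    (hφ : ContDiff ℝ ∞ φ) (hc : HasCompactSupport φ) :
    Integrable (fun x => ((‖x‖ ^ (-a) : ℝ) : ℂ) * fracLaplacian s φ x) ∧
    Tendsto (fun t : ℝ => ∫ x, ((‖x‖ ^ (-a) : ℝ) : ℂ) *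
        ((((t ^ 2) ^ s : ℝ) : ℂ)⁻¹ * (φ x - poissonConv s t φ x))) (𝓝[>] 0)
      (𝓝 (((Real.Gamma (1 - s) / (s * Real.Gamma s * 2 ^ (2 * s)) : ℝ) : ℂ) *
        ∫ x, ((‖x‖ ^ (-a) : ℝ) : ℂ) * fracLaplacian s φ x)) := by
  have hΓ := Real.Gamma_pos_of_pos hs
  have hΓ' := Real.Gamma_pos_of_pos (show 0 < 1 - s by linarith)
  obtain ⟨c, hcdef⟩ : ∃ c, c = Real.Gamma (1 - s) / (s * Real.Gamma s * 2 ^ (2 * s)) := ⟨_, rfl⟩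
  have hc0 : (c : ℂ) ≠ 0 := by
    rw [hcdef]
    exact_mod_cast (show 0 < Real.Gamma (1 - s) / (s * Real.Gamma s * 2 ^ (2 * s)) by
      positivity).ne'
  obtain ⟨C, hC0, hC⟩ := exists_norm_sub_poissonConv_le hs hs1 hφ hc
  have hlim : ∀ x, Tendsto (fun t : ℝ => ((‖x‖ ^ (-a) : ℝ) : ℂ) *
      ((((t ^ 2) ^ s : ℝ) : ℂ)⁻¹ * (φ x - poissonConv s t φ x))) (𝓝[>] 0)
      (𝓝 (((‖x‖ ^ (-a) : ℝ) : ℂ) * (c * fracLaplacian s φ x))) := fun x => by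
    rw [hcdef]
    exact (tendsto_sub_poissonConv_div hs hs1 hφ hc x).const_mul _
  have hmeas : ∀ t : ℝ, AEStronglyMeasurable (fun x => ((‖x‖ ^ (-a) : ℝ) : ℂ) *
      ((((t ^ 2) ^ s : ℝ) : ℂ)⁻¹ * (φ x - poissonConv s t φ x))) := fun t => by
    have h1 := (stronglyMeasurable_poissonConv (s := s) t hφ.continuous).measurable
    have h2 := hφ.continuous.measurable
    exact (by fun_prop : Measurable _).aestronglyMeasurable
  have hdom : Integrable (fun x : EuclideanSpace ℝ (Fin N) =>
      C * (‖x‖ ^ (-a) / (1 + ‖x‖ ^ ((N : ℝ) + 2 * s)))) :=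
    (integrable_norm_rpow_div hs ha haN).const_mul C
  have hbound : ∀ t : ℝ, 0 < t → ∀ x, ‖((‖x‖ ^ (-a) : ℝ) : ℂ) *
      ((((t ^ 2) ^ s : ℝ) : ℂ)⁻¹ * (φ x - poissonConv s t φ x))‖ ≤
        C * (‖x‖ ^ (-a) / (1 + ‖x‖ ^ ((N : ℝ) + 2 * s))) := fun t ht x => by
    rw [norm_mul, Complex.norm_real, Real.norm_of_nonneg (by positivity)]
    calc _ ≤ ‖x‖ ^ (-a) * (C / (1 + ‖x‖ ^ ((N : ℝ) + 2 * s))) :=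
          mul_le_mul_of_nonneg_left (hC t x ht) (by positivity)
      _ = _ := by ring
  have hint : Integrable (fun x => ((‖x‖ ^ (-a) : ℝ) : ℂ) * (c * fracLaplacian s φ x)) := by
    -- Both measurability and decay of `(-Δ)^s φ` are inherited from the difference quotients
    -- through their pointwise limit.
    refine hdom.mono' (aestronglyMeasurable_of_tendsto_ae (𝓝[>] (0 : ℝ)) hmeas
      (ae_of_all _ hlim)) (ae_of_all _ fun x => le_of_tendsto (hlim x).norm ?_)
    filter_upwards [self_mem_nhdsWithin] with t ht
    exact hbound t ht x
  rw [← hcdef]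
  constructor
  · refine (hint.const_mul (c : ℂ)⁻¹).congr (ae_of_all _ fun x => ?_)
    field_simp
  · rw [← integral_const_mul]
    simp_rw [mul_left_comm (c : ℂ)]
    refine tendsto_integral_filter_of_dominated_convergence _
      (Eventually.of_forall hmeas) ?_ hdom (ae_of_all _ hlim)
    filter_upwards [self_mem_nhdsWithin] with t ht
    exact ae_of_all _ (hbound t ht)

lemma tendsto_integral_powerProfile_sub (hs : 0 < s) (hs1 : s < 1) (ha : 0 < a) (haN : a < N)
    (hφ : Continuous φ) (hc : HasCompactSupport φ) (h0 : tsupport φ ⊆ {0}ᶜ) :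
    Tendsto (fun T : ℝ => ∫ x : EuclideanSpace ℝ (Fin N), (((powerProfile N s a 0 (‖x‖ ^ 2) -
        powerProfile N s a T (‖x‖ ^ 2)) / T ^ s : ℝ) : ℂ) * φ x) (𝓝[>] 0)
      (𝓝 (∫ x : EuclideanSpace ℝ (Fin N), ((-(profileSlope N s a / s) *
        (‖x‖ ^ 2) ^ (-(a / 2 + s)) : ℝ) : ℂ) * φ x)) := by
  obtain ⟨K, hK0, hK⟩ := exists_powerProfile_sub_le_fst N hs hs1 ha haN
  -- At the origin the values of the profile and of the powers are conventional; they play no role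
  -- because `φ` vanishes there.
  have hφ0 : φ 0 = 0 := by
    by_contra h
    exact h0 (subset_tsupport _ h) rfl
  have hdom : Integrable (fun x : EuclideanSpace ℝ (Fin N) =>
      ‖((K * ‖x‖ ^ (-(a + 2 * s)) : ℝ) : ℂ) * φ x‖) := by
    refine (integrable_mul_testFunction ?_ hφ hc h0).norm
    exact Complex.continuous_ofReal.comp_continuousOn
      ((continuousOn_norm_rpow _).const_mul K |>.congr fun _ _ => rfl)
  have hpow : ∀ x : EuclideanSpace ℝ (Fin N),
      (‖x‖ ^ 2) ^ (-(a / 2 + s)) = ‖x‖ ^ (-(a + 2 * s)) := fun x => by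
    rw [← Real.rpow_natCast, ← Real.rpow_mul (norm_nonneg _)]
    congr 1
    push_cast
    ring
  refine tendsto_integral_filter_of_dominated_convergence _ ?_ ?_ hdom (ae_of_all _ fun x => ?_)
  · filter_upwards [self_mem_nhdsWithin] with T (hT : 0 < T)
    have h1 := (continuous_powerProfile_norm_sq (N := N) (s := s) ha haN hT).continuousOn
      (s := ({0} : Set (EuclideanSpace ℝ (Fin N)))ᶜ)
    have h2 : ContinuousOn (fun x : EuclideanSpace ℝ (Fin N) => powerProfile N s a 0 (‖x‖ ^ 2))
        {0}ᶜ := by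
      refine ((continuous_norm.pow 2).continuousOn.rpow_const fun x hx => Or.inl ?_).congr
        fun x hx => powerProfile_zero hs ha (pow_pos (norm_pos_iff.2 hx) 2)
      exact (pow_pos (norm_pos_iff.2 hx) 2).ne'
    exact (integrable_mul_testFunction (Complex.continuous_ofReal.comp_continuousOn
      ((h2.sub h1).div_const (T ^ s))) hφ hc h0).aestronglyMeasurable
  · filter_upwards [self_mem_nhdsWithin] with T (hT : 0 < T)
    refine ae_of_all _ fun x => ?_
    rcases eq_or_ne x 0 with rfl | hx
    · simp [hφ0]
    have hX : 0 < ‖x‖ ^ 2 := pow_pos (norm_pos_iff.2 hx) 2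
    have hTs : 0 < T ^ s := Real.rpow_pos_of_pos hT s
    rw [norm_mul, norm_mul, Complex.norm_real, Complex.norm_real,
      Real.norm_of_nonneg (by positivity : 0 ≤ K * ‖x‖ ^ (-(a + 2 * s)))]
    refine mul_le_mul_of_nonneg_right ?_ (norm_nonneg _)
    -- The increment estimate at `X = |x|²` with lower bound `ε = |x|²`; dividing by `T^s` gives a
    -- majorant independent of `T`.
    have h := hK (‖x‖ ^ 2) 0 T (‖x‖ ^ 2) hX le_rfl hT.le hX.le (by linarith)
    rw [Real.zero_rpow hs.ne', sub_zero, hpow] at h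
    rwa [norm_div, Real.norm_eq_abs, Real.norm_of_nonneg hTs.le, div_le_iff₀ hTs]
  · rcases eq_or_ne x 0 with rfl | hx
    · simp [hφ0]
    exact ((Complex.continuous_ofReal.tendsto _).comp (tendsto_powerProfile_sub_div hs hs1 ha haN
      (pow_pos (norm_pos_iff.2 hx) 2))).mul_const _

/-- The same quantity has two limits: on one side `c` times the pairing with `(-Δ)^s φ`, on the
other the pairing of `φ` with the slope of the profile. The constants agree because `κ_s = 2sc` and
`κ_s γ` is `-2` times the slope. -/
lemma integral_norm_rpow_mul_fracLaplacian (hs : 0 < s) (hs1 : s < 1) (ha : 0 < a) (haN : a < N)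
    (hφ : ContDiff ℝ ∞ φ) (hc : HasCompactSupport φ) (h0 : tsupport φ ⊆ {0}ᶜ) :
    ∫ x, ((‖x‖ ^ (-a) : ℝ) : ℂ) * fracLaplacian s φ x =
      ∫ x, ((powerGamma N s a * ‖x‖ ^ (-2 * s) * ‖x‖ ^ (-a) : ℝ) : ℂ) * φ x := by
  have hΓ := Real.Gamma_pos_of_pos hs
  have hΓ' := Real.Gamma_pos_of_pos (show 0 < 1 - s by linarith)
  have hφ0 : φ 0 = 0 := by
    by_contra h
    exact h0 (subset_tsupport _ h) rfl
  have hsq : Tendsto (fun t : ℝ => t ^ 2) (𝓝[>] 0) (𝓝[>] 0) := by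
    refine tendsto_nhdsWithin_iff.2 ⟨?_, ?_⟩
    · have : Tendsto (fun t : ℝ => t ^ 2) (𝓝 0) (𝓝 (0 ^ 2)) := (continuous_pow 2).tendsto 0
      rw [zero_pow two_ne_zero] at this
      exact this.mono_left nhdsWithin_le_nhds
    · filter_upwards [self_mem_nhdsWithin] with t (ht : 0 < t)
      exact pow_pos ht 2
  have hL := (tendsto_integral_mul_sub_poissonConv hs hs1 ha haN hφ hc).2
  have hR := (tendsto_integral_powerProfile_sub hs hs1 ha haN hφ.continuous hc h0).comp hsq
  have heq := tendsto_nhds_unique (hL.congr' ?_) hR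
  · obtain ⟨c, hcdef⟩ : ∃ c, c = Real.Gamma (1 - s) / (s * Real.Gamma s * 2 ^ (2 * s)) :=
      ⟨_, rfl⟩
    have hc0 : 0 < c := by
      rw [hcdef]
      positivity
    have hκ : -(profileSlope N s a / s) = c * powerGamma N s a := by
      have h := kappa_mul_powerGamma (N := N) hs hs1 ha haN
      have h2 : kappa s = 2 * s * c := by
        rw [hcdef, kappa, Real.rpow_sub_one two_ne_zero]
        field_simp
      rw [h2] at h
      field_simp
      linarith
    rw [← hcdef] at heq
    have hc0' : (c : ℂ) ≠ 0 := by exact_mod_cast hc0.ne'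
    refine mul_left_cancel₀ hc0' (heq.trans ?_)
    rw [← integral_const_mul]
    congr 1
    funext x
    rcases eq_or_ne x 0 with rfl | hx
    · simp [hφ0]
    have hx0 := norm_pos_iff.2 hx
    have e : (‖x‖ ^ 2) ^ (-(a / 2 + s)) = ‖x‖ ^ (-2 * s) * ‖x‖ ^ (-a) := by
      rw [← Real.rpow_natCast, ← Real.rpow_mul (norm_nonneg _), ← Real.rpow_add hx0]
      congr 1
      push_cast
      ring
    rw [e, hκ]
    push_cast
    ring
  · filter_upwards [self_mem_nhdsWithin] with t (ht : 0 < t)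
    have hϑφ : Integrable (fun x => ((‖x‖ ^ (-a) : ℝ) : ℂ) * φ x) :=
      integrable_mul_testFunction (Complex.continuous_ofReal.comp_continuousOn
        (continuousOn_norm_rpow _)) hφ.continuous hc h0
    have hΥφ : Integrable (fun x : EuclideanSpace ℝ (Fin N) =>
        (powerProfile N s a (t ^ 2) (‖x‖ ^ 2) : ℂ) * φ x) :=
      integrable_mul_testFunction (Complex.continuous_ofReal.comp
        (continuous_powerProfile_norm_sq ha haN (by positivity))).continuousOn hφ.continuous hc h0
    obtain ⟨hi, he⟩ := integral_mul_poissonConv hs ha haN ht hφ.continuous hc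
    obtain ⟨d, hd⟩ : ∃ d : ℝ, d = (t ^ 2) ^ s := ⟨_, rfl⟩
    simp only [Function.comp_apply, ← hd]
    have e1 : ∀ x, ((‖x‖ ^ (-a) : ℝ) : ℂ) * ((d : ℂ)⁻¹ * (φ x - poissonConv s t φ x)) =
        (d : ℂ)⁻¹ * (((‖x‖ ^ (-a) : ℝ) : ℂ) * φ x -
          ((‖x‖ ^ (-a) : ℝ) : ℂ) * poissonConv s t φ x) := fun x => by ring
    have e2 : ∀ x : EuclideanSpace ℝ (Fin N), (((powerProfile N s a 0 (‖x‖ ^ 2) -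
        powerProfile N s a (t ^ 2) (‖x‖ ^ 2)) / d : ℝ) : ℂ) * φ x =
        (d : ℂ)⁻¹ * (((‖x‖ ^ (-a) : ℝ) : ℂ) * φ x -
          (powerProfile N s a (t ^ 2) (‖x‖ ^ 2) : ℂ) * φ x) := fun x => by
      rcases eq_or_ne x 0 with rfl | hx
      · simp [hφ0]
      have e : (‖x‖ ^ 2) ^ (-(a / 2)) = ‖x‖ ^ (-a) := by
        rw [← Real.rpow_natCast, ← Real.rpow_mul (norm_nonneg _)]
        congr 1
        push_cast
        ring
      rw [powerProfile_zero hs ha (pow_pos (norm_pos_iff.2 hx) 2), e]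
      push_cast
      ring
    simp_rw [e1, e2]
    rw [integral_const_mul, integral_const_mul, integral_sub hϑφ hi, integral_sub hϑφ hΥφ, he]

theorem fracLaplacianEqOn_power (hs : 0 < s) (hs1 : s < 1) (ha : 0 < a) (haN : a < N) :
    FracLaplacianEqOn s {0}ᶜ (fun x : EuclideanSpace ℝ (Fin N) => ‖x‖ ^ (-a))
      (fun x => powerGamma N s a * ‖x‖ ^ (-2 * s) * ‖x‖ ^ (-a)) := by
  refine ⟨⟨(by fun_prop : Measurable _).aestronglyMeasurable, ?_⟩, ?_, fun φ hφ hc h0 =>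
    ⟨(tendsto_integral_mul_sub_poissonConv hs hs1 ha haN hφ hc).1,
      integral_norm_rpow_mul_fracLaplacian hs hs1 ha haN hφ hc h0⟩⟩
  · refine (integrable_norm_rpow_div hs ha haN).congr (ae_of_all _ fun x => ?_)
    simp only [abs_of_nonneg (Real.rpow_nonneg (norm_nonneg x) (-a))]
  · exact ContinuousOn.locallyIntegrableOn (((continuousOn_norm_rpow _).const_mul _).mul
      (continuousOn_norm_rpow _)) (measurableSet_singleton 0).compl

end DistributionalEquation

/-! ### Assembly with `a = N/2 - s - α`. -/

theorem mainTheorem5 (N : ℕ) (s : ℝ) (hs0 : 0 < s) (hs1 : s < 1) :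
    -- on `[0, N/2 - s)` the map `α ↦ γ_α` is continuous and (strictly) decreasing
    (ContinuousOn (hardyGamma N s) (Set.Ico 0 ((N : ℝ) / 2 - s)) ∧
      StrictAntiOn (hardyGamma N s) (Set.Ico 0 ((N : ℝ) / 2 - s))) ∧
    ∀ α ∈ Set.Ioo (-(N : ℝ) / 2 - s) ((N : ℝ) / 2 - s),
      -- `(-Δ)^s ϑ_α = γ_α |x|^(-2s) ϑ_α` on `ℝᴺ ∖ {0}`, in the sense of distributions
      FracLaplacianEqOn s {0}ᶜ (powerFun N s α)
        (fun x => hardyGamma N s α * ‖x‖ ^ (-2 * s) * powerFun N s α x) ∧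
      -- the Poisson extension of `ϑ_α` is positive on the closed half-space minus the origin
      (∀ z ∈ closedUpperHalfPunctured N, 0 < poissonExtension s (powerFun N s α) z) ∧
      -- it is Hölder continuous there, away from the origin
      (∃ β : NNReal, 0 < β ∧ β < 1 ∧
        LocallyHolderOn β (poissonExtension s (powerFun N s α)) (closedUpperHalfPunctured N)) ∧
      -- it solves the extension equation in the open half-space
      ContDiffOn ℝ ∞ (poissonExtension s (powerFun N s α)) (upperHalf N) ∧
      (∀ z ∈ upperHalf N,
        weightedDiv s (poissonExtension s (powerFun N s α)) z.1 z.2 = 0) ∧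
      -- it has the boundary values `ϑ_α`
      (∀ x : EuclideanSpace ℝ (Fin N), x ≠ 0 →
        poissonExtension s (powerFun N s α) (0, x) = powerFun N s α x) ∧
      -- `- lim_{t → 0+} t^(1-2s) ∂_t Υ_α = κ_s γ_α |x|^(-2s) ϑ_α` on `ℝᴺ ∖ {0}`
      TendstoLocallyUniformlyOn
        (fun (t : ℝ) (x : EuclideanSpace ℝ (Fin N)) =>
          -(t ^ (1 - 2 * s) * partialT (poissonExtension s (powerFun N s α)) t x))
        (fun x => kappa s * (hardyGamma N s α * ‖x‖ ^ (-2 * s) * powerFun N s α x))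
        (𝓝[>] 0) {0}ᶜ ∧
      -- for `α > 0` the gradient is in `L²(B_+(0, R); t^(1-2s))` for every `R > 0`
      (0 < α → ∀ R : ℝ, 0 < R →
        IntegrableOn (fun z : ℝ × EuclideanSpace ℝ (Fin N) =>
          z.1 ^ (1 - 2 * s) * gradSq (poissonExtension s (powerFun N s α)) z.1 z.2)
          (upperHalfBall N R)) := by
  refine ⟨⟨continuousOn_hardyGamma hs0, strictAntiOn_hardyGamma hs0⟩, fun α ⟨hα0, hα1⟩ => ?_⟩
  have ha : 0 < (N : ℝ) / 2 - s - α := by linarith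
  have haN : (N : ℝ) / 2 - s - α < N := by
    have : -(N : ℝ) / 2 = -(N / 2) := by ring
    linarith
  have hγ : hardyGamma N s α = powerGamma N s ((N : ℝ) / 2 - s - α) := hardyGamma_eq N s α
  rw [hγ, powerFun_eq]
  refine ⟨fracLaplacianEqOn_power hs0 hs1 ha haN,
    fun z hz => poissonExtension_power_pos hs0 ha haN hz,
    ⟨s.toNNReal, Real.toNNReal_pos.2 hs0, ?_,
      locallyHolderOn_poissonExtension_power hs0 hs1 ha haN⟩,
    contDiffOn_poissonExtension_power hs0 ha haN,
    fun z hz => weightedDiv_poissonExtension_power hs0 ha haN hz z.2,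
    fun x _ => by simp [poissonExtension],
    tendsto_normal_derivative hs0 hs1 ha haN,
    fun hα R hR => integrableOn_weighted_gradSq hs0 hs1 ha haN (by linarith) hR⟩
  rw [← NNReal.coe_lt_coe, Real.coe_toNNReal _ hs0.le]
  exact hs1
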